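/- **Setting.** Let $q=e^{\eta}$ with $\operatorname{Re}\eta<0$ (so $0<|q|<1$) and $\lambda=e^{\ell}\neq0$; powers mean $q^{z}=e^{\eta z}$, $\lambda^{z}=e^{\ell z}$. Let $F\ge1$ and let the sites $f=1,\dots,F$ be taken cyclically, $F+1\sim1$. Let $\mathbf u_f,\mathbf v_f$ be the generators of the half-integer ultra-local Weyl algebra, $\mathbf u_f\mathbf v_f=q^{1/2}\mathbf v_f\mathbf u_f$ (generators at different sites commute), acting on the space with basis $|k\rangle$, $k\in\mathbb Z^F$, where $\mathbf u_f|k\rangle=q^{(\sigma_f+k_f)/2}|k\rangle$, $\mathbf v_f|k\rangle=|k+e_f\rangle$ and $\sigma\in\mathbb C^F$ is arbitrary. Put $x=q^{\theta/2}$, $\theta\in\mathbb C$, and let $\mathbf s_f$ be the diagonal operator with eigenvalue $\theta+\sigma_f+k_f$ on $|k\rangle$, so that $x^2\mathbf u_f^2=q^{\mathbf s_f}$; the substitution $x^2\mapsto q^{-1}x^2$ means $\theta\mapsto\theta-1$. All infinite sums of operators, and the sums that define products of formal operators, are understood, and asserted to converge, matrix element by matrix element. Let $L_f(x)=\begin{pmatrix}x\mathbf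 u_f-(x\mathbf u_f)^{-1}&\mathbf v_f\\ q^{-1/2}\lambda\mathbf v_f^{-1}&0\end{pmatrix}$ and $T(x^2)=\big((-x)^F\prod_f\mathbf u_f\big)\operatorname{tr}(L_1(x)\cdots L_F(x))$. Then $T(x^2)=\sum_{j=0}^F(-x^2)^{F-j}t_j$ with commuting $t_j$, $t_F=1$, $t_0=\prod_f\mathbf u_f^2$; put $\bar t_j=t_0^{-1}t_{F-j}$. For commuting $\{t_j\}$ with $t_F=1$ define the formal series in $X$ $$J(X,\lambda,\{t\})=\Big(\prod_{k\ge1}T(q^kX)\Big)\sum_{k\ge0}\big(-(-\lambda)^Ft_0\big)^kc_k(X),\quad c_0=1,\quad c_k(X)=\sum_{j\ge1}\frac{(q^jX)^F\,c_{k-1}(q^{1+j}X)}{T(q^jX)\,T(q^{1+j}X)}.$$ For both $\{t\}$ and $\{\bar t\}$ (the latter with $T$ replaced by $\overline T(X)=\sum_j(-X)^{F-j}\bar t_j$), $J$ is the unique formal power series solution with constant term $1$ of the Baxter equation $T(X)Q(X)=\big((-\lambda X)^Ft_0\big)Q(qX)+Q(q^{-1}X)$. Define $$Q_+(x^2)=J(x^2,\lambda,\{t\}),\qquad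 Q_-(x^2)=\lambda^{-\sum_f\mathbf s_f}J(x^{-2},\lambda,\{\bar t\}),$$ $$W(x^2)=Q_+(q^{-1}x^2)Q_-(x^2)-Q_+(x^2)Q_-(q^{-1}x^2);$$ the two power series converge for every $x\ne0$, and so do the sums defining the products in $W$. Let $(x;q)_\infty=\prod_{n\ge0}(1-q^nx)$, $(x;q)_n=\prod_{k=0}^{n-1}(1-q^kx)$, and $\mathbf g_{\alpha,\beta}(n,m)=q^{nm}\alpha^n\beta^m\,(q^{1+n};q)_\infty(q^{1+m};q)_\infty/(q;q)_\infty$; for operators $\mathbf Y$, $(\mathbf Y;q)_\infty=\sum_{n\ge0}q^{n(n-1)/2}(-\mathbf Y)^n/(q;q)_n$. Write $(\mathbf{uv})_f=\mathbf u_f\mathbf v_f$. **Proposition.** 1. $\displaystyle Q_+(x^2)=\sum_{\{n_f\ge0\}}\Big(\prod_f\mathbf g_{1,\lambda}(n_f+\mathbf s_f,n_f)\Big)\prod_f(\mathbf{uv})_f^{\,n_{f+1}-n_f}.$ 2. $\displaystyle Q_-(x^2)=\sum_{\{n_f\ge0\}}\Big(\prod_f\mathbf g_{1,\lambda}(n_f,n_f-\mathbf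 s_f)\Big)\prod_f(\mathbf{uv})_f^{\,n_f-n_{f-1}}.$ 3. $\displaystyle W(x^2)=\Big(\prod_f(q^{\mathbf s_f};q)_\infty(q^{1-\mathbf s_f};q)_\infty\lambda^{-\mathbf s_f}\Big)\cdot\prod_f\Big(\frac{\lambda(\mathbf{uv})_f}{(\mathbf{uv})_{f+1}};q\Big)_\infty$, the last product being the convergent multiple series obtained by multiplying out the $F$ commuting series. 4. Let $\mathbf a|N\rangle=|N-1\rangle$, $\mathbf a|0\rangle=0$, $\mathbf a^+|N\rangle=[N+1]\,|N+1\rangle$ on the $q$-oscillator space with basis $|N\rangle$, $N=0,1,2,\dots$, where $[N]=-q^{1/2}\lambda^{-1}(1-q^{-N})$; let $\mathbf N|N\rangle=N|N\rangle$ and $$M_f(x)=\mathbf g_{1,\lambda}(\mathbf N,\mathbf N-\mathbf s_f)+\sum_{n\ge1}\mathbf a^n\,\mathbf g_{1,\lambda}(\mathbf N,\mathbf N-\mathbf s_f)\,(x\mathbf u_f\mathbf v_f)^n+\sum_{n\ge1}(\lambda x\mathbf u_f\mathbf v_f^{-1})^n\,\mathbf g_{1,\lambda}(\mathbf N,\mathbf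 N-\mathbf s_f)\,(\mathbf a^+)^n .$$ Then $Q_-(x^2)$ is the trace of $M_1(x)\cdots M_F(x)$ over the $q$-oscillator space. 5. Let all $\sigma_f$ be equal, let the auxiliary space $h$ be a copy of the space of one site (basis $|\kappa\rangle$, $\kappa\in\mathbb Z$), let $P_{h,f}$ be the permutation of $h$ with the $f$-th site, and $M_f=\sum_{n\ge0}\mathbf g_{1,\lambda}(n+\mathbf s_f,n)(\mathbf{uv})_f^{-n}P_{h,f}(\mathbf{uv})_f^n$. Let $P$ be the cyclic shift, $P|k_1,\dots,k_F\rangle=|k_2,\dots,k_F,k_1\rangle$ (so $\mathbf u_fP=P\mathbf u_{f+1}$, $\mathbf v_fP=P\mathbf v_{f+1}$). Then $Q_+(x^2)\,P=P\,Q_+(x^2)=\operatorname{tr}_h(M_1\cdots M_F)$. -/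

import Mathlib

namespace RelToda

/-! ## The Baxter series attached to a family of coefficients

`A` is any complex algebra with a topology; a power series is a formal series in the
spectral variable `X` with coefficients in `A`, and all limits are taken coefficientwise. -/

section BaxterSeries

/-- The substitution `φ(X) ↦ φ(c X)`. -/
noncomputable def dilate {A : Type*} [Ring A] [Algebra ℂ A] (c : ℂ) (φ : PowerSeries A) :
    PowerSeries A :=
  PowerSeries.mk fun N => c ^ N • PowerSeries.coeff N φ

/-- `T(X) = ∑_{j=0}^F (-X)^{F-j} t_j`. -/
noncomputable def transferSeries {A : Type*} [Ring A] (F : ℕ) (t : ℕ → A) : PowerSeries A :=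
  ∑ j ∈ Finset.range (F + 1), PowerSeries.monomial (F - j) ((-1) ^ (F - j) * t j)

/-- The (two-sided) inverse of a power series with constant term `1`. -/
noncomputable def seriesInv {A : Type*} [Ring A] (φ : PowerSeries A) : PowerSeries A :=
  PowerSeries.invOfUnit φ 1

/-- The infinite product `∏_{k ≥ 1} T(q^k X)`: coefficientwise limit of the partial products. -/
noncomputable def transferProd {A : Type*} [Ring A] [Algebra ℂ A] [TopologicalSpace A]
    (F : ℕ) (q : ℂ) (t : ℕ → A) : PowerSeries A :=
  PowerSeries.mk fun N => Filter.limUnder Filter.atTop fun K : ℕ => PowerSeries.coeff N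
    ((List.ofFn fun k : Fin K => dilate (q ^ ((k : ℕ) + 1)) (transferSeries F t)).prod)

/-- `c_0 = 1` and
`c_k(X) = ∑_{j ≥ 1} (q^j X)^F c_{k-1}(q^{1+j} X) / (T(q^j X) T(q^{1+j} X))`. -/
noncomputable def cSeries {A : Type*} [Ring A] [Algebra ℂ A] [TopologicalSpace A]
    (F : ℕ) (q : ℂ) (t : ℕ → A) : ℕ → PowerSeries A
  | 0 => 1
  | k + 1 => PowerSeries.mk fun N => ∑' j : ℕ, PowerSeries.coeff N
      (dilate (q ^ (j + 1)) (PowerSeries.X ^ F) * dilate (q ^ (j + 2)) (cSeries F q t k)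
        * seriesInv (dilate (q ^ (j + 1)) (transferSeries F t))
        * seriesInv (dilate (q ^ (j + 2)) (transferSeries F t)))

/-- `J(X, λ, {t}) = (∏_{k ≥ 1} T(q^k X)) ∑_{k ≥ 0} (-(-λ)^F t_0)^k c_k(X)`. -/
noncomputable def baxterJ {A : Type*} [Ring A] [Algebra ℂ A] [TopologicalSpace A]
    (F : ℕ) (q lam : ℂ) (t : ℕ → A) : PowerSeries A :=
  transferProd F q t * PowerSeries.mk fun N => ∑' k : ℕ,
    (-((-lam) ^ F • t 0)) ^ k * PowerSeries.coeff N (cSeries F q t k)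

/-- The Baxter equation `T(X) Q(X) = ((-λ X)^F t_0) Q(q X) + Q(q⁻¹ X)`. -/
def IsBaxterSolution {A : Type*} [Ring A] [Algebra ℂ A]
    (F : ℕ) (q lam : ℂ) (t : ℕ → A) (Q : PowerSeries A) : Prop :=
  transferSeries F t * Q =
    PowerSeries.monomial F ((-lam) ^ F • t 0) * dilate q Q + dilate q⁻¹ Q

end BaxterSeries

/-! ## The transfer matrix

`A` is a complex algebra, `u_f`, `v_f` are invertible elements of it and `qh` is `q^{1/2}`. -/

section Transfer

/-- The Lax operator `L_f(x)`, with entries Laurent polynomials in `x`. -/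
noncomputable def laxMatrix {A : Type*} [Ring A] [Algebra ℂ A] (qh lam : ℂ) (u v : Aˣ) :
    Matrix (Fin 2) (Fin 2) (LaurentPolynomial A) :=
  !![LaurentPolynomial.C u.val * LaurentPolynomial.T 1
        - LaurentPolynomial.C (u⁻¹).val * LaurentPolynomial.T (-1),
      LaurentPolynomial.C v.val;
      LaurentPolynomial.C ((qh⁻¹ * lam) • (v⁻¹).val),
      0]

/-- `T(x²) = ((-x)^F ∏_f u_f) tr (L_1(x) ⋯ L_F(x))`, as a Laurent polynomial in `x`. -/
noncomputable def transferMatrix {A : Type*} [Ring A] [Algebra ℂ A] {F : ℕ} (qh lam : ℂ)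
    (u v : Fin F → Aˣ) : LaurentPolynomial A :=
  (-LaurentPolynomial.T 1) ^ F * LaurentPolynomial.C ((List.ofFn u).prod).val
    * (List.ofFn fun f => laxMatrix qh lam (u f) (v f)).prod.trace

/-- `∑_{j=0}^F (-x²)^{F-j} t_j`, as a Laurent polynomial in `x`. -/
noncomputable def transferLaurent {A : Type*} [Ring A] (F : ℕ) (t : ℕ → A) :
    LaurentPolynomial A :=
  ∑ j ∈ Finset.range (F + 1), (-LaurentPolynomial.T 2) ^ (F - j) * LaurentPolynomial.C (t j)

/-- The coefficients `t_j` in `T(x²) = ∑_{j=0}^F (-x²)^{F-j} t_j`. -/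
noncomputable def transferCoeff {A : Type*} [Ring A] [Algebra ℂ A] {F : ℕ} (qh lam : ℂ)
    (u v : Fin F → Aˣ) (j : ℕ) : A :=
  (-1) ^ (F - j) * (transferMatrix qh lam u v).coeff (2 * (F - j : ℕ))

end Transfer

/-! ## The quantum space and its operators

Throughout `q = exp η` and `λ = exp ℓ`, with `q ^ z = exp (η z)`, `λ ^ z = exp (ℓ z)`.
The sites are `f : Fin F`, with `f + 1` and `f - 1` understood cyclically. The quantum space has
the basis `|k⟩`, `k : Fin F → ℤ`; `u_f` is diagonal with the `q`-equidistant spectrum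
`q ^ ((σ_f + k_f) / 2)` and `v_f` raises `k_f` by one. -/

/-- Operators (finite on each basis vector) of the quantum space. -/
abbrev Op (F : ℕ) : Type := Module.End ℂ ((Fin F → ℤ) →₀ ℂ)

/-- Formal operators: arbitrary infinite matrices `A k' k = ⟨k'|A|k⟩`. Their topology is that of
entrywise convergence. -/
abbrev FormalOp (F : ℕ) : Type := Matrix (Fin F → ℤ) (Fin F → ℤ) ℂ

/-- The matrix of an operator. -/
noncomputable def toFormal {F : ℕ} (a : Op F) : FormalOp F :=
  fun k' k => a (Finsupp.single k 1) k'

/-- Convergence of operators is convergence of all matrix elements. -/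
noncomputable instance opTopology (F : ℕ) : TopologicalSpace (Op F) :=
  TopologicalSpace.induced toFormal inferInstance

instance opT2Space (F : ℕ) : T2Space (Op F) :=
  T2Space.of_injective_continuous
    (f := toFormal) (fun a b h => by
      refine Finsupp.lhom_ext' fun k => LinearMap.ext_ring (Finsupp.ext fun k' => ?_)
      exact congrFun (congrFun h k') k) continuous_induced_dom

/-- All the sums defining the product of two formal operators converge. -/
def FormalOp.Composable {F : ℕ} (A B : FormalOp F) : Prop :=
  ∀ k' k, Summable fun j => A k' j * B j k

/-- The product of formal operators. -/
noncomputable def FormalOp.comp {F : ℕ} (A B : FormalOp F) : FormalOp F :=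
  fun k' k => ∑' j, A k' j * B j k

/-- The diagonal operator `|k⟩ ↦ d(k) |k⟩`. -/
noncomputable def diagOp {F : ℕ} (d : (Fin F → ℤ) → ℂ) : Op F :=
  Finsupp.linearCombination ℂ fun k => Finsupp.single k (d k)

/-- The shift `|k⟩ ↦ |k + m⟩`. -/
noncomputable def shiftOp {F : ℕ} (m : Fin F → ℤ) : Op F :=
  Finsupp.linearCombination ℂ fun k => Finsupp.single (k + m) 1

theorem diagOp_single {F : ℕ} (d : (Fin F → ℤ) → ℂ) (k : Fin F → ℤ) (c : ℂ) :
    diagOp d (Finsupp.single k c) = Finsupp.single k (c * d k) := by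
  simp [diagOp]

theorem shiftOp_single {F : ℕ} (m k : Fin F → ℤ) (c : ℂ) :
    shiftOp m (Finsupp.single k c) = Finsupp.single (k + m) c := by
  simp [shiftOp]

theorem diagOp_mul_eq_one {F : ℕ} (d e : (Fin F → ℤ) → ℂ) (h : ∀ k, d k * e k = 1) :
    diagOp d * diagOp e = 1 := by
  refine Finsupp.lhom_ext fun k c => ?_
  rw [Module.End.mul_apply, diagOp_single, diagOp_single, mul_assoc, mul_comm (e k), h k, mul_one]
  rfl

theorem shiftOp_mul_eq_one {F : ℕ} (m m' : Fin F → ℤ) (h : m' + m = 0) :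
    shiftOp m * shiftOp m' = 1 := by
  refine Finsupp.lhom_ext fun k c => ?_
  rw [Module.End.mul_apply, shiftOp_single, shiftOp_single, add_assoc, h, add_zero]
  rfl

/-- The generator `u_f`. -/
noncomputable def uOp {F : ℕ} (η : ℂ) (σ : Fin F → ℂ) (f : Fin F) : (Op F)ˣ where
  val := diagOp fun k => Complex.exp (η * (σ f + k f) / 2)
  inv := diagOp fun k => Complex.exp (-(η * (σ f + k f) / 2))
  val_inv := diagOp_mul_eq_one _ _ fun k => by rw [← Complex.exp_add]; simp
  inv_val := diagOp_mul_eq_one _ _ fun k => by rw [← Complex.exp_add]; simp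

/-- The generator `v_f`. -/
noncomputable def vOp {F : ℕ} (f : Fin F) : (Op F)ˣ where
  val := shiftOp (Pi.single f 1)
  inv := shiftOp (-Pi.single f 1)
  val_inv := shiftOp_mul_eq_one _ _ (neg_add_cancel _)
  inv_val := shiftOp_mul_eq_one _ _ (add_neg_cancel _)

/-- The half-integer Weyl relation `u_f v_f = q^{1/2} v_f u_f`. -/
theorem weyl_relation {F : ℕ} (η : ℂ) (σ : Fin F → ℂ) (f : Fin F) :
    (uOp η σ f : Op F) * (vOp f : Op F) =
      Complex.exp (η / 2) • ((vOp f : Op F) * (uOp η σ f : Op F)) := by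
  refine Finsupp.lhom_ext fun k c => ?_
  simp only [uOp, vOp, Module.End.mul_apply, LinearMap.smul_apply, diagOp_single, shiftOp_single,
    Finsupp.smul_single, smul_eq_mul, Pi.add_apply, Pi.single_eq_same]
  congr 1
  rw [mul_left_comm, ← Complex.exp_add]
  push_cast
  ring_nf

/-- Generators at different sites commute; here `u_f` and `v_g`. -/
theorem ultralocality {F : ℕ} (η : ℂ) (σ : Fin F → ℂ) (f g : Fin F) (h : f ≠ g) :
    (uOp η σ f : Op F) * (vOp g : Op F) = (vOp g : Op F) * (uOp η σ f : Op F) := by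
  refine Finsupp.lhom_ext fun k c => ?_
  simp only [uOp, vOp, Module.End.mul_apply, diagOp_single, shiftOp_single, Pi.add_apply,
    Pi.single_eq_of_ne h, add_zero]

/-- The product `(uv)_f = u_f v_f`. -/
noncomputable def uvOp {F : ℕ} (η : ℂ) (σ : Fin F → ℂ) (f : Fin F) : (Op F)ˣ :=
  uOp η σ f * vOp f

/-- The monomial `∏_f (uv)_f^{m_f}`. -/
noncomputable def uvMonomial {F : ℕ} (η : ℂ) (σ : Fin F → ℂ) (m : Fin F → ℤ) : (Op F)ˣ :=
  (List.ofFn fun f => uvOp η σ f ^ m f).prod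

/-- The eigenvalue of `s_f` on `|k⟩`, where `q^{s_f} = x² u_f²` and `x = q^{θ/2}`. -/
def sVal {F : ℕ} (σ : Fin F → ℂ) (θ : ℂ) (k : Fin F → ℤ) (f : Fin F) : ℂ :=
  θ + σ f + k f

/-- The coefficients `t_j` of the transfer matrix of the chain. -/
noncomputable def tCoeff (F : ℕ) (η ℓ : ℂ) (σ : Fin F → ℂ) (j : ℕ) : Op F :=
  transferCoeff (Complex.exp (η / 2)) (Complex.exp ℓ) (uOp η σ) vOp j

/-- `t̄_j = t_0⁻¹ t_{F-j}`. -/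
noncomputable def tBar (F : ℕ) (η ℓ : ℂ) (σ : Fin F → ℂ) (j : ℕ) : Op F :=
  Ring.inverse (tCoeff F η ℓ σ 0) * tCoeff F η ℓ σ (F - j)

/-! ## The two `Q`-operators and their Wronskian -/

/-- The term of degree `N` in `x²` of `Q_+(x²) = J(x², λ, {t})`, at `x² = q^θ`. -/
noncomputable def qPlusTerm (F : ℕ) (η ℓ : ℂ) (σ : Fin F → ℂ) (θ : ℂ) (N : ℕ) : FormalOp F :=
  Complex.exp (η * θ) ^ N • toFormal
    (PowerSeries.coeff N (baxterJ F (Complex.exp η) (Complex.exp ℓ) (tCoeff F η ℓ σ)))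

/-- `Q_+(x²)` at `x² = q^θ`. -/
noncomputable def qPlus (F : ℕ) (η ℓ : ℂ) (σ : Fin F → ℂ) (θ : ℂ) : FormalOp F :=
  ∑' N, qPlusTerm F η ℓ σ θ N

/-- The term of degree `N` in `x^{-2}` of
`Q_-(x²) = λ^{-∑_f s_f} J(x^{-2}, λ, {t̄})`, at `x² = q^θ`. -/
noncomputable def qMinusTerm (F : ℕ) (η ℓ : ℂ) (σ : Fin F → ℂ) (θ : ℂ) (N : ℕ) : FormalOp F :=
  Complex.exp (-(η * θ)) ^ N • toFormal
    (diagOp (fun k => Complex.exp (-(ℓ * ∑ f, sVal σ θ k f))) *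
      PowerSeries.coeff N (baxterJ F (Complex.exp η) (Complex.exp ℓ) (tBar F η ℓ σ)))

/-- `Q_-(x²)` at `x² = q^θ`; as a function of `x²` it is multivalued, as a function of `θ` not. -/
noncomputable def qMinus (F : ℕ) (η ℓ : ℂ) (σ : Fin F → ℂ) (θ : ℂ) : FormalOp F :=
  ∑' N, qMinusTerm F η ℓ σ θ N

/-- `W(x²) = Q_+(q⁻¹x²) Q_-(x²) - Q_+(x²) Q_-(q⁻¹x²)` at `x² = q^θ`. -/
noncomputable def wronskian (F : ℕ) (η ℓ : ℂ) (σ : Fin F → ℂ) (θ : ℂ) : FormalOp F :=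
  (qPlus F η ℓ σ (θ - 1)).comp (qMinus F η ℓ σ θ)
    - (qPlus F η ℓ σ θ).comp (qMinus F η ℓ σ (θ - 1))

/-! ## Local forms -/

/-- `(x; q)_∞ = ∏_{k ≥ 0} (1 - q^k x)`. -/
noncomputable def qPochInf (q x : ℂ) : ℂ := ∏' k : ℕ, (1 - q ^ k * x)

/-- `(x; q)_n = ∏_{k=0}^{n-1} (1 - q^k x)`. -/
noncomputable def qPoch (q x : ℂ) (n : ℕ) : ℂ := ∏ k ∈ Finset.range n, (1 - q ^ k * x)

/-- `g_{α,β}(n,m) = q^{nm} α^n β^m (q^{1+n};q)_∞ (q^{1+m};q)_∞ / (q;q)_∞`, where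
`α = exp a` and `β = exp b`. -/
noncomputable def gFun (η a b n m : ℂ) : ℂ :=
  Complex.exp (η * (n * m)) * Complex.exp (a * n) * Complex.exp (b * m) *
    (qPochInf (Complex.exp η) (Complex.exp (η * (1 + n))) *
      qPochInf (Complex.exp η) (Complex.exp (η * (1 + m))) /
        qPochInf (Complex.exp η) (Complex.exp η))

/-- `(∏_f g_{1,λ}(n_f + s_f, n_f)) ∏_f (uv)_f^{n_{f+1} - n_f}`. -/
noncomputable def localPlus {F : ℕ} [NeZero F] (η ℓ : ℂ) (σ : Fin F → ℂ) (θ : ℂ)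
    (n : Fin F → ℕ) : Op F :=
  diagOp (fun k => ∏ f, gFun η 0 ℓ (n f + sVal σ θ k f) (n f)) *
    (uvMonomial η σ fun f => (n (f + 1) : ℤ) - n f).val

/-- `(∏_f g_{1,λ}(n_f, n_f - s_f)) ∏_f (uv)_f^{n_f - n_{f-1}}`. -/
noncomputable def localMinus {F : ℕ} [NeZero F] (η ℓ : ℂ) (σ : Fin F → ℂ) (θ : ℂ)
    (n : Fin F → ℕ) : Op F :=
  diagOp (fun k => ∏ f, gFun η 0 ℓ (n f) (n f - sVal σ θ k f)) *
    (uvMonomial η σ fun f => (n f : ℤ) - n (f - 1)).val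

/-- The diagonal factor `∏_f (q^{s_f};q)_∞ (q^{1-s_f};q)_∞ λ^{-s_f}`. -/
noncomputable def thetaFactor {F : ℕ} (η ℓ : ℂ) (σ : Fin F → ℂ) (θ : ℂ) : Op F :=
  diagOp fun k => ∏ f,
    (qPochInf (Complex.exp η) (Complex.exp (η * sVal σ θ k f)) *
      qPochInf (Complex.exp η) (Complex.exp (η * (1 - sVal σ θ k f))) *
      Complex.exp (-(ℓ * sVal σ θ k f)))

/-- The term of index `n` of the product of the `F` series
`(Y_f;q)_∞ = ∑_{n_f ≥ 0} q^{n_f(n_f-1)/2} (-Y_f)^{n_f} / (q;q)_{n_f}`. -/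
noncomputable def qPochSeriesTerm {F : ℕ} (q : ℂ) (Y : Fin F → Op F) (n : Fin F → ℕ) : Op F :=
  (List.ofFn fun f => (q ^ (n f * (n f - 1) / 2) / qPoch q q (n f)) • (-Y f) ^ n f).prod

/-- `Y_f = λ (uv)_f / (uv)_{f+1}`. -/
noncomputable def wronskianArg {F : ℕ} [NeZero F] (η ℓ : ℂ) (σ : Fin F → ℂ) (f : Fin F) : Op F :=
  Complex.exp ℓ • (uvOp η σ f * (uvOp η σ (f + 1))⁻¹ : (Op F)ˣ).val

/-! ## The local operator `M` in the `q`-oscillator representation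

The auxiliary space has the basis `|N⟩`, `N = 0, 1, 2, …`, and the trace over it is the sum of
the diagonal matrix elements. -/

/-- `[N] = -q^{1/2} λ⁻¹ (1 - q^{-N})`. -/
noncomputable def bracket (η ℓ : ℂ) (N : ℕ) : ℂ :=
  -Complex.exp (η / 2) * Complex.exp (-ℓ) * (1 - Complex.exp (-(η * N)))

/-- `a |N⟩ = |N - 1⟩`, `a |0⟩ = 0`. -/
noncomputable def oscA : Module.End ℂ (ℕ →₀ ℂ) :=
  Finsupp.linearCombination ℂ fun N => if N = 0 then 0 else Finsupp.single (N - 1) 1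

/-- `a⁺ |N⟩ = [N + 1] |N + 1⟩`. -/
noncomputable def oscAdag (η ℓ : ℂ) : Module.End ℂ (ℕ →₀ ℂ) :=
  Finsupp.linearCombination ℂ fun N => Finsupp.single (N + 1) (bracket η ℓ (N + 1))

/-- The quantum operator `g_{1,λ}(N, N - s_f)`, for an eigenvalue `N` of the number operator. -/
noncomputable def oscG {F : ℕ} (η ℓ : ℂ) (σ : Fin F → ℂ) (θ : ℂ) (f : Fin F) (N : ℕ) : Op F :=
  diagOp fun k => gFun η 0 ℓ N (N - sVal σ θ k f)

/-- The matrix element `⟨N'| M_f(x) |N⟩`, an operator of the quantum space, of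
`M = g(N, N-s) + ∑_{n ≥ 1} aⁿ g(N, N-s) (x uv)ⁿ + ∑_{n ≥ 1} (λ x u v⁻¹)ⁿ g(N, N-s) (a⁺)ⁿ`,
where `g = g_{1,λ}` and `x = q^{θ/2}`. Only finitely many `n` contribute to it. -/
noncomputable def oscM {F : ℕ} (η ℓ : ℂ) (σ : Fin F → ℂ) (θ : ℂ) (f : Fin F) (N' N : ℕ) : Op F :=
  (if N' = N then oscG η ℓ σ θ f N else 0)
    + (∑ᶠ n : ℕ, ((oscA ^ (n + 1)) (Finsupp.single N 1) N') •
        (oscG η ℓ σ θ f N *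
          (Complex.exp (η * θ / 2) • (uvOp η σ f : Op F)) ^ (n + 1)))
    + ∑ᶠ n : ℕ, ((oscAdag η ℓ ^ (n + 1)) (Finsupp.single N 1) N') •
        ((((Complex.exp ℓ * Complex.exp (η * θ / 2)) •
            (uOp η σ f * (vOp f)⁻¹ : (Op F)ˣ).val)) ^ (n + 1) * oscG η ℓ σ θ f N')

/-- The contribution `⟨n_F|M_1|n_1⟩ ⟨n_1|M_2|n_2⟩ ⋯ ⟨n_{F-1}|M_F|n_F⟩` to the trace of the
monodromy `M_1 M_2 ⋯ M_F` over the auxiliary space. -/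
noncomputable def oscTraceTerm {F : ℕ} [NeZero F] (η ℓ : ℂ) (σ : Fin F → ℂ) (θ : ℂ)
    (n : Fin F → ℕ) : Op F :=
  (List.ofFn fun f => oscM η ℓ σ θ f (n (f - 1)) (n f)).prod

/-! ## The local operator `M` with the permutation extracted

Here the auxiliary space is a copy of the space of one site, with basis `|κ⟩`, `κ : ℤ`; the basis
of the product of the auxiliary and the quantum space is `|κ; k⟩`. -/

/-- Operators of the product of the auxiliary and the quantum space. -/
abbrev AuxOp (F : ℕ) : Type := Module.End ℂ ((ℤ × (Fin F → ℤ)) →₀ ℂ)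

/-- An operator of the quantum space, acting trivially on the auxiliary space. -/
noncomputable def liftOp {F : ℕ} (a : Op F) : AuxOp F :=
  Finsupp.linearCombination ℂ fun p =>
    Finsupp.mapDomain (fun k => (p.1, k)) (a (Finsupp.single p.2 1))

/-- The permutation `P_{h,f}` of the auxiliary space with the `f`-th site. -/
noncomputable def permOp {F : ℕ} (f : Fin F) : AuxOp F :=
  Finsupp.linearCombination ℂ fun p =>
    Finsupp.single (p.2 f, Function.update p.2 f p.1) 1

/-- The `n`-th term of
`M_f = ∑_{n ≥ 0} g_{1,λ}(n + s_f, n) (uv)_f^{-n} P_{h,f} (uv)_f^n`. -/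
noncomputable def permMTerm {F : ℕ} (η ℓ : ℂ) (σ : Fin F → ℂ) (θ : ℂ) (f : Fin F) (n : ℕ) :
    AuxOp F :=
  liftOp (diagOp fun k => gFun η 0 ℓ (n + sVal σ θ k f) n) *
    liftOp (uvOp η σ f ^ (-(n : ℤ)) : (Op F)ˣ).val * permOp f *
    liftOp (uvOp η σ f ^ (n : ℤ) : (Op F)ˣ).val

/-- The contribution of the terms `n_1, …, n_F` of `M_1, …, M_F` and of the auxiliary basis vector
`|κ⟩` to the trace of the monodromy `M_1 M_2 ⋯ M_F` over the auxiliary space. -/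
noncomputable def permTraceTerm {F : ℕ} (η ℓ : ℂ) (σ : Fin F → ℂ) (θ : ℂ)
    (p : (Fin F → ℕ) × ℤ) : FormalOp F :=
  fun k' k => (List.ofFn fun f => permMTerm η ℓ σ θ f (p.1 f)).prod
    (Finsupp.single (p.2, k) 1) (p.2, k')

/-- The cyclic shift `P` of the chain: `u_f P = P u_{f+1}`, `v_f P = P v_{f+1}`. -/
noncomputable def cyclicShift (F : ℕ) [NeZero F] : Op F :=
  Finsupp.linearCombination ℂ fun k => Finsupp.single (fun f => k (f + 1)) 1

end RelToda

/-! All operators are handled through their matrix elements. A diagonal conjugation (`gauge`) turns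
the monomials in u_f v_f into pure shifts, and the operators built from them become cyclic sums:
sums over labels at the sites of products of weights that depend on the labels at f and f+1.

The Baxter equation determines the coefficient of X^N from lower ones because 1 − q^{-N} ≠ 0. Its
solution is constructed over a commutative ring without limits (`algJ_baxter`) and carried over to
the commutative algebra generated by the t_j, where the limits in the definition of J reduce to
limits of scalars (`isBaxterSolution_iff_eq_baxterJ`). The t_j commute because the six-vertex
R-matrix intertwines the weights of T(x)T(y) and T(y)T(x) (`commute_transferAt`).

Local forms. The candidate for Q_+ is the sum, over occupation numbers n with n_{f+1} − n_f = k'_f −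
k_f, of the products of λ^n q^{n²} U^n (q^{n+1}U;q)_∞/(q;q)_n, where U = q^{s_f}. The factor q^{n²}
makes it entire in x², and at x² = 0 it is the identity. Applying T to it produces, for fixed n, the
trace of a product of 2×2 matrices with the common eigenvector (1,1), whose eigenvalues are 1 −
q^{-n_f} and q^{-n_f} − U_f; the two resulting products over f are the two terms on the right of the
Baxter equation (`kernel_baxter`). Comparison of Taylor coefficients and uniqueness identify the
candidate with J (`hasSum_baxterJ`). For Q_- one uses T̄(X) = (−X)^F t_0⁻¹ T(1/X), whose local
weights are those of T transposed, up to a gauge factor (`neg_mul_ell_inv`); the same kernel with U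
inverted and the chain reversed solves it.

Wronskian. The terms of a product of Q_+ and Q_- are grouped by the total occupation numbers N = n +
p. For the first product this gives a finite cyclic sum of `weightA`, for the second, after raising
N by one, a cyclic sum of `weightB` over positive labels. The difference of `weightA` in one label
is a difference of `weightB` in the other (`weightA_sub`), so conjugation by the summation matrix
splits the first cyclic sum into the product of the row sums and exactly the second product
(`cycSum_eq_add`). The row sums are evaluated by the q-binomial theorem and give the diagonal factor
times the coefficients of the series (Y_f;q)_∞. The rearrangements rest on a bound that factorizes
over the sites (`exists_bound_localG_mul`).

Traces. Every matrix element of the oscillator M_f is g(N, N−s)(xuv)^{N−N'}, so the trace agrees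
with the local form of Q_- term by term. For the M_f with permutations, following the auxiliary
label round the chain leaves one basis vector for each n, and the result is the local form of Q_+
applied to the rotated state. -/

namespace RelToda

/-! ### Dilations of power series and the Baxter series -/

section Dilate

variable {A : Type*} [Ring A] [Algebra ℂ A]

@[simp] theorem coeff_dilate (c : ℂ) (φ : PowerSeries A) (N : ℕ) :
    PowerSeries.coeff N (dilate c φ) = c ^ N • PowerSeries.coeff N φ := by
  simp [dilate]

theorem constantCoeff_dilate (c : ℂ) (φ : PowerSeries A) :
    PowerSeries.constantCoeff (dilate c φ) = PowerSeries.constantCoeff φ := by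
  rw [← PowerSeries.coeff_zero_eq_constantCoeff_apply, coeff_dilate]
  simp

theorem dilate_mul (c : ℂ) (φ ψ : PowerSeries A) :
    dilate c (φ * ψ) = dilate c φ * dilate c ψ := by
  ext N
  simp only [coeff_dilate, PowerSeries.coeff_mul, Finset.smul_sum]
  refine Finset.sum_congr rfl fun x hx => ?_
  rw [← Finset.HasAntidiagonal.mem_antidiagonal.1 hx, smul_mul_smul_comm, pow_add]

theorem dilate_dilate (c d : ℂ) (φ : PowerSeries A) :
    dilate c (dilate d φ) = dilate (c * d) φ := by
  ext N
  simp [mul_pow, smul_smul]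

@[simp] theorem dilate_one_left (φ : PowerSeries A) : dilate 1 φ = φ := by
  ext N
  simp

@[simp] theorem dilate_one_right (c : ℂ) : dilate c (1 : PowerSeries A) = 1 := by
  ext N
  rcases N with _ | N <;> simp [PowerSeries.coeff_one]

theorem map_dilate {B : Type*} [Ring B] [Algebra ℂ B] (f : A →ₐ[ℂ] B) (c : ℂ)
    (φ : PowerSeries A) :
    PowerSeries.map (f : A →+* B) (dilate c φ) = dilate c (PowerSeries.map (f : A →+* B) φ) := by
  ext N
  simp

theorem map_series_monomial {A B : Type*} [Ring A] [Ring B] (f : A →+* B) (n : ℕ) (a : A) :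
    PowerSeries.map f (PowerSeries.monomial n a) = PowerSeries.monomial n (f a) := by
  ext N
  simp only [PowerSeries.coeff_map, PowerSeries.coeff_monomial]
  split_ifs <;> simp

theorem coeff_mul_congr {A : Type*} [Ring A] {φ ψ : PowerSeries A} {N : ℕ}
    (h : ∀ i ≤ N, PowerSeries.coeff i φ = PowerSeries.coeff i ψ) (χ : PowerSeries A) :
    PowerSeries.coeff N (χ * φ) = PowerSeries.coeff N (χ * ψ) := by
  simp only [PowerSeries.coeff_mul]
  refine Finset.sum_congr rfl fun x hx => ?_
  rw [h _ (by have := Finset.HasAntidiagonal.mem_antidiagonal.1 hx; omega)]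

theorem map_seriesInv {A : Type*} [Ring A] {B : Type*} [Ring B] (f : A →+* B) (φ : PowerSeries A)
    (h : PowerSeries.constantCoeff φ = 1) :
    seriesInv (PowerSeries.map f φ) = PowerSeries.map f (seriesInv φ) := by
  have h' : PowerSeries.constantCoeff (PowerSeries.map f φ) = ((1 : Bˣ) : B) := by
    rw [← PowerSeries.coeff_zero_eq_constantCoeff_apply, PowerSeries.coeff_map,
      PowerSeries.coeff_zero_eq_constantCoeff_apply, h]
    simp
  refine left_inv_eq_right_inv (PowerSeries.invOfUnit_mul _ 1 h') ?_
  rw [← map_mul, seriesInv, PowerSeries.mul_invOfUnit _ 1 (by simpa using h), map_one]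

theorem dilate_seriesInv (c : ℂ) (φ : PowerSeries A) (h : PowerSeries.constantCoeff φ = 1) :
    dilate c (seriesInv φ) = seriesInv (dilate c φ) := by
  refine left_inv_eq_right_inv (a := dilate c φ) ?_ (PowerSeries.mul_invOfUnit _ 1 ?_)
  · rw [← dilate_mul, seriesInv, PowerSeries.invOfUnit_mul _ 1 (by simpa using h),
      dilate_one_right]
  · rw [constantCoeff_dilate, h]; rfl

theorem coeff_transferSeries {A : Type*} [Ring A] (F : ℕ) (t : ℕ → A) (N : ℕ) :
    PowerSeries.coeff N (transferSeries F t) =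
      if N ≤ F then (-1) ^ N * t (F - N) else 0 := by
  simp only [transferSeries, map_sum, PowerSeries.coeff_monomial]
  split_ifs with h
  · rw [Finset.sum_eq_single_of_mem (F - N) (by simp)]
    · have : F - (F - N) = N := by omega
      simp [this]
    · intro j hj hne
      rw [if_neg]
      simp only [Finset.mem_range] at hj
      omega
  · exact Finset.sum_eq_zero fun j hj => if_neg (by omega)

theorem constantCoeff_transferSeries {A : Type*} [Ring A] (F : ℕ) (t : ℕ → A) :
    PowerSeries.constantCoeff (transferSeries F t) = t F := by
  rw [← PowerSeries.coeff_zero_eq_constantCoeff_apply, coeff_transferSeries]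
  simp

theorem map_transferSeries {A : Type*} [Ring A] {B : Type*} [Ring B] (f : A →+* B) (F : ℕ) (t : ℕ → A) :
    PowerSeries.map f (transferSeries F t) = transferSeries F (fun j => f (t j)) := by
  ext N
  rw [PowerSeries.coeff_map, coeff_transferSeries, coeff_transferSeries]
  split_ifs <;> simp

/-- The recursion satisfied by the coefficients of a solution of the Baxter equation. -/
theorem isBaxterSolution_iff {F : ℕ} {q lam : ℂ} {t : ℕ → A} {Q : PowerSeries A} :
    IsBaxterSolution F q lam t Q ↔ ∀ N,
      (∑ x ∈ (Finset.HasAntidiagonal.antidiagonal N), PowerSeries.coeff x.1 (transferSeries F t) *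
          PowerSeries.coeff x.2 Q) =
        (if F ≤ N then ((-lam) ^ F • t 0) * (q ^ (N - F) • PowerSeries.coeff (N - F) Q) else 0) +
          q⁻¹ ^ N • PowerSeries.coeff N Q := by
  rw [IsBaxterSolution, PowerSeries.ext_iff]
  refine forall_congr' fun N => ?_
  rw [PowerSeries.coeff_mul, map_add, coeff_dilate, PowerSeries.coeff_mul,
    Finset.Nat.sum_antidiagonal_eq_sum_range_succ_mk
      (fun x => PowerSeries.coeff x.1 (PowerSeries.monomial F _) * _)]
  simp only [PowerSeries.coeff_monomial, coeff_dilate, ite_mul, zero_mul, Finset.sum_ite_eq',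
    Finset.mem_range, Nat.lt_succ_iff]

/-- In degree N the unknown coefficient enters with the factor 1 − q^{-N}, which is nonzero for N ≥
1; all other terms have lower degree because F ≥ 1. -/
theorem eq_of_isBaxterSolution {F : ℕ} (hF : F ≠ 0) {q lam : ℂ}
    (hq : ∀ N : ℕ, N ≠ 0 → q ^ N ≠ 1) {t : ℕ → A} (ht : t F = 1) {Q Q' : PowerSeries A}
    (h : IsBaxterSolution F q lam t Q) (h' : IsBaxterSolution F q lam t Q')
    (h0 : PowerSeries.constantCoeff Q = PowerSeries.constantCoeff Q') : Q = Q' := by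
  rw [isBaxterSolution_iff] at h h'
  ext N
  induction N using Nat.strong_induction_on with
  | _ N ih =>
    rcases Nat.eq_zero_or_pos N with rfl | hN
    · simpa using h0
    have e := h N
    have e' := h' N
    have hz : ((0 : ℕ), N) ∈ (Finset.HasAntidiagonal.antidiagonal N) := by simp
    rw [← Finset.add_sum_erase _ _ hz] at e e'
    have hs : ∑ x ∈ (Finset.HasAntidiagonal.antidiagonal N).erase (0, N),
          PowerSeries.coeff x.1 (transferSeries F t) * PowerSeries.coeff x.2 Q =
        ∑ x ∈ (Finset.HasAntidiagonal.antidiagonal N).erase (0, N),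
          PowerSeries.coeff x.1 (transferSeries F t) * PowerSeries.coeff x.2 Q' := by
      refine Finset.sum_congr rfl fun x hx => ?_
      rw [Finset.mem_erase, Finset.HasAntidiagonal.mem_antidiagonal] at hx
      rw [ih x.2]
      rcases x with ⟨a, b⟩
      have : a ≠ 0 := by
        rintro rfl
        simp at hx
      simp only at hx ⊢
      omega
    have hm : (if F ≤ N then ((-lam) ^ F • t 0) * (q ^ (N - F) • PowerSeries.coeff (N - F) Q)
          else 0) =
        (if F ≤ N then ((-lam) ^ F • t 0) * (q ^ (N - F) • PowerSeries.coeff (N - F) Q')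
          else 0) := by
      split_ifs
      · rw [ih (N - F) (by omega)]
      · rfl
    have hc : PowerSeries.coeff 0 (transferSeries F t) = 1 := by
      rw [coeff_transferSeries]; simp [ht]
    simp only [hc, one_mul] at e e'
    rw [hs, hm] at e
    have e2 : PowerSeries.coeff N Q - PowerSeries.coeff N Q' =
        q⁻¹ ^ N • (PowerSeries.coeff N Q - PowerSeries.coeff N Q') := by
      rw [smul_sub]
      simpa only [add_sub_add_left_eq_sub, add_sub_add_right_eq_sub] using
        congrArg₂ (· - ·) e e'
    have e3 : (1 - q⁻¹ ^ N) • (PowerSeries.coeff N Q - PowerSeries.coeff N Q') = 0 := by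
      rw [sub_smul, one_smul, ← e2, sub_self]
    have hne : 1 - q⁻¹ ^ N ≠ 0 := by
      rw [inv_pow, sub_ne_zero]
      intro h1
      exact hq N hN.ne' (by rw [← inv_inv (q ^ N), ← h1, inv_one])
    exact sub_eq_zero.1 ((smul_eq_zero_iff_right hne).1 e3)

end Dilate

/-! ### The Baxter equation over a commutative ring, without limits -/

section Algebraic

variable {S : Type*} [CommRing S] [Algebra ℂ S]

/-- The coefficients of the solution of `P(X) = τ(q X) P(q X)` with `P(0) = 1`. -/
noncomputable def prodCoeff (q : ℂ) (τ : PowerSeries S) : ℕ → S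
  | 0 => 1
  | N + 1 => (q ^ (N + 1) / (1 - q ^ (N + 1))) •
      ∑ i : Fin (N + 1), PowerSeries.coeff (N + 1 - i) τ * prodCoeff q τ i
termination_by N => N
decreasing_by exact i.2

/-- The solution of `P(X) = τ(q X) P(q X)` with `P(0) = 1`. -/
noncomputable def prodSeries (q : ℂ) (τ : PowerSeries S) : PowerSeries S :=
  PowerSeries.mk (prodCoeff q τ)

theorem constantCoeff_prodSeries (q : ℂ) (τ : PowerSeries S) :
    PowerSeries.constantCoeff (prodSeries q τ) = 1 := by
  rw [← PowerSeries.coeff_zero_eq_constantCoeff_apply, prodSeries, PowerSeries.coeff_mk, prodCoeff]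

/-- In degree N this reads (1 − q^N) P_N = q^N ∑_{i<N} τ_{N−i} P_i, the recursion that defines
`prodCoeff`. -/
theorem dilate_mul_prodSeries {q : ℂ} (hq : ∀ N : ℕ, N ≠ 0 → q ^ N ≠ 1) {τ : PowerSeries S}
    (hτ : PowerSeries.constantCoeff τ = 1) :
    dilate q (τ * prodSeries q τ) = prodSeries q τ := by
  ext N
  rw [coeff_dilate, mul_comm, PowerSeries.coeff_mul, Finset.Nat.sum_antidiagonal_eq_sum_range_succ_mk]
  rcases N with _ | N
  · simp [hτ]
  · rw [Finset.sum_range_succ]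
    have h1 : 1 - q ^ (N + 1) ≠ 0 := sub_ne_zero.2 (Ne.symm (hq _ (by simp)))
    simp only [prodSeries, PowerSeries.coeff_mk, Nat.sub_self,
      PowerSeries.coeff_zero_eq_constantCoeff_apply, hτ, mul_one]
    rw [smul_add, prodCoeff, smul_smul, ← Fin.sum_univ_eq_sum_range
      (fun i => prodCoeff q τ i * PowerSeries.coeff (N + 1 - i) τ) (N + 1),
      Finset.sum_congr rfl fun (i : Fin (N + 1)) _ =>
        mul_comm (prodCoeff q τ i) (PowerSeries.coeff (N + 1 - i) τ), ← add_smul]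
    congr 1
    field_simp
    ring

/-- The functional equation iterated K times. As P(q^K X) tends to 1 coefficientwise, it identifies
P with the infinite product of the τ(q^k X), k ≥ 1. -/
theorem prod_ofFn_mul_dilate {q : ℂ} (hq : ∀ N : ℕ, N ≠ 0 → q ^ N ≠ 1) {τ : PowerSeries S}
    (hτ : PowerSeries.constantCoeff τ = 1) (K : ℕ) :
    (List.ofFn fun k : Fin K => dilate (q ^ ((k : ℕ) + 1)) τ).prod *
      dilate (q ^ K) (prodSeries q τ) = prodSeries q τ := by
  induction K with
  | zero => simp
  | succ K ih =>
    rw [List.ofFn_succ', List.concat_eq_append, List.prod_append]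
    simp only [Fin.val_castSucc, Fin.val_last, List.prod_cons, List.prod_nil, mul_one]
    rw [mul_assoc, ← dilate_mul]
    conv_rhs => rw [← ih, ← dilate_mul_prodSeries hq hτ, dilate_dilate, ← pow_succ]

/-- The series `c_k(X)`, over a commutative ring and without limits. -/
noncomputable def algC (F : ℕ) (q : ℂ) (τ : PowerSeries S) : ℕ → PowerSeries S
  | 0 => 1
  -- Substituting q^j X and summing over j ≥ 1 multiplies the coefficient of X^N by q^N/(1 − q^N).
  -- At N = 0 the quotient is 0 by the convention on division, which is harmless since that
  -- coefficient vanishes when F ≠ 0.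
  | k + 1 => PowerSeries.mk fun N => (q ^ N / (1 - q ^ N)) • PowerSeries.coeff N
      (PowerSeries.X ^ F * dilate q (algC F q τ k) * seriesInv τ * seriesInv (dilate q τ))

/-- Every step of the recursion contributes a factor X^F with F ≥ 1. Hence the sum over k is finite
in each degree, which justifies the truncation in `algJ`. -/
theorem coeff_algC_of_lt {F : ℕ} (hF : F ≠ 0) (q : ℂ) (τ : PowerSeries S) (k : ℕ) :
    ∀ N < k, PowerSeries.coeff N (algC F q τ k) = 0 := by
  induction k with
  | zero => intro N hN; omega
  | succ k ih =>
    intro N hN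
    rw [algC, PowerSeries.coeff_mk, mul_assoc, mul_assoc, PowerSeries.coeff_X_pow_mul']
    split_ifs with h
    · rw [PowerSeries.coeff_mul, Finset.sum_eq_zero, smul_zero]
      intro x hx
      have := Finset.HasAntidiagonal.mem_antidiagonal.1 hx
      rw [coeff_dilate, ih x.1 (by omega), smul_zero, zero_mul]
    · rw [smul_zero]

/-- The sum over j telescopes: replacing X by q⁻¹X adds the term j = 0. -/
theorem algC_succ_sub {F : ℕ} {q : ℂ} (hq0 : q ≠ 0) (hF : F ≠ 0)
    (hq : ∀ N : ℕ, N ≠ 0 → q ^ N ≠ 1) (τ : PowerSeries S) (k : ℕ) :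
    algC F q τ (k + 1) - dilate q⁻¹ (algC F q τ (k + 1)) =
      -(PowerSeries.X ^ F * dilate q (algC F q τ k) * seriesInv τ * seriesInv (dilate q τ)) := by
  ext N
  rw [map_sub, coeff_dilate, map_neg]
  simp only [algC, PowerSeries.coeff_mk]
  rcases Nat.eq_zero_or_pos N with rfl | hN
  · simp [hF]
  · rw [smul_smul, ← sub_smul, ← neg_one_smul ℂ]
    congr 1
    have h1 : 1 - q ^ N ≠ 0 := sub_ne_zero.2 (Ne.symm (hq _ hN.ne'))
    have h2 : q ^ N * q⁻¹ ^ N = 1 := by rw [← mul_pow, mul_inv_cancel₀ hq0, one_pow]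
    field_simp
    linear_combination -h2

/-- The normalized solution of the Baxter equation over a commutative ring. -/
noncomputable def algJ (F : ℕ) (q : ℂ) (z : S) (τ : PowerSeries S) : PowerSeries S :=
  prodSeries q τ * PowerSeries.mk fun N =>
    ∑ k ∈ Finset.range (N + 1), z ^ k * PowerSeries.coeff N (algC F q τ k)

theorem constantCoeff_algJ (F : ℕ) (q : ℂ) (z : S) (τ : PowerSeries S) :
    PowerSeries.constantCoeff (algJ F q z τ) = 1 := by
  rw [algJ, map_mul, constantCoeff_prodSeries, one_mul,
    ← PowerSeries.coeff_zero_eq_constantCoeff_apply, PowerSeries.coeff_mk]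
  simp [algC]

/-- Write J = Pσ with σ = ∑ z^k c_k. Since P(q⁻¹X) = τ(X)P(X) and P(X) = τ(qX)P(qX), division by τP
turns the Baxter equation into σ(X) − σ(q⁻¹X) = −z X^F σ(qX)/(τ(X)τ(qX)), which is `algC_succ_sub`
summed over k. -/
theorem algJ_baxter {F : ℕ} (hF : F ≠ 0) {q : ℂ} (hq0 : q ≠ 0)
    (hq : ∀ N : ℕ, N ≠ 0 → q ^ N ≠ 1) (z : S) {τ : PowerSeries S}
    (hτ : PowerSeries.constantCoeff τ = 1) :
    τ * algJ F q z τ =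
      PowerSeries.monomial F (-z) * dilate q (algJ F q z τ) + dilate q⁻¹ (algJ F q z τ) := by
  set P := prodSeries q τ with hP
  set σ : ℕ → PowerSeries S := fun M =>
    ∑ k ∈ Finset.range M, PowerSeries.C (z ^ k) * algC F q τ k with hσ
  have hagree : ∀ M N, N < M → PowerSeries.coeff N (σ M) =
      ∑ k ∈ Finset.range (N + 1), z ^ k * PowerSeries.coeff N (algC F q τ k) := by
    intro M N h
    simp only [hσ, map_sum, PowerSeries.coeff_C_mul]
    symm
    refine Finset.sum_subset (Finset.range_mono h) fun k _ hk => ?_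
    rw [coeff_algC_of_lt hF q τ k N (by simpa using hk), mul_zero]
  -- In degrees below M the sum over k may be cut off at M, so only finite sums are manipulated.
  have hJ : ∀ M N, N < M → ∀ i ≤ N, PowerSeries.coeff i (algJ F q z τ) =
      PowerSeries.coeff i (P * σ M) := by
    intro M N h i hi
    refine coeff_mul_congr (fun j hj => ?_) P
    rw [hagree M j (by omega), PowerSeries.coeff_mk]
  have hdC : ∀ (c : ℂ) (a : S), dilate c (PowerSeries.C a) = PowerSeries.C a := by
    intro c a
    ext N
    rw [coeff_dilate, PowerSeries.coeff_C]
    split_ifs with h <;> simp [h]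
  have hdsum : ∀ (c : ℂ) (M : ℕ), dilate c (σ M) =
      ∑ k ∈ Finset.range M, PowerSeries.C (z ^ k) * dilate c (algC F q τ k) := by
    intro c M
    ext N
    simp only [hσ, coeff_dilate, map_sum, Finset.smul_sum, PowerSeries.coeff_C_mul]
    exact Finset.sum_congr rfl fun k _ => (mul_smul_comm _ _ _).symm
  have hi1 : τ * seriesInv τ = 1 := PowerSeries.mul_invOfUnit _ 1 (by simpa using hτ)
  have hi2 : dilate q τ * seriesInv (dilate q τ) = 1 :=
    PowerSeries.mul_invOfUnit _ 1 (by rw [constantCoeff_dilate]; simpa using hτ)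
  have hσ1 : ∀ M, σ (M + 1) - dilate q⁻¹ (σ (M + 1)) =
      -(PowerSeries.C z * PowerSeries.X ^ F * dilate q (σ M) * seriesInv τ *
        seriesInv (dilate q τ)) := by
    intro M
    rw [hdsum, hdsum]
    simp only [hσ]
    rw [Finset.sum_range_succ', Finset.sum_range_succ']
    simp only [algC, dilate_one_right, add_sub_add_right_eq_sub]
    rw [← Finset.sum_sub_distrib, Finset.mul_sum, Finset.sum_mul, Finset.sum_mul,
      ← Finset.sum_neg_distrib]
    refine Finset.sum_congr rfl fun k _ => ?_
    rw [← mul_sub]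
    have := algC_succ_sub hq0 hF hq τ k
    rw [algC] at this
    rw [this, pow_succ, map_mul]
    ring
  have hPq : dilate q⁻¹ P = τ * P := by
    conv_lhs => rw [hP, ← dilate_mul_prodSeries hq hτ, dilate_dilate, inv_mul_cancel₀ hq0,
      dilate_one_left]
  have hP1 : dilate q τ * dilate q P = P := by rw [← dilate_mul]; exact dilate_mul_prodSeries hq hτ
  -- The cutoff drops by one in the middle term because c_{k+1} is built from c_k.
  have key : ∀ M, τ * (P * σ (M + 1)) = PowerSeries.monomial F (-z) * dilate q (P * σ M) +
      dilate q⁻¹ (P * σ (M + 1)) := by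
    intro M
    have hm : (PowerSeries.monomial F (-z) : PowerSeries S) =
        -(PowerSeries.C z * PowerSeries.X ^ F) := by
      rw [PowerSeries.monomial_eq_C_mul_X_pow, map_neg, neg_mul]
    rw [dilate_mul, dilate_mul, hPq, hm]
    have h := hσ1 M
    linear_combination (τ * P) * h -
      (τ * seriesInv τ) * seriesInv (dilate q τ) * PowerSeries.C z * PowerSeries.X ^ F *
        dilate q (σ M) * (-hP1) - PowerSeries.C z * PowerSeries.X ^ F * dilate q (σ M) *
        dilate q P * (τ * seriesInv τ) * hi2 - PowerSeries.C z * PowerSeries.X ^ F *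
        dilate q (σ M) * dilate q P * hi1
  ext N
  have h1 := coeff_mul_congr (hJ (N + 2) N (by omega)) τ
  have h2 : PowerSeries.coeff N (PowerSeries.monomial F (-z) * dilate q (algJ F q z τ)) =
      PowerSeries.coeff N (PowerSeries.monomial F (-z) * dilate q (P * σ (N + 1))) :=
    coeff_mul_congr (fun i hi => by
      rw [coeff_dilate, coeff_dilate, hJ (N + 1) N (by omega) i hi]) _
  rw [h1, map_add, h2, coeff_dilate, hJ (N + 2) N (by omega) N le_rfl, key (N + 1), map_add,
    coeff_dilate]

end Algebraic

/-! ### The limits in the definition of J -/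

section Limits

variable {S : Type*} [CommRing S] [Algebra ℂ S] {A : Type*} [Ring A] [Algebra ℂ A]
  [TopologicalSpace A] [ContinuousSMul ℂ A] [T2Space A]

/-- Multiplication in A is not assumed continuous. By `prod_ofFn_mul_dilate` the K-th partial
product is P(X) P⁻¹(q^K X), so each coefficient is a finite combination of fixed elements with
scalar coefficients q^{Kj}, and only scalar limits occur. -/
theorem transferProd_eq_map [ContinuousAdd A] (f : S →ₐ[ℂ] A) (F : ℕ) {q : ℂ} (hq1 : ‖q‖ < 1)
    (hq : ∀ N : ℕ, N ≠ 0 → q ^ N ≠ 1) (t : ℕ → S) (ht : t F = 1) :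
    transferProd F q (fun j => f (t j)) =
      PowerSeries.map (f : S →+* A) (prodSeries q (transferSeries F t)) := by
  have hτ : PowerSeries.constantCoeff (transferSeries F t) = 1 := by
    rw [constantCoeff_transferSeries, ht]
  set P := prodSeries q (transferSeries F t) with hP
  have hPI : P * seriesInv P = 1 :=
    PowerSeries.mul_invOfUnit _ 1 (by rw [hP, constantCoeff_prodSeries]; rfl)
  ext N
  rw [transferProd, PowerSeries.coeff_mk, PowerSeries.coeff_map]
  refine Filter.Tendsto.limUnder_eq ?_
  have hK : ∀ K : ℕ, PowerSeries.coeff N ((List.ofFn fun k : Fin K =>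
        dilate (q ^ ((k : ℕ) + 1)) (transferSeries F fun j => f (t j))).prod) =
      ∑ x ∈ (Finset.HasAntidiagonal.antidiagonal N), (q ^ K) ^ x.2 •
        f (PowerSeries.coeff x.1 P * PowerSeries.coeff x.2 (seriesInv P)) := by
    intro K
    have h1 : (List.ofFn fun k : Fin K =>
        dilate (q ^ ((k : ℕ) + 1)) (transferSeries F fun j => f (t j))).prod =
        PowerSeries.map (f : S →+* A) (P * dilate (q ^ K) (seriesInv P)) := by
      have h2 : (List.ofFn fun k : Fin K => dilate (q ^ ((k : ℕ) + 1)) (transferSeries F t)).prod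
          = P * dilate (q ^ K) (seriesInv P) := by
        have h3 := congrArg (· * dilate (q ^ K) (seriesInv P)) (prod_ofFn_mul_dilate hq hτ K)
        simp only [← hP, mul_assoc, ← dilate_mul, hPI, dilate_one_right, mul_one] at h3
        exact h3
      rw [← h2, map_list_prod, List.map_ofFn]
      congr 2
      funext k
      simp only [Function.comp, map_dilate]
      rw [map_transferSeries]
      rfl
    rw [h1, PowerSeries.coeff_map, PowerSeries.coeff_mul, map_sum]
    refine Finset.sum_congr rfl fun x _ => ?_
    rw [coeff_dilate, mul_smul_comm]
    exact map_smul f _ _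
  simp only [hK]
  have hlim : ∀ j : ℕ, Filter.Tendsto (fun K : ℕ => (q ^ K) ^ j) Filter.atTop
      (nhds (if j = 0 then 1 else 0)) := by
    intro j
    rcases Nat.eq_zero_or_pos j with rfl | hj
    · simp
    · simp only [hj.ne', if_false]
      simp only [← pow_mul, mul_comm _ j]
      simp only [pow_mul]
      refine tendsto_pow_atTop_nhds_zero_of_norm_lt_one ?_
      rw [norm_pow]
      exact pow_lt_one₀ (norm_nonneg _) hq1 hj.ne'
  have := tendsto_finsetSum (Finset.HasAntidiagonal.antidiagonal N) fun x _ =>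
    (hlim x.2).smul (tendsto_const_nhds (x := f (PowerSeries.coeff x.1 P *
      PowerSeries.coeff x.2 (seriesInv P))))
  convert this using 2
  rw [Finset.sum_eq_single_of_mem (N, 0) (by simp)]
  · have : PowerSeries.coeff 0 (seriesInv P) = 1 := by
      simp [seriesInv, PowerSeries.constantCoeff_invOfUnit]
    simp [this]
  · rintro ⟨a, b⟩ hx hne
    have : b ≠ 0 := by
      rintro rfl
      simp only [Finset.HasAntidiagonal.mem_antidiagonal, add_zero] at hx
      exact hne (by simp [hx])
    simp [this]

/-- In degree N the sum over j is a scalar geometric series of ratio q^N applied to a fixed element;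
its value is the factor used in `algC`. -/
theorem cSeries_eq_map (f : S →ₐ[ℂ] A) {F : ℕ} (hF : F ≠ 0) {q : ℂ} (hq1 : ‖q‖ < 1)
    (t : ℕ → S) (ht : t F = 1) (k : ℕ) :
    cSeries F q (fun j => f (t j)) k =
      PowerSeries.map (f : S →+* A) (algC F q (transferSeries F t) k) := by
  have hτ : PowerSeries.constantCoeff (transferSeries F t) = 1 := by
    rw [constantCoeff_transferSeries, ht]
  induction k with
  | zero => simp [cSeries, algC]
  | succ k ih =>
    ext N
    rw [cSeries, PowerSeries.coeff_mk, PowerSeries.coeff_map, algC, PowerSeries.coeff_mk]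
    set φ := PowerSeries.X ^ F * dilate q (algC F q (transferSeries F t) k) *
      seriesInv (transferSeries F t) * seriesInv (dilate q (transferSeries F t)) with hφ
    have hterm : ∀ j : ℕ, PowerSeries.coeff N
        (dilate (q ^ (j + 1)) (PowerSeries.X ^ F) *
          dilate (q ^ (j + 2)) (cSeries F q (fun j => f (t j)) k) *
          seriesInv (dilate (q ^ (j + 1)) (transferSeries F fun j => f (t j))) *
          seriesInv (dilate (q ^ (j + 2)) (transferSeries F fun j => f (t j)))) =
        (q ^ N * (q ^ N) ^ j) • f (PowerSeries.coeff N φ) := by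
      intro j
      have e : dilate (q ^ (j + 1)) (PowerSeries.X ^ F) *
          dilate (q ^ (j + 2)) (cSeries F q (fun j => f (t j)) k) *
          seriesInv (dilate (q ^ (j + 1)) (transferSeries F fun j => f (t j))) *
          seriesInv (dilate (q ^ (j + 2)) (transferSeries F fun j => f (t j))) =
          PowerSeries.map (f : S →+* A) (dilate (q ^ (j + 1)) φ) := by
        have hT : transferSeries F (fun j => f (t j)) =
            PowerSeries.map (f : S →+* A) (transferSeries F t) := by
          rw [map_transferSeries]; rfl
        rw [hφ, dilate_mul, dilate_mul, dilate_mul, dilate_dilate,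
          dilate_seriesInv _ _ hτ, dilate_seriesInv _ _ (by rw [constantCoeff_dilate, hτ]),
          dilate_dilate, ← pow_succ, map_mul, map_mul, map_mul, ih, hT,
          ← map_seriesInv _ _ (by rw [constantCoeff_dilate, hτ]),
          ← map_seriesInv _ _ (by rw [constantCoeff_dilate, hτ])]
        simp only [map_dilate, map_pow, PowerSeries.map_X]
      rw [e, PowerSeries.coeff_map, coeff_dilate]
      rw [show (q ^ N * (q ^ N) ^ j) = (q ^ (j + 1)) ^ N by rw [← pow_mul, ← pow_mul]; ring]
      exact map_smul f _ _
    simp only [hterm]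
    rcases Nat.eq_zero_or_pos N with rfl | hN
    · have : PowerSeries.coeff 0 φ = 0 := by simp [hφ, hF]
      simp [this]
    · have hN1 : ‖q ^ N‖ < 1 := by
        rw [norm_pow]
        exact pow_lt_one₀ (norm_nonneg _) hq1 hN.ne'
      have := ((hasSum_geometric_of_norm_lt_one hN1).mul_left (q ^ N)).smul_const
        (f (PowerSeries.coeff N φ))
      rw [this.tsum_eq, ← div_eq_mul_inv]
      exact (map_smul f _ _).symm

theorem baxterJ_eq_map [ContinuousAdd A] (f : S →ₐ[ℂ] A) {F : ℕ} (hF : F ≠ 0) {q : ℂ} (hq1 : ‖q‖ < 1)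
    (hq : ∀ N : ℕ, N ≠ 0 → q ^ N ≠ 1) (lam : ℂ) (t : ℕ → S) (ht : t F = 1) :
    baxterJ F q lam (fun j => f (t j)) = PowerSeries.map (f : S →+* A)
      (algJ F q (-((-lam) ^ F • t 0)) (transferSeries F t)) := by
  rw [baxterJ, algJ, map_mul, transferProd_eq_map f F hq1 hq t ht]
  congr 1
  ext N
  rw [PowerSeries.coeff_mk, PowerSeries.coeff_map, PowerSeries.coeff_mk, map_sum]
  have hz : ∀ k, (-((-lam) ^ F • f (t 0))) ^ k * PowerSeries.coeff N
      (cSeries F q (fun j => f (t j)) k) =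
      (f : S →+* A) ((-((-lam) ^ F • t 0)) ^ k *
        PowerSeries.coeff N (algC F q (transferSeries F t) k)) := by
    intro k
    rw [cSeries_eq_map f hF hq1 t ht, map_mul, map_pow, PowerSeries.coeff_map]
    congr 2
    exact (by simp : -((-lam) ^ F • f (t 0)) = f (-((-lam) ^ F • t 0)))
  simp only [hz]
  refine tsum_eq_sum fun k hk => ?_
  rw [coeff_algC_of_lt hF q _ k N (by simpa using hk), mul_zero, map_zero]

end Limits

/-- `J` is the unique solution of the Baxter equation with constant term `1`. -/
theorem isBaxterSolution_iff_eq_baxterJ {A : Type*} [Ring A] [Algebra ℂ A]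
    [TopologicalSpace A] [ContinuousAdd A] [ContinuousSMul ℂ A] [T2Space A]
    {F : ℕ} (hF : F ≠ 0) {q : ℂ} (hq0 : q ≠ 0) (hq1 : ‖q‖ < 1) (lam : ℂ) (t : ℕ → A)
    (ht : t F = 1) (hcomm : ∀ i j, Commute (t i) (t j)) (Q : PowerSeries A) :
    IsBaxterSolution F q lam t Q ∧ PowerSeries.constantCoeff Q = 1 ↔
      Q = baxterJ F q lam t := by
  have hq : ∀ N : ℕ, N ≠ 0 → q ^ N ≠ 1 := by
    intro N hN h
    have := congrArg norm h
    rw [norm_pow, norm_one] at this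
    exact (pow_lt_one₀ (norm_nonneg _) hq1 hN).ne this
  -- The t_j commute, so they generate a commutative algebra, and J is the image of `algJ` under its
  -- inclusion.
  let S := Algebra.adjoin ℂ (Set.range t)
  let _ : CommRing S :=
    { (inferInstance : Ring S) with
      mul_comm := (Algebra.isMulCommutative_adjoin ℂ (by
        rintro _ ⟨i, rfl⟩ _ ⟨j, rfl⟩
        exact hcomm i j)).is_comm.comm }
  let τ : ℕ → S := fun j => ⟨t j, Algebra.subset_adjoin ⟨j, rfl⟩⟩
  let f : S →ₐ[ℂ] A := S.val
  have hτ : τ F = 1 := Subtype.ext ht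
  have hJ : baxterJ F q lam t = PowerSeries.map (f : S →+* A)
      (algJ F q (-((-lam) ^ F • τ 0)) (transferSeries F τ)) :=
    baxterJ_eq_map f hF hq1 hq lam τ hτ
  have hsol : IsBaxterSolution F q lam t (baxterJ F q lam t) := by
    have h := congrArg (PowerSeries.map (f : S →+* A)) (algJ_baxter hF hq0 hq
      (-((-lam) ^ F • τ 0)) (τ := transferSeries F τ)
      (by rw [constantCoeff_transferSeries, hτ]))
    rw [map_mul, map_add, map_mul, map_dilate, map_dilate, ← hJ, map_transferSeries] at h
    rw [IsBaxterSolution]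
    rw [neg_neg, map_series_monomial] at h
    exact h
  have h1 : PowerSeries.constantCoeff (baxterJ F q lam t) = 1 := by
    rw [hJ, ← PowerSeries.coeff_zero_eq_constantCoeff_apply, PowerSeries.coeff_map,
      PowerSeries.coeff_zero_eq_constantCoeff_apply, constantCoeff_algJ, map_one]
  constructor
  · rintro ⟨h, h0⟩
    exact eq_of_isBaxterSolution hF hq ht h hsol (h0.trans h1.symm)
  · rintro rfl
    exact ⟨hsol, h1⟩

end RelToda

/-! ### The transfer matrix as a polynomial in x² -/

namespace RelToda

/-! ### Products of matrices over a noncommutative ring as sums over paths -/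

section Paths

variable {R ι : Type*} [Ring R] [Fintype ι] [DecidableEq ι]

theorem prod_ofFn_apply_eq_sum {n : ℕ} (L : Fin n → Matrix ι ι R) (i j : ι) :
    (List.ofFn L).prod i j = ∑ a : Fin (n + 1) → ι,
      if a 0 = i ∧ a (Fin.last n) = j then
        (List.ofFn fun f : Fin n => L f (a f.castSucc) (a f.succ)).prod else 0 := by
  induction n generalizing i with
  | zero =>
    simp only [List.ofFn_zero, List.prod_nil, Matrix.one_apply]
    rw [← (Equiv.funUnique (Fin 1) ι).symm.sum_comp]
    simp only [Equiv.funUnique_symm_apply, uniqueElim_const]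
    rw [Finset.sum_eq_single i]
    · simp
    · intro b _ hb
      simp [hb]
    · simp
  | succ n ih =>
    rw [List.ofFn_succ, List.prod_cons, Matrix.mul_apply, ← (Fin.consEquiv fun _ => ι).sum_comp,
      Fintype.sum_prod_type]
    symm
    rw [Finset.sum_eq_single i]
    · simp only [ih, Finset.mul_sum]
      rw [Finset.sum_comm]
      refine Finset.sum_congr rfl fun a _ => ?_
      rw [Finset.sum_eq_single (a 0)]
      · simp only [true_and, Fin.consEquiv_apply, Fin.cons_zero, ← Fin.succ_last, Fin.cons_succ,
          mul_ite, mul_zero, List.ofFn_succ, Fin.castSucc_zero, List.prod_cons,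
          ← Fin.succ_castSucc]
      · intro b _ hb
        rw [if_neg (fun h => hb h.1.symm), mul_zero]
      · simp
    · intro b _ hb
      refine Finset.sum_eq_zero fun a _ => ?_
      rw [if_neg (fun h => hb h.1)]
    · simp

theorem trace_prod_ofFn {F : ℕ} [NeZero F] (L : Fin F → Matrix ι ι R) :
    (List.ofFn L).prod.trace = ∑ a : Fin F → ι,
      (List.ofFn fun f => L f (a f) (a (f + 1))).prod := by
  obtain ⟨n, rfl⟩ : ∃ n, F = n + 1 := ⟨F - 1, (Nat.succ_pred_eq_of_ne_zero (NeZero.ne F)).symm⟩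
  simp only [Matrix.trace, Matrix.diag, prod_ofFn_apply_eq_sum]
  rw [Finset.sum_comm]
  -- A path through F factors has F + 1 vertices. The last one is split off, and the trace forces it
  -- to equal the first.
  rw [← (Fin.snocEquiv fun _ => ι).sum_comp, Fintype.sum_prod_type, Finset.sum_comm]
  refine Finset.sum_congr rfl fun a _ => ?_
  rw [Finset.sum_eq_single (a 0)]
  · rw [Finset.sum_eq_single (a 0)]
    · have h0 : (Fin.snoc (α := fun _ => ι) a (a 0) : Fin (n + 2) → ι) 0 = a 0 :=
        Fin.snoc_castSucc (α := fun _ => ι) (a 0) a 0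
      simp only [Fin.snocEquiv_apply, h0, Fin.snoc_last, and_self, if_true, Fin.snoc_castSucc]
      congr 2
      funext f
      congr 1
      induction f using Fin.lastCases with
      | last => rw [Fin.succ_last, Fin.snoc_last, Fin.last_add_one]
      | cast f => rw [Fin.succ_castSucc, Fin.snoc_castSucc, Fin.coeSucc_eq_succ]
    · intro b _ hb
      rw [if_neg]
      rintro ⟨-, h⟩
      simp only [Fin.snocEquiv_apply, Fin.snoc_last] at h
      exact hb h.symm
    · simp
  · intro b _ hb
    refine Finset.sum_eq_zero fun i _ => ?_
    rw [if_neg]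
    rintro ⟨h, h'⟩
    simp only [Fin.snocEquiv_apply, Fin.snoc_last] at h h'
    have h0 : (Fin.snoc (α := fun _ => ι) a b : Fin (n + 2) → ι) 0 = a 0 :=
      Fin.snoc_castSucc (α := fun _ => ι) b a 0
    exact hb (by rw [h', ← h, h0])
  · simp

end Paths

/-! ### The transfer matrix as a polynomial -/

section TransferPolynomial

open LaurentPolynomial in
/-- The substitution `X ↦ x²`. -/
noncomputable def polyToLaurent (A : Type*) [Ring A] :
    Polynomial A →+* LaurentPolynomial A :=
  Polynomial.eval₂RingHom' C (T 2) fun a => (commute_T 2 (C a)).symm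

variable {A : Type*} [Ring A] [Algebra ℂ A]

/-- The Lax operator, rescaled and gauged so that its entries are polynomials in `X = x²`. -/
noncomputable def laxPoly (qh lam : ℂ) (u v : Aˣ) : Matrix (Fin 2) (Fin 2) (Polynomial A) :=
  !![1 - Polynomial.C (u.val ^ 2) * Polynomial.X, -Polynomial.C (u * v : Aˣ).val;
    -(Polynomial.C ((qh⁻¹ * lam) • (u * v⁻¹ : Aˣ).val) * Polynomial.X), 0]

/-- The transfer matrix as a polynomial in `X = x²`. -/
noncomputable def transferPoly {F : ℕ} (qh lam : ℂ) (u v : Fin F → Aˣ) : Polynomial A :=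
  (List.ofFn fun f => laxPoly qh lam (u f) (v f)).prod.trace

open LaurentPolynomial in
theorem conj_diag {B : Type*} [Ring B] (N : Matrix (Fin 2) (Fin 2) (LaurentPolynomial B)) :
    !![1, 0; 0, T (-1)] * N * !![1, 0; 0, T 1] =
      !![N 0 0, N 0 1 * T 1; T (-1) * N 1 0, T (-1) * N 1 1 * T 1] := by
  conv_lhs => rw [Matrix.eta_fin_two N]
  simp only [Matrix.mul_fin_two, one_mul, zero_mul, mul_one, mul_zero, add_zero, zero_add]

open LaurentPolynomial in
-- The factor −xu clears the negative powers of x, and conjugation by diag(1, x) moves the odd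
-- powers between the off-diagonal entries, leaving polynomials in x².
theorem smul_laxMatrix (qh lam : ℂ) (u v : Aˣ) :
    (-(T 1 : LaurentPolynomial A) * C u.val) • laxMatrix qh lam u v =
      !![1, 0; 0, T (-1)] * (polyToLaurent A).mapMatrix (laxPoly qh lam u v) *
        !![1, 0; 0, T 1] := by
  have hX : polyToLaurent A Polynomial.X = T 2 := by
    simp [polyToLaurent, Polynomial.eval₂RingHom']
  have hC : ∀ a, polyToLaurent A (Polynomial.C a) = C a := by
    simp [polyToLaurent, Polynomial.eval₂RingHom']
  have h1 : (C u.val : LaurentPolynomial A) * C (u⁻¹).val = 1 := by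
    rw [← map_mul, Units.mul_inv, map_one]
  have h2 : ∀ p : LaurentPolynomial A, T 1 * p = p * T 1 := fun p => T_mul 1 p
  have h11 : (T 1 : LaurentPolynomial A) * T 1 = T 2 := by rw [← T_add]; rfl
  have h1m : (T (-1) : LaurentPolynomial A) * T 1 = 1 := by rw [← T_add, neg_add_cancel, T_zero]
  have hm1 : (T 1 : LaurentPolynomial A) * T (-1) = 1 := by rw [← T_add, add_neg_cancel, T_zero]
  rw [conj_diag]
  refine Matrix.ext fun i j => ?_
  have e00 : (polyToLaurent A).mapMatrix (laxPoly qh lam u v) 0 0 =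
      1 - C (u.val ^ 2) * T 2 := by
    change polyToLaurent A (1 - _) = _
    rw [map_sub, map_one, map_mul, hC, hX]
  have e01 : (polyToLaurent A).mapMatrix (laxPoly qh lam u v) 0 1 = -C (u.val * v.val) := by
    change polyToLaurent A (-Polynomial.C (u * v : Aˣ).val) = _
    rw [map_neg, hC, Units.val_mul]
  have e10 : (polyToLaurent A).mapMatrix (laxPoly qh lam u v) 1 0 =
      -(C (u.val * ((qh⁻¹ * lam) • (v⁻¹).val)) * T 2) := by
    change polyToLaurent A (-(Polynomial.C ((qh⁻¹ * lam) • (u * v⁻¹ : Aˣ).val) *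
      Polynomial.X)) = _
    rw [map_neg, map_mul, hC, hX, Units.val_mul, mul_smul_comm]
  have e11 : (polyToLaurent A).mapMatrix (laxPoly qh lam u v) 1 1 = 0 :=
    map_zero (polyToLaurent A)
  fin_cases i <;> fin_cases j
  · change -T 1 * C u.val * (C u.val * T 1 - C (u⁻¹).val * T (-1)) =
      (polyToLaurent A).mapMatrix (laxPoly qh lam u v) 0 0
    rw [e00, mul_sub, neg_mul, neg_mul, neg_mul, sub_neg_eq_add, mul_assoc (T 1),
      ← mul_assoc (C _) (C _) (T 1), h2, mul_assoc _ (T 1), h11, ← map_mul, ← pow_two,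
      mul_assoc (T 1), ← mul_assoc (C _) (C _), h1, one_mul, hm1]
    abel
  · change -T 1 * C u.val * C v.val =
      (polyToLaurent A).mapMatrix (laxPoly qh lam u v) 0 1 * T 1
    rw [e01, neg_mul, neg_mul, neg_mul, mul_assoc, ← map_mul, h2]
  · change -T 1 * C u.val * C ((qh⁻¹ * lam) • (v⁻¹).val) =
      T (-1) * (polyToLaurent A).mapMatrix (laxPoly qh lam u v) 1 0
    rw [e10, mul_neg, neg_mul, neg_mul, mul_assoc, ← map_mul, ← T_mul, ← mul_assoc, ← T_add]
    rfl
  · change -T 1 * C u.val * 0 =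
      T (-1) * (polyToLaurent A).mapMatrix (laxPoly qh lam u v) 1 1 * T 1
    rw [e11, mul_zero, mul_zero, zero_mul]

open LaurentPolynomial in
-- Each u_g is moved past the Lax matrices of the preceding sites, with which it commutes; the
-- absence of repetitions in the list is what makes this legitimate.
theorem smul_prod_laxMatrix {ι : Type*} (qh lam : ℂ) (u v : ι → Aˣ)
    (hu : ∀ f g, f ≠ g → Commute (u f).val (u g).val)
    (huv : ∀ f g, f ≠ g → Commute (u f).val (v g).val) (l : List ι) (hl : l.Nodup) :
    ((-(T 1 : LaurentPolynomial A)) ^ l.length * C ((l.map u).prod).val) •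
        (l.map fun f => laxMatrix qh lam (u f) (v f)).prod =
      (l.map fun f => (-(T 1 : LaurentPolynomial A) * C (u f).val) •
        laxMatrix qh lam (u f) (v f)).prod := by
  induction l with
  | nil => simp
  | cons f l ih =>
    rw [List.nodup_cons] at hl
    simp only [List.map_cons, List.prod_cons, List.length_cons, ← ih hl.2]
    have hUu : ∀ g, g ∉ l → Commute ((l.map u).prod).val (u g).val := by
      intro g hg
      rw [← Units.coeHom_apply, map_list_prod, List.map_map]
      refine Commute.list_prod_left _ _ fun x hx => ?_
      obtain ⟨h, hh, rfl⟩ := List.mem_map.1 hx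
      exact hu h g (by rintro rfl; exact hg hh)
    have hUv : ∀ g, g ∉ l → Commute ((l.map u).prod).val (v g).val := by
      intro g hg
      rw [← Units.coeHom_apply, map_list_prod, List.map_map]
      refine Commute.list_prod_left _ _ fun x hx => ?_
      obtain ⟨h, hh, rfl⟩ := List.mem_map.1 hx
      exact huv h g (by rintro rfl; exact hg hh)
    have hL : ∀ i j, Commute ((-(T 1 : LaurentPolynomial A)) ^ l.length *
        C ((l.map u).prod).val) (laxMatrix qh lam (u f) (v f) i j) := by
      intro i j
      refine Commute.mul_left
        ((commute_T 1 (laxMatrix qh lam (u f) (v f) i j)).neg_left.pow_left _) ?_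
      have e1 := (hUu f hl.1).map (C : A →+* LaurentPolynomial A)
      have e2 := ((hUu f hl.1).units_inv_right).map (C : A →+* LaurentPolynomial A)
      have e3 := (hUv f hl.1).map (C : A →+* LaurentPolynomial A)
      have e4 := (((hUv f hl.1).units_inv_right).smul_right (qh⁻¹ * lam)).map
        (C : A →+* LaurentPolynomial A)
      fin_cases i <;> fin_cases j
      · exact (e1.mul_right (commute_T _ _).symm).sub_right (e2.mul_right (commute_T _ _).symm)
      · exact e3
      · exact e4
      · exact Commute.zero_right _
    refine Matrix.ext fun i j => ?_
    simp only [Matrix.smul_apply, Matrix.mul_apply, smul_eq_mul, Finset.mul_sum]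
    refine Finset.sum_congr rfl fun m _ => ?_
    have hx := hL i m
    generalize laxMatrix qh lam (u f) (v f) i m = x at hx ⊢
    generalize (l.map fun f => laxMatrix qh lam (u f) (v f)).prod m j = y
    have e : -T 1 * C (u f).val * x * ((-T 1) ^ l.length * C ((l.map u).prod).val * y) =
        -T 1 * C (u f).val * ((-T 1) ^ l.length * C ((l.map u).prod).val * x) * y := by
      rw [hx.eq]
      simp only [mul_assoc]
    have := (commute_T 1 (C (u f).val : LaurentPolynomial A)).neg_left.pow_left l.length
    rw [e, pow_succ', Units.val_mul, map_mul]
    simp only [mul_assoc]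
    congr 1
    rw [← mul_assoc _ (C (u f).val), this.eq, mul_assoc]

theorem list_prod_conj {M ι : Type*} [Monoid M] {a b : M} (hab : a * b = 1) (hba : b * a = 1)
    (N : ι → M) (l : List ι) :
    (l.map fun f => a * N f * b).prod = a * (l.map N).prod * b := by
  induction l with
  | nil => simp [hab]
  | cons f l ih =>
    rw [List.map_cons, List.prod_cons, ih, List.map_cons, List.prod_cons]
    simp only [mul_assoc]
    rw [← mul_assoc b a, hba, one_mul]

open LaurentPolynomial in
-- The trace over a noncommutative ring is not cyclic, but the entries of the conjugating matrices
-- are powers of x, hence central, and they cancel in the diagonal entries.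
theorem transferMatrix_eq {F : ℕ} (qh lam : ℂ) (u v : Fin F → Aˣ)
    (hu : ∀ f g, f ≠ g → Commute (u f).val (u g).val)
    (huv : ∀ f g, f ≠ g → Commute (u f).val (v g).val) :
    transferMatrix qh lam u v = polyToLaurent A (transferPoly qh lam u v) := by
  have h := smul_prod_laxMatrix qh lam u v hu huv (List.finRange F) (List.nodup_finRange F)
  simp only [List.length_finRange, smul_laxMatrix] at h
  have hconj : ∀ l : List (Fin F), (l.map fun f => !![1, 0; 0, T (-1)] *
      (polyToLaurent A).mapMatrix (laxPoly qh lam (u f) (v f)) * !![1, 0; 0, T 1]).prod =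
      !![1, 0; 0, T (-1)] * (polyToLaurent A).mapMatrix
        (l.map fun f => laxPoly qh lam (u f) (v f)).prod * !![1, 0; 0, T 1] := by
    have e1 : (!![1, 0; 0, T (-1)] * !![1, 0; 0, T 1] :
        Matrix (Fin 2) (Fin 2) (LaurentPolynomial A)) = 1 := by
      rw [Matrix.mul_fin_two, Matrix.one_fin_two, ← T_add]
      simp only [neg_add_cancel, T_zero, mul_one, mul_zero, add_zero, zero_add, zero_mul]
    have e2 : (!![1, 0; 0, T 1] * !![1, 0; 0, T (-1)] :
        Matrix (Fin 2) (Fin 2) (LaurentPolynomial A)) = 1 := by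
      rw [Matrix.mul_fin_two, Matrix.one_fin_two, ← T_add]
      simp only [add_neg_cancel, T_zero, mul_one, mul_zero, add_zero, zero_add, zero_mul]
    intro l
    rw [list_prod_conj e1 e2, map_list_prod, List.map_map]
    rfl
  have h2 := congrArg Matrix.trace h
  rw [Matrix.trace_smul, hconj] at h2
  rw [transferMatrix, transferPoly, List.ofFn_eq_map, List.ofFn_eq_map, List.ofFn_eq_map,
    ← smul_eq_mul, h2]
  rw [conj_diag, Matrix.trace_fin_two_of, Matrix.trace_fin_two, map_add, ← T_mul, ← mul_assoc,
    ← T_add, add_neg_cancel, T_zero, one_mul]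
  rfl

theorem natDegree_prod_laxPoly_le {ι : Type*} (qh lam : ℂ) (u v : ι → Aˣ) (l : List ι)
    (i j : Fin 2) :
    ((l.map fun f => laxPoly qh lam (u f) (v f)).prod i j).natDegree ≤ l.length := by
  have hX : ∀ a : A, (Polynomial.C a * Polynomial.X).natDegree ≤ 1 := fun a => by
    simpa using Polynomial.natDegree_C_mul_X_pow_le a 1
  have h1 : ∀ f i j, (laxPoly qh lam (u f) (v f) i j).natDegree ≤ 1 := by
    intro f i j
    fin_cases i <;> fin_cases j
    · exact Polynomial.natDegree_sub_le_of_le (Polynomial.natDegree_one.le.trans zero_le_one) (hX _)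
    · exact (Polynomial.natDegree_neg_le_of_le (Polynomial.natDegree_C _).le).trans zero_le_one
    · exact Polynomial.natDegree_neg_le_of_le (hX _)
    · exact (Polynomial.natDegree_zero).le.trans zero_le_one
  induction l generalizing i with
  | nil =>
    simp only [List.map_nil, List.prod_nil, List.length_nil, Matrix.one_apply]
    split_ifs <;> simp
  | cons f l ih =>
    simp only [List.map_cons, List.prod_cons, List.length_cons, Matrix.mul_apply]
    refine Polynomial.natDegree_sum_le_of_forall_le _ _ fun m _ => ?_
    rw [add_comm]
    exact Polynomial.natDegree_mul_le_of_le (h1 f i m) (ih m)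

theorem natDegree_transferPoly_le {F : ℕ} (qh lam : ℂ) (u v : Fin F → Aˣ) :
    (transferPoly qh lam u v).natDegree ≤ F := by
  rw [transferPoly, Matrix.trace, List.ofFn_eq_map]
  refine Polynomial.natDegree_sum_le_of_forall_le _ _ fun m _ => ?_
  simpa using natDegree_prod_laxPoly_le qh lam u v (List.finRange F) m m

/-- At X = 0 each factor has zero second row and upper left entry 1. A nonempty chain is needed: the
empty product has trace 2. -/
theorem coeff_zero_transferPoly {F : ℕ} [NeZero F] (qh lam : ℂ) (u v : Fin F → Aˣ) :
    (transferPoly qh lam u v).coeff 0 = 1 := by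
  obtain ⟨n, rfl⟩ : ∃ n, F = n + 1 := ⟨F - 1, (Nat.succ_pred_eq_of_ne_zero (NeZero.ne F)).symm⟩
  have h : ∀ l : List (Fin (n + 1)),
      ((l.map fun f => laxPoly qh lam (u f) (v f)).prod 0 0).coeff 0 = 1 ∧
      ((l.map fun f => laxPoly qh lam (u f) (v f)).prod 1 0).coeff 0 = 0 := by
    intro l
    induction l with
    | nil => simp
    | cons f l ih =>
      simp only [List.map_cons, List.prod_cons, Matrix.mul_apply, Fin.sum_univ_two,
        Polynomial.coeff_add, Polynomial.mul_coeff_zero, ih]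
      simp [laxPoly]
  rw [transferPoly, Matrix.trace_fin_two, Polynomial.coeff_add, List.ofFn_eq_map, (h _).1,
    List.finRange_succ, List.map_cons, List.prod_cons, Matrix.mul_apply, Fin.sum_univ_two]
  simp only [Polynomial.coeff_add, Polynomial.mul_coeff_zero]
  simp [laxPoly]

/-- The second column of each factor has degree 0 in X, so degree F is reached only by taking the
upper left entry at every site. -/
theorem coeff_top_transferPoly {F : ℕ} [NeZero F] (qh lam : ℂ) (u v : Fin F → Aˣ) :
    (transferPoly qh lam u v).coeff F = (-1) ^ F * (List.ofFn fun f => u f ^ 2).prod.val := by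
  obtain ⟨n, rfl⟩ : ∃ n, F = n + 1 := ⟨F - 1, (Nat.succ_pred_eq_of_ne_zero (NeZero.ne F)).symm⟩
  have h : ∀ l : List (Fin (n + 1)),
      ((l.map fun f => laxPoly qh lam (u f) (v f)).prod 0 0).coeff l.length =
        (-1) ^ l.length * ((l.map fun f => u f ^ 2).prod).val ∧
      ((l.map fun f => laxPoly qh lam (u f) (v f)).prod 0 1).coeff l.length = 0 := by
    have hneg : ∀ (a : A) (p : Polynomial A) (l : ℕ), p.natDegree ≤ l →
        ((-Polynomial.C a) * p).coeff (l + 1) = 0 := by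
      intro a p l hp
      rw [← Polynomial.C_neg, Polynomial.coeff_C_mul,
        Polynomial.coeff_eq_zero_of_natDegree_lt (by omega), mul_zero]
    have hlin : ∀ (a : A) (p : Polynomial A) (l : ℕ), p.natDegree ≤ l →
        ((1 - Polynomial.C a * Polynomial.X) * p).coeff (l + 1) = - (a * p.coeff l) := by
      intro a p l hp
      rw [sub_mul, one_mul, Polynomial.coeff_sub, Polynomial.coeff_eq_zero_of_natDegree_lt (by omega),
        mul_assoc, Polynomial.coeff_C_mul, Polynomial.coeff_X_mul, zero_sub]
    intro l
    induction l with
    | nil => simp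
    | cons f l ih =>
      have hd := natDegree_prod_laxPoly_le qh lam u v l
      have e0 : laxPoly qh lam (u f) (v f) 0 0 =
        1 - Polynomial.C ((u f).val ^ 2) * Polynomial.X := rfl
      have e1 : laxPoly qh lam (u f) (v f) 0 1 = -Polynomial.C (u f * v f : Aˣ).val := rfl
      simp only [List.map_cons, List.prod_cons, Matrix.mul_apply, Fin.sum_univ_two,
        Polynomial.coeff_add, List.length_cons, e0, e1, hlin _ _ _ (hd _ _), hneg _ _ _ (hd _ _),
        ih]
      refine ⟨?_, by simp⟩
      rw [Units.val_mul, Units.val_pow_eq_pow_val, add_zero, pow_succ' (-1 : A) l.length,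
        neg_one_mul, neg_mul, ← mul_assoc, ← mul_assoc,
        ((Commute.neg_one_left ((u f).val ^ 2)).pow_left l.length).eq]
  rw [transferPoly, Matrix.trace_fin_two, Polynomial.coeff_add, List.ofFn_eq_map, List.ofFn_eq_map]
  have h0 := (h (List.finRange (n + 1))).1
  rw [List.length_finRange] at h0
  rw [h0, add_eq_left, List.finRange_succ, List.map_cons, List.prod_cons, Matrix.mul_apply,
    Fin.sum_univ_two]
  have hz := (h ((List.finRange n).map Fin.succ)).2
  rw [List.length_map, List.length_finRange] at hz
  have e2 : laxPoly qh lam (u 0) (v 0) 1 0 =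
    -(Polynomial.C ((qh⁻¹ * lam) • (u 0 * (v 0)⁻¹ : Aˣ).val) * Polynomial.X) := rfl
  have e3 : laxPoly qh lam (u 0) (v 0) 1 1 = 0 := rfl
  rw [Polynomial.coeff_add, e2, e3, zero_mul, Polynomial.coeff_zero, add_zero, neg_mul,
    Polynomial.coeff_neg, mul_assoc, Polynomial.coeff_C_mul, Polynomial.coeff_X_mul, hz, mul_zero,
    neg_zero]

open LaurentPolynomial in
theorem polyToLaurent_eq_sum {B : Type*} [Ring B] (p : Polynomial B) {F : ℕ} (hp : p.natDegree ≤ F) :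
    polyToLaurent B p = ∑ i ∈ Finset.range (F + 1), C (p.coeff i) * T (2 * (i : ℤ)) := by
  rw [polyToLaurent, Polynomial.eval₂RingHom']
  change Polynomial.eval₂ C (T 2) p = _
  rw [Polynomial.eval₂_eq_sum_range' C (Nat.lt_succ_of_le hp)]
  refine Finset.sum_congr rfl fun i _ => ?_
  rw [T_pow, mul_comm (i : ℤ)]

open LaurentPolynomial in
theorem coeff_polyToLaurent {B : Type*} [Ring B] (p : Polynomial B) (i : ℕ) :
    (polyToLaurent B p).coeff (2 * (i : ℕ)) = p.coeff i := by
  rw [polyToLaurent_eq_sum p (le_max_left p.natDegree i), AddMonoidAlgebra.coeff_sum,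
    Finsupp.finsetSum_apply, Finset.sum_eq_single_of_mem i (by simp)]
  · rw [← single_eq_C_mul_T, AddMonoidAlgebra.coeff_single, Finsupp.single_eq_same]
  · intro j _ hj
    rw [← single_eq_C_mul_T, AddMonoidAlgebra.coeff_single, Finsupp.single_eq_of_ne]
    omega

theorem transferCoeff_eq {F : ℕ} (qh lam : ℂ) (u v : Fin F → Aˣ)
    (hu : ∀ f g, f ≠ g → Commute (u f).val (u g).val)
    (huv : ∀ f g, f ≠ g → Commute (u f).val (v g).val) (j : ℕ) :
    transferCoeff qh lam u v j = (-1) ^ (F - j) * (transferPoly qh lam u v).coeff (F - j) := by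
  rw [transferCoeff, transferMatrix_eq qh lam u v hu huv, ← coeff_polyToLaurent]

open LaurentPolynomial in
theorem transferMatrix_eq_transferLaurent {F : ℕ} (qh lam : ℂ) (u v : Fin F → Aˣ)
    (hu : ∀ f g, f ≠ g → Commute (u f).val (u g).val)
    (huv : ∀ f g, f ≠ g → Commute (u f).val (v g).val) :
    transferMatrix qh lam u v = transferLaurent F (transferCoeff qh lam u v) := by
  rw [transferMatrix_eq qh lam u v hu huv,
    polyToLaurent_eq_sum _ (natDegree_transferPoly_le qh lam u v), transferLaurent,
    ← Finset.sum_range_reflect]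
  refine Finset.sum_congr rfl fun j hj => ?_
  rw [Finset.mem_range] at hj
  have e : F + 1 - 1 - j = F - j := by omega
  rw [transferCoeff_eq qh lam u v hu huv, e, map_mul, map_pow, map_neg, map_one, ← mul_assoc,
    ← Commute.mul_pow (Commute.neg_one_right _), mul_neg_one, neg_neg, T_pow, ← T_mul,
    mul_comm (2 : ℤ)]

theorem transferSeries_transferCoeff {F : ℕ} (qh lam : ℂ) (u v : Fin F → Aˣ)
    (hu : ∀ f g, f ≠ g → Commute (u f).val (u g).val)
    (huv : ∀ f g, f ≠ g → Commute (u f).val (v g).val) (N : ℕ) :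
    PowerSeries.coeff N (transferSeries F (transferCoeff qh lam u v)) =
      (transferPoly qh lam u v).coeff N := by
  rw [coeff_transferSeries]
  split_ifs with h
  · rw [transferCoeff_eq qh lam u v hu huv, Nat.sub_sub_self h, ← mul_assoc, ← pow_add,
      ← two_mul, pow_mul, neg_one_sq, one_pow, one_mul]
  · rw [Polynomial.coeff_eq_zero_of_natDegree_lt]
    exact lt_of_le_of_lt (natDegree_transferPoly_le qh lam u v) (by omega)

end TransferPolynomial

end RelToda

/-! ### Explicit matrix elements of the transfer matrix -/

namespace RelToda

/-! ### Monomial operators -/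

section Monomial

variable {F : ℕ}

/-- The matrix elements of an operator. -/
noncomputable def entry (a : Op F) (k' k : Fin F → ℤ) : ℂ := a (Finsupp.single k 1) k'

theorem op_ext {a b : Op F} (h : ∀ k' k, entry a k' k = entry b k' k) : a = b :=
  Finsupp.lhom_ext' fun k => LinearMap.ext_ring (Finsupp.ext fun k' => h k' k)

/-- The operator `|k⟩ ↦ c(k + m) |k + m⟩`. -/
noncomputable def monoOp (c : (Fin F → ℤ) → ℂ) (m : Fin F → ℤ) : Op F := diagOp c * shiftOp m

theorem monoOp_single (c : (Fin F → ℤ) → ℂ) (m k : Fin F → ℤ) (x : ℂ) :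
    monoOp c m (Finsupp.single k x) = Finsupp.single (k + m) (x * c (k + m)) := by
  rw [monoOp, Module.End.mul_apply, shiftOp_single, diagOp_single]

theorem monoOp_apply (c : (Fin F → ℤ) → ℂ) (m : Fin F → ℤ) (x : (Fin F → ℤ) →₀ ℂ)
    (k' : Fin F → ℤ) : monoOp c m x k' = c k' * x (k' - m) := by
  induction x using Finsupp.induction_linear with
  | zero => simp
  | add x y hx hy => rw [map_add, Finsupp.add_apply, hx, hy, Finsupp.add_apply, mul_add]
  | single k x =>
    rw [monoOp_single, Finsupp.single_apply, Finsupp.single_apply]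
    by_cases h : k + m = k'
    · rw [if_pos h, if_pos (by rw [← h]; abel), h, mul_comm]
    · rw [if_neg h, if_neg (fun h' => h (by rw [h']; abel)), mul_zero]

theorem entry_monoOp (c : (Fin F → ℤ) → ℂ) (m k' k : Fin F → ℤ) :
    entry (monoOp c m) k' k = if k' = k + m then c k' else 0 := by
  rw [entry, monoOp_single, Finsupp.single_apply, one_mul]
  by_cases h : k' = k + m
  · rw [if_pos h, if_pos h.symm, h]
  · rw [if_neg h, if_neg (fun h' => h h'.symm)]

theorem entry_monoOp_mul (c : (Fin F → ℤ) → ℂ) (m : Fin F → ℤ) (b : Op F)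
    (k' k : Fin F → ℤ) :
    entry (monoOp c m * b) k' k = c k' * entry b (k' - m) k := by
  rw [entry, Module.End.mul_apply, monoOp_apply]
  rfl

theorem monoOp_mul (c c' : (Fin F → ℤ) → ℂ) (m m' : Fin F → ℤ) :
    monoOp c m * monoOp c' m' = monoOp (fun k => c k * c' (k - m)) (m + m') := by
  refine op_ext fun k' k => ?_
  rw [entry_monoOp_mul, entry_monoOp, entry_monoOp]
  by_cases h : k' = k + (m + m')
  · rw [if_pos h, if_pos (by rw [h]; abel)]
  · rw [if_neg h, if_neg, mul_zero]
    intro h'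
    apply h
    rw [← sub_add_cancel k' m, h']
    abel

theorem monoOp_one : monoOp (F := F) (fun _ => 1) 0 = 1 := by
  refine op_ext fun k' k => ?_
  rw [entry_monoOp, entry, Module.End.one_apply, Finsupp.single_apply, add_zero]
  simp only [eq_comm]

theorem smul_monoOp (x : ℂ) (c : (Fin F → ℤ) → ℂ) (m : Fin F → ℤ) :
    x • monoOp c m = monoOp (fun k => x * c k) m := by
  refine op_ext fun k' k => ?_
  rw [entry_monoOp]
  change x * entry (monoOp c m) k' k = _
  rw [entry_monoOp, mul_ite, mul_zero]

theorem diagOp_eq_monoOp (c : (Fin F → ℤ) → ℂ) : diagOp c = monoOp c 0 := by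
  refine op_ext fun k' k => ?_
  rw [entry_monoOp, entry, diagOp_single, Finsupp.single_apply, add_zero, one_mul]
  by_cases h : k = k'
  · simp [h]
  · rw [if_neg h, if_neg (Ne.symm h)]

theorem diagOp_mul_monoOp (c c' : (Fin F → ℤ) → ℂ) (m : Fin F → ℤ) :
    diagOp c * monoOp c' m = monoOp (fun k => c k * c' k) m := by
  rw [diagOp_eq_monoOp, monoOp_mul, zero_add]
  simp only [sub_zero]

/-- Each coefficient depends on its own site only, so the shifts at the other sites do not affect
it. -/
theorem list_prod_monoOp (c : Fin F → ℤ → ℂ) (m : Fin F → ℤ) (l : List (Fin F)) (hl : l.Nodup) :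
    (l.map fun f => monoOp (fun k => c f (k f)) (Pi.single f (m f))).prod =
      monoOp (fun k => (l.map fun f => c f (k f)).prod) (l.map fun f => Pi.single f (m f)).sum := by
  induction l with
  | nil => exact monoOp_one.symm
  | cons f l ih =>
    rw [List.nodup_cons] at hl
    simp only [List.map_cons, List.prod_cons, List.sum_cons, ih hl.2, monoOp_mul]
    congr 1
    funext k
    congr 2
    refine List.map_congr_left fun g hg => ?_
    have : g ≠ f := by rintro rfl; exact hl.1 hg
    rw [Pi.sub_apply, Pi.single_eq_of_ne this, sub_zero]

theorem prod_ofFn_monoOp (c : Fin F → ℤ → ℂ) (m : Fin F → ℤ) :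
    (List.ofFn fun f => monoOp (fun k => c f (k f)) (Pi.single f (m f))).prod =
      monoOp (fun k => ∏ f, c f (k f)) m := by
  rw [List.ofFn_eq_map, list_prod_monoOp c m _ (List.nodup_finRange F)]
  have h1 : ∀ k : Fin F → ℤ, ((List.finRange F).map fun f => c f (k f)).prod =
      ∏ f, c f (k f) := fun k => by
    rw [← List.ofFn_eq_map, List.prod_ofFn]
  have h2 : ((List.finRange F).map fun f => (Pi.single f (m f) : Fin F → ℤ)).sum = m := by
    rw [← List.ofFn_eq_map, List.sum_ofFn, Finset.univ_sum_single]
  simp only [h1, h2]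

end Monomial

/-! ### The Weyl monomials in terms of shifts -/

section Weyl

variable {F : ℕ} (η : ℂ) (σ : Fin F → ℂ)

/-- The local factor of the diagonal operator that conjugates `v_f` into `u_f v_f`. -/
noncomputable def siteGauge (f : Fin F) (κ : ℤ) : ℂ :=
  Complex.exp (η * (κ * σ f + κ * (κ + 1) / 2) / 2)

/-- The diagonal operator that conjugates `v_f` into `u_f v_f` for all `f`. -/
noncomputable def gauge (k : Fin F → ℤ) : ℂ := ∏ f, siteGauge η σ f (k f)

theorem siteGauge_ne_zero (f : Fin F) (κ : ℤ) : siteGauge η σ f κ ≠ 0 := Complex.exp_ne_zero _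

theorem gauge_ne_zero (k : Fin F → ℤ) : gauge η σ k ≠ 0 :=
  Finset.prod_ne_zero_iff.2 fun f _ => siteGauge_ne_zero η σ f _

theorem gauge_div (k m : Fin F → ℤ) :
    gauge η σ k / gauge η σ (k - m) =
      ∏ f, siteGauge η σ f (k f) / siteGauge η σ f (k f - m f) := by
  rw [gauge, gauge, Finset.prod_div_distrib]
  rfl

/-- The shift by `m`, conjugated by the diagonal operator `gauge`. -/
noncomputable def weylUnit (m : Fin F → ℤ) : (Op F)ˣ where
  val := monoOp (fun k => gauge η σ k / gauge η σ (k - m)) m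
  inv := monoOp (fun k => gauge η σ k / gauge η σ (k + m)) (-m)
  val_inv := by
    rw [monoOp_mul, ← monoOp_one, add_neg_cancel]
    congr 1
    funext k
    rw [sub_add_cancel]
    field_simp [gauge_ne_zero]
  inv_val := by
    rw [monoOp_mul, ← monoOp_one, neg_add_cancel]
    congr 1
    funext k
    rw [sub_neg_eq_add, add_sub_cancel_right]
    field_simp [gauge_ne_zero]

/-- The monomials in the operators `u_f v_f`, as conjugated shifts. -/
noncomputable def weylShift : Multiplicative (Fin F → ℤ) →* (Op F)ˣ where
  toFun m := weylUnit η σ m.toAdd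
  map_one' := by
    refine Units.ext ?_
    change monoOp (fun k => gauge η σ k / gauge η σ (k - 0)) 0 = 1
    rw [← monoOp_one]
    congr 1
    funext k
    rw [sub_zero, div_self (gauge_ne_zero η σ k)]
  map_mul' m m' := by
    refine Units.ext ?_
    change monoOp (fun k => gauge η σ k / gauge η σ (k - (m.toAdd + m'.toAdd)))
      (m.toAdd + m'.toAdd) = monoOp _ _ * monoOp _ _
    rw [monoOp_mul]
    congr 1
    funext k
    have := gauge_ne_zero η σ (k - m.toAdd)
    rw [sub_add_eq_sub_sub]
    field_simp

theorem weylShift_val (m : Fin F → ℤ) : (weylShift η σ (Multiplicative.ofAdd m)).val =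
    monoOp (fun k => gauge η σ k / gauge η σ (k - m)) m := rfl

theorem weylShift_single (f : Fin F) (m : ℤ) :
    (weylShift η σ (Multiplicative.ofAdd (Pi.single f m))).val =
      monoOp (fun k => siteGauge η σ f (k f) / siteGauge η σ f (k f - m)) (Pi.single f m) := by
  rw [weylShift_val]
  congr 1
  funext k
  rw [gauge_div, Finset.prod_eq_single f]
  · rw [Pi.single_eq_same]
  · intro g _ hg
    rw [Pi.single_eq_of_ne hg, sub_zero, div_self (siteGauge_ne_zero η σ g _)]
  · simp

/-- The quadratic exponent in `siteGauge` is chosen so that its ratio at κ and κ − 1 is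
q^{(σ_f+κ)/2}, the eigenvalue of u_f. -/
theorem uvOp_eq (f : Fin F) :
    uvOp η σ f = weylShift η σ (Multiplicative.ofAdd (Pi.single f 1)) := by
  refine Units.ext ?_
  rw [weylShift_single, uvOp, Units.val_mul]
  change monoOp _ _ = _
  congr 1
  funext k
  rw [siteGauge, siteGauge, ← Complex.exp_sub]
  congr 1
  push_cast
  ring

theorem uvOp_zpow (f : Fin F) (m : ℤ) :
    uvOp η σ f ^ m = weylShift η σ (Multiplicative.ofAdd (Pi.single f m)) := by
  rw [uvOp_eq, ← map_zpow, ← ofAdd_zsmul, ← Pi.single_smul, smul_eq_mul, mul_one]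

theorem uvMonomial_eq (m : Fin F → ℤ) :
    uvMonomial η σ m = weylShift η σ (Multiplicative.ofAdd m) := by
  rw [uvMonomial]
  simp only [uvOp_zpow]
  have : (fun f => weylShift η σ (Multiplicative.ofAdd (Pi.single f (m f)))) =
      weylShift η σ ∘ fun f => Multiplicative.ofAdd (Pi.single f (m f)) := rfl
  rw [this, ← List.map_ofFn, ← map_list_prod, List.prod_ofFn, ← ofAdd_sum, Finset.univ_sum_single]

theorem commute_uOp (f g : Fin F) : Commute (uOp η σ f).val (uOp η σ g).val := by
  change diagOp _ * diagOp _ = diagOp _ * diagOp _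
  rw [diagOp_eq_monoOp, diagOp_eq_monoOp, monoOp_mul, monoOp_mul]
  simp only [sub_zero, mul_comm]

theorem commute_uOp_vOp (f g : Fin F) (h : f ≠ g) :
    Commute (uOp η σ f).val (vOp g : (Op F)ˣ).val := ultralocality η σ f g h

end Weyl

/-! ### The transfer matrix at a point -/

section Evaluation

/-- The value of a polynomial with coefficients in a complex algebra. -/
noncomputable def evalAt {A : Type*} [Ring A] [Algebra ℂ A] (x : ℂ) : Polynomial A →+* A :=
  Polynomial.eval₂RingHom' (RingHom.id A) (algebraMap ℂ A x) fun a => Algebra.commutes' x a |>.symm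

theorem evalAt_C {A : Type*} [Ring A] [Algebra ℂ A] (x : ℂ) (a : A) :
    evalAt x (Polynomial.C a) = a := by
  change Polynomial.eval₂ _ _ _ = _
  simp

theorem evalAt_X {A : Type*} [Ring A] [Algebra ℂ A] (x : ℂ) :
    evalAt x (Polynomial.X : Polynomial A) = algebraMap ℂ A x := by
  change Polynomial.eval₂ _ _ _ = _
  simp

theorem evalAt_eq_sum {A : Type*} [Ring A] [Algebra ℂ A] (x : ℂ) {p : Polynomial A} {F : ℕ}
    (hp : p.natDegree ≤ F) : evalAt x p = ∑ i ∈ Finset.range (F + 1), x ^ i • p.coeff i := by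
  change Polynomial.eval₂ _ _ _ = _
  rw [Polynomial.eval₂_eq_sum_range' _ (Nat.lt_succ_of_le hp)]
  refine Finset.sum_congr rfl fun i _ => ?_
  rw [RingHom.id_apply, ← map_pow, ← Algebra.commutes, ← Algebra.smul_def]

theorem evalAt_laxPoly_entries {A : Type*} [Ring A] [Algebra ℂ A] (x qh lam : ℂ) (u v : Aˣ) :
    evalAt x (laxPoly qh lam u v 0 0) = 1 - x • u.val ^ 2 ∧
      evalAt x (laxPoly qh lam u v 0 1) = (-1 : ℂ) • (u * v : Aˣ).val ∧
      evalAt x (laxPoly qh lam u v 1 0) = (-x * (qh⁻¹ * lam)) • (u * v⁻¹ : Aˣ).val ∧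
      evalAt x (laxPoly qh lam u v 1 1) = 0 := by
  refine ⟨?_, ?_, ?_, map_zero _⟩
  · change evalAt x (1 - Polynomial.C _ * Polynomial.X) = _
    rw [map_sub, map_one, map_mul, evalAt_C, evalAt_X, ← Algebra.commutes, ← Algebra.smul_def]
  · change evalAt x (-Polynomial.C _) = _
    rw [map_neg, evalAt_C, neg_one_smul]
  · change evalAt x (-(Polynomial.C _ * Polynomial.X)) = _
    rw [map_neg, map_mul, evalAt_C, evalAt_X, ← Algebra.commutes, ← Algebra.smul_def, smul_smul,
      neg_mul, neg_smul]

/-- The local Boltzmann weights of the transfer matrix. -/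
def ell (lam U : ℂ) : Fin 2 → Fin 2 → ℂ := ![![1 - U, -1], ![-(lam * U), 0]]

/-- The differences `n_{f+1} - n_f`. -/
def fwd {F : ℕ} [NeZero F] (n : Fin F → ℕ) : Fin F → ℤ := fun f => n (f + 1) - n f

variable {F : ℕ} (η ℓ : ℂ) (σ : Fin F → ℂ)

/-- The eigenvalue of `u_f²` on `|k⟩`. -/
noncomputable def uSq (k : Fin F → ℤ) (f : Fin F) : ℂ := Complex.exp (η * (σ f + k f))

/-- The entry (a, b) shifts k_f by b − a. The weight −λU of the entry (1, 0) arises from q^{-1/2} u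
v⁻¹ = u² (uv)⁻¹. -/
theorem evalAt_laxPoly (x : ℂ) (f : Fin F) (a b : Fin 2) :
    evalAt x (laxPoly (Complex.exp (η / 2)) (Complex.exp ℓ) (uOp η σ f) (vOp f) a b) =
      monoOp (fun k => ell (Complex.exp ℓ) (x * Complex.exp (η * (σ f + k f))) a b *
        (siteGauge η σ f (k f) / siteGauge η σ f (k f - ((b : ℕ) - (a : ℕ) : ℤ))))
        (Pi.single f ((b : ℕ) - (a : ℕ) : ℤ)) := by
  have hsq : (uOp η σ f).val ^ 2 = monoOp (fun k => Complex.exp (η * (σ f + k f))) 0 := by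
    change diagOp _ ^ 2 = _
    rw [pow_two, diagOp_eq_monoOp, monoOp_mul, add_zero]
    congr 1
    funext k
    rw [sub_zero, ← Complex.exp_add]
    congr 1
    ring
  fin_cases a <;> fin_cases b
  · refine (evalAt_laxPoly_entries x _ _ _ _).1.trans ?_
    rw [hsq, smul_monoOp]
    refine op_ext fun k' k => ?_
    change entry (1 : Op F) k' k - entry (monoOp _ _) k' k = _
    rw [← monoOp_one]
    simp only [entry_monoOp]
    simp only [ell, Fin.zero_eta, Nat.cast_zero, sub_self, Pi.single_zero, add_zero,
      sub_zero, div_self (siteGauge_ne_zero η σ f _)]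
    split_ifs <;> simp
  · refine (evalAt_laxPoly_entries x _ _ _ _).2.1.trans ?_
    change _ • (uvOp η σ f).val = _
    rw [uvOp_eq, weylShift_single, smul_monoOp]
    simp [ell]
  · refine (evalAt_laxPoly_entries x _ _ _ _).2.2.1.trans ?_
    have huv : (uOp η σ f * (vOp f)⁻¹ : (Op F)ˣ).val =
        monoOp (fun k => Complex.exp (η * (σ f + k f) / 2)) (Pi.single f (-1)) := by
      rw [Pi.single_neg]
      rfl
    rw [huv, smul_monoOp]
    change monoOp _ _ = monoOp (fun k => -(Complex.exp ℓ * (x * Complex.exp (η * (σ f + k f)))) *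
      (siteGauge η σ f (k f) / siteGauge η σ f (k f - ((0 : ℕ) - (1 : ℕ) : ℤ))))
      (Pi.single f ((0 : ℕ) - (1 : ℕ) : ℤ))
    rw [show (((0 : ℕ) - (1 : ℕ) : ℤ)) = -1 by norm_num]
    congr 1
    funext k
    rw [siteGauge, siteGauge, ← Complex.exp_sub, ← Complex.exp_neg, ← Complex.exp_add]
    have e : ∀ a b c d : ℂ, a + b = c + d → -x * Complex.exp a * Complex.exp b =
        -(x * (Complex.exp c * Complex.exp d)) := by
      intro a b c d h
      rw [mul_assoc, ← Complex.exp_add, ← Complex.exp_add, h]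
      ring
    rw [e _ _ (ℓ + η * (σ f + k f)) (η * (↑(k f) * σ f + ↑(k f) * (↑(k f) + 1) / 2) / 2 -
      η * (↑(k f - -1) * σ f + ↑(k f - -1) * (↑(k f - -1) + 1) / 2) / 2)]
    · rw [Complex.exp_add ℓ]
      ring
    · push_cast
      ring
  · refine (evalAt_laxPoly_entries x _ _ _ _).2.2.2.trans ?_
    refine op_ext fun k' k => ?_
    rw [entry_monoOp]
    simp [ell, entry]

/-- The auxiliary labels enter the shift through a_{f+1} − a_f, exactly as the occupation numbers
enter the local form of Q_+. This common shape lets the Baxter equation be checked by adding a to n.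
-/
theorem evalAt_transferPoly [NeZero F] (x : ℂ) :
    evalAt x (transferPoly (Complex.exp (η / 2)) (Complex.exp ℓ) (uOp η σ) vOp) =
      ∑ a : Fin F → Fin 2, monoOp (fun k =>
        (∏ f, ell (Complex.exp ℓ) (x * uSq η σ k f) (a f) (a (f + 1))) *
          (gauge η σ k / gauge η σ (k - fwd fun f => (a f : ℕ)))) (fwd fun f => (a f : ℕ)) := by
  rw [transferPoly, trace_prod_ofFn, map_sum]
  refine Finset.sum_congr rfl fun a _ => ?_
  rw [map_list_prod, List.map_ofFn]
  have : (evalAt x ∘ fun f => laxPoly (Complex.exp (η / 2)) (Complex.exp ℓ) (uOp η σ f) (vOp f)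
      (a f) (a (f + 1))) = fun f => monoOp (fun k =>
        (fun (f : Fin F) (κ : ℤ) => ell (Complex.exp ℓ) (x * Complex.exp (η * (σ f + κ))) (a f)
          (a (f + 1)) * (siteGauge η σ f κ / siteGauge η σ f (κ - fwd (fun f => (a f : ℕ)) f)))
          f (k f)) (Pi.single f (fwd (fun f => (a f : ℕ)) f)) := by
    funext f
    exact evalAt_laxPoly η ℓ σ x f _ _
  rw [this, prod_ofFn_monoOp (fun (f : Fin F) (κ : ℤ) => ell (Complex.exp ℓ)
    (x * Complex.exp (η * (σ f + κ))) (a f) (a (f + 1)) *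
    (siteGauge η σ f κ / siteGauge η σ f (κ - fwd (fun f => (a f : ℕ)) f)))]
  congr 1
  funext k
  rw [Finset.prod_mul_distrib, gauge_div]
  rfl

end Evaluation

end RelToda

/-! ### Cyclic sums and commuting transfer matrices -/

namespace RelToda

/-! ### Cyclic sums of products of local weights -/

section Cyclic

variable {R κ ι : Type*} [CommRing R] [Fintype κ] [DecidableEq κ] [DecidableEq ι]

/-- The sum of `∏_f A_f(a_f, a_{ρ f})` over all `a` with `a_f ∈ s_f`. -/
def cycSum (ρ : Equiv.Perm κ) (s : κ → Finset ι) (A : κ → ι → ι → R) : R :=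
  ∑ a ∈ Fintype.piFinset s, ∏ f, A f (a f) (a (ρ f))

/-- A cyclic sum does not change under gauge transformations of the local weights. -/
theorem cycSum_conj (ρ : Equiv.Perm κ) (s : κ → Finset ι) {A B S T : κ → ι → ι → R}
    (hTS : ∀ f, ∀ a ∈ s f, ∀ c ∈ s f, ∑ x ∈ s f, T f a x * S f x c = if a = c then 1 else 0)
    (hST : ∀ f, ∀ d ∈ s f, ∀ x ∈ s f, ∑ a ∈ s f, S f d a * T f a x = if d = x then 1 else 0)
    (h : ∀ f, ∀ x ∈ s f, ∀ b ∈ s (ρ f),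
      ∑ e ∈ s f, S f x e * A f e b = ∑ d ∈ s (ρ f), B f x d * S (ρ f) d b) :
    cycSum ρ s A = cycSum ρ s B := by
  -- Inverting the intertwining relation gives A = T B S with S taken at the next site. Round the
  -- cycle each S meets the T of the same site and cancels.
  have hA : ∀ f, ∀ a ∈ s f, ∀ b ∈ s (ρ f), A f a b =
      ∑ x ∈ s f, ∑ d ∈ s (ρ f), T f a x * B f x d * S (ρ f) d b := by
    intro f a ha b hb
    calc A f a b = ∑ e ∈ s f, (if a = e then 1 else 0) * A f e b := by
          simp [ha]
      _ = ∑ e ∈ s f, ∑ x ∈ s f, T f a x * (S f x e * A f e b) := by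
          refine Finset.sum_congr rfl fun e he => ?_
          rw [← hTS f a ha e he, Finset.sum_mul]
          exact Finset.sum_congr rfl fun x _ => mul_assoc _ _ _
      _ = ∑ x ∈ s f, T f a x * ∑ e ∈ s f, S f x e * A f e b := by
          rw [Finset.sum_comm]
          exact Finset.sum_congr rfl fun x _ => (Finset.mul_sum _ _ _).symm
      _ = _ := by
          refine Finset.sum_congr rfl fun x hx => ?_
          rw [h f x hx b hb, Finset.mul_sum]
          exact Finset.sum_congr rfl fun d _ => (mul_assoc _ _ _).symm
  calc cycSum ρ s A
      = ∑ a ∈ Fintype.piFinset s, ∑ x ∈ Fintype.piFinset s,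
          ∑ d ∈ Fintype.piFinset (fun f => s (ρ f)),
          ∏ f, T f (a f) (x f) * B f (x f) (d f) * S (ρ f) (d f) (a (ρ f)) := by
        refine Finset.sum_congr rfl fun a ha => ?_
        rw [Fintype.mem_piFinset] at ha
        rw [Finset.prod_congr rfl fun f _ => hA f _ (ha f) _ (ha (ρ f)), Finset.prod_univ_sum]
        refine Finset.sum_congr rfl fun x _ => ?_
        rw [Finset.prod_univ_sum]
    _ = ∑ x ∈ Fintype.piFinset s, ∑ d ∈ Fintype.piFinset (fun f => s (ρ f)),
          (∏ f, B f (x f) (d f)) *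
          ∑ a ∈ Fintype.piFinset s, ∏ f, S f (d (ρ.symm f)) (a f) * T f (a f) (x f) := by
        rw [Finset.sum_comm]
        refine Finset.sum_congr rfl fun x _ => ?_
        rw [Finset.sum_comm]
        refine Finset.sum_congr rfl fun d _ => ?_
        rw [Finset.mul_sum]
        refine Finset.sum_congr rfl fun a _ => ?_
        rw [Finset.prod_mul_distrib, Finset.prod_mul_distrib, Finset.prod_mul_distrib,
          ← Equiv.prod_comp ρ fun f => S f (d (ρ.symm f)) (a f)]
        simp only [Equiv.symm_apply_apply]
        ring
    _ = ∑ x ∈ Fintype.piFinset s, ∑ d ∈ Fintype.piFinset (fun f => s (ρ f)),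
          ∏ f, B f (x f) (d f) * (if d f = x (ρ f) then 1 else 0) := by
        refine Finset.sum_congr rfl fun x hx => Finset.sum_congr rfl fun d hd => ?_
        rw [Fintype.mem_piFinset] at hx hd
        rw [← Finset.prod_univ_sum (fun f => s f)
          (fun f a => S f (d (ρ.symm f)) a * T f a (x f)), Finset.prod_mul_distrib]
        congr 1
        rw [← Equiv.prod_comp ρ]
        refine Finset.prod_congr rfl fun f _ => ?_
        rw [hST _ _ (by rw [Equiv.symm_apply_apply]; exact hd f) _ (hx _),
          Equiv.symm_apply_apply]
    _ = cycSum ρ s B := by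
        refine Finset.sum_congr rfl fun x hx => ?_
        rw [Fintype.mem_piFinset] at hx
        rw [← Finset.prod_univ_sum (fun f => s (ρ f))
          (fun f d => B f (x f) d * (if d = x (ρ f) then 1 else 0))]
        refine Finset.prod_congr rfl fun f _ => ?_
        simp [hx]

/-- The permutation `ρ` acts transitively. -/
def IsTransitive {κ : Type*} (ρ : Equiv.Perm κ) : Prop :=
  ∀ s : Set κ, s.Nonempty → (∀ f, ρ f ∈ s → f ∈ s) → s = Set.univ

/-- If the first column of each weight vanishes below the diagonal, the cyclic sum splits. -/
theorem cycSum_split [Nonempty κ] {ρ : Equiv.Perm κ} (hρ : IsTransitive ρ) (N : κ → ℕ)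
    (B : κ → ℕ → ℕ → R) (hB : ∀ f ν, B f (ν + 1) 0 = 0) :
    cycSum ρ (fun f => Finset.range (N f + 1)) B = ∏ f, B f 0 0 +
      ∑ a ∈ Fintype.piFinset (fun f => Finset.Icc 1 (N f)), ∏ f, B f (a f) (a (ρ f)) := by
  rw [cycSum, ← Finset.sum_filter_not_add_sum_filter _ (fun a => ∀ f, a f ≠ 0)]
  congr 1
  · rw [Finset.sum_eq_single_of_mem (fun _ => 0)]
    · simp
    · intro a ha hne
      rw [Finset.mem_filter] at ha
      obtain ⟨-, hz⟩ := ha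
      push Not at hz
      by_contra hprod
      refine hne ?_
      -- In a nonvanishing term a zero label propagates backwards along ρ, so by transitivity one
      -- zero label forces all labels to be zero.
      have hcl : ∀ f, a (ρ f) = 0 → a f = 0 := by
        intro f hf
        by_contra hn
        obtain ⟨m, hm⟩ := Nat.exists_eq_succ_of_ne_zero hn
        refine hprod (Finset.prod_eq_zero (Finset.mem_univ f) ?_)
        rw [hf, hm]
        exact hB f m
      have := hρ {f | a f = 0} hz hcl
      funext f
      exact (Set.ext_iff.1 this f).2 trivial
  · refine Finset.sum_congr ?_ fun _ _ => rfl
    ext a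
    simp only [Finset.mem_filter, Fintype.mem_piFinset, Finset.mem_range, Finset.mem_Icc]
    constructor
    · rintro ⟨h1, h2⟩ f
      have := h1 f
      have := h2 f
      omega
    · intro h
      refine ⟨fun f => ?_, fun f => ?_⟩ <;> have := h f <;> omega

/-- The cyclic sum of weights with constant row sums, in terms of their successive differences. -/
theorem cycSum_eq_add [Nonempty κ] {ρ : Equiv.Perm κ} (hρ : IsTransitive ρ) (N : κ → ℕ)
    (A B : κ → ℕ → ℕ → R) (c : κ → R)
    (hrow : ∀ f, ∑ j ∈ Finset.range (N (ρ f) + 1), A f 0 j = c f)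
    (hB0 : ∀ f ν, B f (ν + 1) 0 = 0) (hBN : ∀ f ν, B f (ν + 1) (N (ρ f) + 1) = 0)
    (hAB : ∀ f, ∀ ν < N f, ∀ j ≤ N (ρ f),
      A f (ν + 1) j - A f ν j = B f (ν + 1) j - B f (ν + 1) (j + 1)) :
    cycSum ρ (fun f => Finset.range (N f + 1)) A = ∏ f, c f +
      ∑ a ∈ Fintype.piFinset (fun f => Finset.Icc 1 (N f)), ∏ f, B f (a f) (a (ρ f)) := by
  -- S takes differences of consecutive labels and T, its inverse, sums up to a label. Conjugation
  -- by S turns A into B': its rows ν ≥ 1 are those of B by `hAB`, its row 0 consists of the tail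
  -- sums of row 0 of A, and its first column vanishes below the diagonal, so `cycSum_split`
  -- applies.
  set B' : κ → ℕ → ℕ → R := fun f ν μ =>
    if ν = 0 then ∑ j ∈ Finset.Ico μ (N (ρ f) + 1), A f 0 j else B f ν μ with hB'
  set S : κ → ℕ → ℕ → R := fun _ x e =>
    (if e = x then 1 else 0) - (if e + 1 = x then 1 else 0) with hS
  set T : κ → ℕ → ℕ → R := fun _ a x => if x ≤ a then 1 else 0 with hT
  have h1 : cycSum ρ (fun f => Finset.range (N f + 1)) A =
      cycSum ρ (fun f => Finset.range (N f + 1)) B' := by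
    refine cycSum_conj ρ _ (S := S) (T := T) ?_ ?_ ?_
    · intro f a ha e he
      rw [Finset.mem_range] at ha he
      simp only [hS, hT, mul_sub, Finset.sum_sub_distrib, mul_ite, mul_one, mul_zero,
        Finset.sum_ite_eq, Finset.mem_range]
      split_ifs <;> first | omega | simp
    · intro f d hd x hx
      rw [Finset.mem_range] at hd hx
      simp only [hS, hT, sub_mul, Finset.sum_sub_distrib, ite_mul, one_mul, zero_mul,
        Finset.sum_ite_eq', Finset.mem_range]
      rw [if_pos hd]
      rcases Nat.eq_zero_or_pos d with rfl | hd0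
      · simp [eq_comm]
      · obtain ⟨m, rfl⟩ := Nat.exists_eq_succ_of_ne_zero hd0.ne'
        simp only [Nat.succ_eq_add_one, Nat.add_right_cancel_iff, Finset.sum_ite_eq',
          Finset.mem_range]
        rw [if_pos (by omega : m < N f + 1)]
        rcases lt_trichotomy x (m + 1) with h | h | h
        · rw [if_pos (by omega), if_pos (by omega), if_neg (by omega), sub_self]
        · rw [if_pos (by omega), if_neg (by omega), if_pos (by omega), sub_zero]
        · rw [if_neg (by omega), if_neg (by omega), if_neg (by omega), sub_zero]
    · intro f x hx b hb
      rw [Finset.mem_range] at hx hb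
      have hr : ∑ d ∈ Finset.range (N (ρ f) + 1), B' f x d * S (ρ f) d b =
          B' f x b - if b + 1 < N (ρ f) + 1 then B' f x (b + 1) else 0 := by
        simp only [hS, mul_sub, Finset.sum_sub_distrib, mul_ite, mul_one, mul_zero,
          Finset.sum_ite_eq, Finset.mem_range]
        rw [if_pos hb]
      rw [hr]
      simp only [hS, sub_mul, Finset.sum_sub_distrib, ite_mul, one_mul, zero_mul,
        Finset.sum_ite_eq', Finset.mem_range, if_pos hx]
      rcases Nat.eq_zero_or_pos x with rfl | hx0
      · simp only [hB', if_true, Nat.add_one_ne_zero, if_false, Finset.sum_const_zero, sub_zero]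
        rw [Finset.sum_eq_sum_Ico_succ_bot hb]
        split_ifs with h
        · abel
        · rw [Finset.Ico_eq_empty (by omega), Finset.sum_empty, add_zero, sub_zero]
      · obtain ⟨m, rfl⟩ := Nat.exists_eq_succ_of_ne_zero hx0.ne'
        simp only [Nat.succ_eq_add_one, Nat.add_right_cancel_iff, Finset.sum_ite_eq',
          Finset.mem_range, hB', Nat.add_one_ne_zero, if_false]
        rw [if_pos (by omega : m < N f + 1), hAB f m (by omega) b (by omega)]
        split_ifs with h
        · rfl
        · have : b = N (ρ f) := by omega
          rw [this, hBN]
  rw [h1, cycSum_split hρ N B' (fun f ν => by simp [hB', hB0])]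
  congr 1
  · refine Finset.prod_congr rfl fun f _ => ?_
    simp only [hB', if_true, ← hrow f, Finset.range_eq_Ico]
  · refine Finset.sum_congr rfl fun a ha => Finset.prod_congr rfl fun f _ => ?_
    rw [Fintype.mem_piFinset] at ha
    have := Finset.mem_Icc.1 (ha f)
    simp only [hB']
    rw [if_neg (by omega)]

end Cyclic

/-- The successor, as a permutation of the cyclically ordered sites. -/
def nextPerm (F : ℕ) [NeZero F] : Equiv.Perm (Fin F) := Equiv.addRight 1

theorem isTransitive_nextPerm (F : ℕ) [NeZero F] : IsTransitive (nextPerm F) := by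
  obtain ⟨n, rfl⟩ : ∃ n, F = n + 1 := ⟨F - 1, (Nat.succ_pred_eq_of_ne_zero (NeZero.ne F)).symm⟩
  intro s hs hcl
  obtain ⟨g, hg⟩ := hs
  have h0 : ∀ m : ℕ, g - Fin.ofNat (n + 1) m ∈ s := by
    intro m
    induction m with
    | zero => 
      have : Fin.ofNat (n + 1) 0 = 0 := rfl
      rwa [this, sub_zero]
    | succ m ih =>
      refine hcl _ ?_
      have : Fin.ofNat (n + 1) (m + 1) = Fin.ofNat (n + 1) m + 1 := by
        refine Fin.ext ?_
        simp [Fin.val_add]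
      change g - Fin.ofNat (n + 1) (m + 1) + 1 ∈ s
      rwa [this, sub_add_eq_sub_sub, sub_add_cancel]
  refine Set.eq_univ_of_forall fun f => ?_
  have := h0 (g - f : Fin (n + 1)).val
  rwa [Fin.ofNat_val_eq_self, sub_sub_cancel] at this

theorem IsTransitive.symm {κ : Type*} {ρ : Equiv.Perm κ} (h : IsTransitive ρ) :
    IsTransitive ρ.symm := by
  intro s hs hcl
  by_contra hne
  have hc : sᶜ.Nonempty := Set.nonempty_compl.2 hne
  have := h sᶜ hc fun f hf hfs => hf (hcl (ρ f) (by rwa [Equiv.symm_apply_apply]))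
  rw [Set.compl_univ_iff.1 this] at hs
  exact Set.not_nonempty_empty hs

/-! ### Commutativity of the transfer matrices -/

section Commutativity

theorem coeff_eq_zero_of_infinite {n : ℕ} {c : ℕ → ℂ} {s : Set ℂ} (hs : s.Infinite)
    (h : ∀ y ∈ s, ∑ i ∈ Finset.range n, y ^ i * c i = 0) {i : ℕ} (hi : i < n) : c i = 0 := by
  set p : Polynomial ℂ := ∑ i ∈ Finset.range n, Polynomial.monomial i (c i) with hp
  have hp0 : p = 0 := by
    refine Polynomial.eq_zero_of_infinite_isRoot p (hs.mono fun y hy => ?_)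
    simp only [Set.mem_ofPred_eq, Polynomial.IsRoot, hp, Polynomial.eval_finsetSum,
      Polynomial.eval_monomial]
    rw [← h y hy]
    exact Finset.sum_congr rfl fun i _ => mul_comm _ _
  have := congrArg (fun p => Polynomial.coeff p i) hp0
  simpa [hp, Polynomial.finsetSum_coeff, Polynomial.coeff_monomial, hi] using this

/-- The six-vertex `R`-matrix. -/
def rMat (q x y : ℂ) (c e : Fin 2 × Fin 2) : ℂ :=
  ![![![![y - q * x, 0], ![0, 0]], ![![0, (1 - q) * y], ![y - x, 0]]],
    ![![![0, q * (y - x)], ![(1 - q) * x, 0]], ![![0, 0], ![0, y - q * x]]]] c.1 c.2 e.1 e.2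

/-- The local weight of the product of two transfer matrices. -/
noncomputable def twoWeight (q lam x y U : ℂ) (c e : Fin 2 × Fin 2) : ℂ :=
  ell lam (x * U) c.1 e.1 * ell lam (y * (U * q ^ (-((e.1 : ℕ) - (c.1 : ℕ) : ℤ)))) c.2 e.2

theorem rMat_mul_rMat (q x y : ℂ) (c e : Fin 2 × Fin 2) :
    ∑ d, rMat q x y c d * rMat q y x d e =
      if c = e then (y - q * x) * (x - q * y) else 0 := by
  obtain ⟨c1, c2⟩ := c
  obtain ⟨e1, e2⟩ := e
  rw [Fintype.sum_prod_type]
  simp only [Fin.sum_univ_two]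
  fin_cases c1 <;> fin_cases c2 <;> fin_cases e1 <;> fin_cases e2 <;>
    simp [rMat] <;> ring

/-- The Yang–Baxter relation, verified entry by entry. The second factor of `twoWeight` sees u_f²
after the shift made by the first, hence the power of q in its argument. -/
theorem rMat_mul_twoWeight {q : ℂ} (hq : q ≠ 0) (lam x y U : ℂ) (c e : Fin 2 × Fin 2) :
    ∑ d, rMat q y x c d * twoWeight q lam x y U d e =
      ∑ d, twoWeight q lam y x U c d * rMat q y x d e := by
  obtain ⟨c1, c2⟩ := c
  obtain ⟨e1, e2⟩ := e
  rw [Fintype.sum_prod_type, Fintype.sum_prod_type]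
  simp only [Fin.sum_univ_two]
  fin_cases c1 <;> fin_cases c2 <;> fin_cases e1 <;> fin_cases e2 <;>
    simp [rMat, twoWeight, ell] <;> field_simp <;> ring

/-- The ice rule: R conserves the sum of the two labels. Therefore the constraint that fixes the
shift at a site can be inserted into the Yang–Baxter relation. -/
theorem rMat_eq_zero {q x y : ℂ} {c e : Fin 2 × Fin 2}
    (h : ((c.1 : ℕ) + (c.2 : ℕ) : ℤ) ≠ (e.1 : ℕ) + (e.2 : ℕ)) : rMat q x y c e = 0 := by
  obtain ⟨c1, c2⟩ := c
  obtain ⟨e1, e2⟩ := e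
  revert h
  fin_cases c1 <;> fin_cases c2 <;> fin_cases e1 <;> fin_cases e2 <;> simp [rMat]

/-- The local weight of a matrix element of the product of two transfer matrices. -/
noncomputable def twoWeightAt (q lam x y U : ℂ) (m : ℤ) (c e : Fin 2 × Fin 2) : ℂ :=
  twoWeight q lam x y U c e *
    if m = ((e.1 : ℕ) + (e.2 : ℕ)) - ((c.1 : ℕ) + (c.2 : ℕ)) then 1 else 0

theorem rMat_mul_twoWeightAt {q : ℂ} (hq : q ≠ 0) (lam x y U : ℂ) (m : ℤ)
    (c e : Fin 2 × Fin 2) :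
    ∑ d, rMat q y x c d * twoWeightAt q lam x y U m d e =
      ∑ d, twoWeightAt q lam y x U m c d * rMat q y x d e := by
  have h1 : ∀ d, rMat q y x c d * twoWeightAt q lam x y U m d e =
      rMat q y x c d * twoWeight q lam x y U d e *
        if m = ((e.1 : ℕ) + (e.2 : ℕ)) - ((c.1 : ℕ) + (c.2 : ℕ)) then 1 else 0 := by
    intro d
    by_cases h : ((c.1 : ℕ) + (c.2 : ℕ) : ℤ) = (d.1 : ℕ) + (d.2 : ℕ)
    · rw [twoWeightAt, h, mul_assoc]
    · simp only [rMat_eq_zero h, zero_mul]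
  have h2 : ∀ d, twoWeightAt q lam y x U m c d * rMat q y x d e =
      twoWeight q lam y x U c d * rMat q y x d e *
        if m = ((e.1 : ℕ) + (e.2 : ℕ)) - ((c.1 : ℕ) + (c.2 : ℕ)) then 1 else 0 := by
    intro d
    by_cases h : ((d.1 : ℕ) + (d.2 : ℕ) : ℤ) = (e.1 : ℕ) + (e.2 : ℕ)
    · rw [twoWeightAt, h]
      ring
    · simp only [rMat_eq_zero h, mul_zero, zero_mul]
  simp only [h1, h2, ← Finset.sum_mul, rMat_mul_twoWeight hq]

theorem uSq_sub {F : ℕ} (η : ℂ) (σ : Fin F → ℂ) (k m : Fin F → ℤ) (f : Fin F) :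
    uSq η σ (k - m) f = uSq η σ k f * Complex.exp η ^ (-(m f)) := by
  rw [uSq, uSq, ← Complex.exp_int_mul, ← Complex.exp_add]
  congr 1
  rw [Pi.sub_apply]
  push_cast
  ring

/-- The transfer matrix, as a polynomial in the spectral variable. -/
noncomputable def chainPoly {F : ℕ} (η ℓ : ℂ) (σ : Fin F → ℂ) :=
  transferPoly (A := Op F) (Complex.exp (η / 2)) (Complex.exp ℓ) (uOp η σ) vOp

/-- The transfer matrix at the point `X = x`. -/
noncomputable def transferAt {F : ℕ} (η ℓ : ℂ) (σ : Fin F → ℂ) (x : ℂ) : Op F :=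
  evalAt x (chainPoly η ℓ σ)

theorem natDegree_chainPoly_le {F : ℕ} (η ℓ : ℂ) (σ : Fin F → ℂ) :
    (chainPoly η ℓ σ).natDegree ≤ F := natDegree_transferPoly_le (A := Op F) _ _ _ _

theorem transferAt_eq_sum {F : ℕ} (η ℓ : ℂ) (σ : Fin F → ℂ) (x : ℂ) :
    transferAt η ℓ σ x = ∑ i ∈ Finset.range (F + 1), x ^ i • (chainPoly η ℓ σ).coeff i :=
  evalAt_eq_sum x (natDegree_chainPoly_le η ℓ σ)

variable {F : ℕ} [NeZero F] (η ℓ : ℂ) (σ : Fin F → ℂ)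

/-- The product of two cyclic sums is one cyclic sum over pairs of labels: the gauge factors of the
intermediate state cancel, and the condition relating k' to k is a product of conditions at the
sites. -/
theorem entry_transferAt_mul (x y : ℂ) (k' k : Fin F → ℤ) :
    entry (transferAt η ℓ σ x * transferAt η ℓ σ y) k' k =
      gauge η σ k' / gauge η σ k * cycSum (nextPerm F) (fun _ => Finset.univ)
        (fun f => twoWeightAt (Complex.exp η) (Complex.exp ℓ) x y (uSq η σ k' f) (k' f - k f)) := by
  rw [transferAt, transferAt, chainPoly, evalAt_transferPoly, evalAt_transferPoly, Finset.sum_mul_sum]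
  simp only [monoOp_mul]
  have hsum : entry (∑ a : Fin F → Fin 2, ∑ b : Fin F → Fin 2, monoOp (fun k =>
      ((∏ f, ell (Complex.exp ℓ) (x * uSq η σ k f) (a f) (a (f + 1))) *
        (gauge η σ k / gauge η σ (k - fwd fun f => (a f : ℕ)))) *
      ((∏ f, ell (Complex.exp ℓ) (y * uSq η σ (k - fwd fun f => (a f : ℕ)) f) (b f) (b (f + 1))) *
        (gauge η σ (k - fwd fun f => (a f : ℕ)) /
          gauge η σ (k - (fwd fun f => (a f : ℕ)) - fwd fun f => (b f : ℕ)))))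
      ((fwd fun f => (a f : ℕ)) + fwd fun f => (b f : ℕ))) k' k =
      ∑ a : Fin F → Fin 2, ∑ b : Fin F → Fin 2, entry (monoOp (fun k =>
      ((∏ f, ell (Complex.exp ℓ) (x * uSq η σ k f) (a f) (a (f + 1))) *
        (gauge η σ k / gauge η σ (k - fwd fun f => (a f : ℕ)))) *
      ((∏ f, ell (Complex.exp ℓ) (y * uSq η σ (k - fwd fun f => (a f : ℕ)) f) (b f) (b (f + 1))) *
        (gauge η σ (k - fwd fun f => (a f : ℕ)) /
          gauge η σ (k - (fwd fun f => (a f : ℕ)) - fwd fun f => (b f : ℕ)))))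
      ((fwd fun f => (a f : ℕ)) + fwd fun f => (b f : ℕ))) k' k := by
    simp only [entry, LinearMap.sum_apply, Finsupp.finsetSum_apply]
  rw [hsum, cycSum, Fintype.piFinset_univ, ← (Equiv.arrowProdEquivProdArrow (Fin F)
    (fun _ => Fin 2) (fun _ => Fin 2)).symm.sum_comp, Fintype.sum_prod_type, Finset.mul_sum]
  refine Finset.sum_congr rfl fun a _ => ?_
  rw [Finset.mul_sum]
  refine Finset.sum_congr rfl fun b _ => ?_
  rw [entry_monoOp]
  simp only [twoWeightAt, twoWeight, Finset.prod_mul_distrib, Finset.prod_ite_zero,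
    Finset.prod_const_one, Equiv.arrowProdEquivProdArrow_symm_apply]
  have hiff : (k' = k + ((fwd fun f => (a f : ℕ)) + fwd fun f => (b f : ℕ))) ↔
      ∀ f ∈ Finset.univ, k' f - k f = ((a (nextPerm F f) : ℕ) + (b (nextPerm F f) : ℕ) : ℤ) -
        ((a f : ℕ) + (b f : ℕ)) := by
    rw [funext_iff]
    simp only [Finset.mem_univ, true_implies]
    refine forall_congr' fun f => ?_
    simp only [Pi.add_apply, fwd, nextPerm, Equiv.coe_addRight]
    constructor <;> intro h <;> omega
  by_cases h : k' = k + ((fwd fun f => (a f : ℕ)) + fwd fun f => (b f : ℕ))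
  · rw [if_pos h, if_pos (hiff.1 h)]
    have hk : k' - (fwd fun f => (a f : ℕ)) - (fwd fun f => (b f : ℕ)) = k := by
      rw [h]; abel
    have hg := gauge_ne_zero η σ (k' - fwd fun f => (a f : ℕ))
    rw [hk, mul_one]
    simp only [uSq_sub]
    have : ∀ z w : ℂ, z * (gauge η σ k' / gauge η σ (k' - fwd fun f => (a f : ℕ))) *
        (w * (gauge η σ (k' - fwd fun f => (a f : ℕ)) / gauge η σ k)) =
        gauge η σ k' / gauge η σ k * (z * w) := by
      intro z w
      field_simp
    rw [this]
    rfl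
  · rw [if_neg h, if_neg (fun h' => h (hiff.2 h')), mul_zero, mul_zero]

/-- For these x and y the matrix R(y, x) is invertible, with inverse proportional to R(x, y), so it
is a gauge transformation of the cyclic sum that exchanges x and y. -/
theorem commute_transferAt {x y : ℂ} (hxy : y - Complex.exp η * x ≠ 0)
    (hyx : x - Complex.exp η * y ≠ 0) :
    Commute (transferAt η ℓ σ x) (transferAt η ℓ σ y) := by
  refine op_ext fun k' k => ?_
  rw [entry_transferAt_mul, entry_transferAt_mul]
  congr 1
  have h0 : ((y - Complex.exp η * x) * (x - Complex.exp η * y))⁻¹ *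
      ((y - Complex.exp η * x) * (x - Complex.exp η * y)) = 1 :=
    inv_mul_cancel₀ (mul_ne_zero hxy hyx)
  have h0' : ((y - Complex.exp η * x) * (x - Complex.exp η * y))⁻¹ *
      ((x - Complex.exp η * y) * (y - Complex.exp η * x)) = 1 := by
    rw [mul_comm (x - _), h0]
  refine cycSum_conj (nextPerm F) _ (S := fun _ => rMat (Complex.exp η) y x)
    (T := fun _ c e => ((y - Complex.exp η * x) * (x - Complex.exp η * y))⁻¹ *
      rMat (Complex.exp η) x y c e) ?_ ?_ ?_
  · intro f a _ c _
    have e : ∀ z u v : ℂ, z * u * v = z * (u * v) := fun z u v => mul_assoc z u v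
    simp only [e _ (rMat _ _ _ _ _), ← Finset.mul_sum, rMat_mul_rMat]
    split_ifs
    · exact h0
    · rw [mul_zero]
  · intro f a _ c _
    simp only [mul_left_comm _ (_⁻¹ : ℂ), ← Finset.mul_sum, rMat_mul_rMat]
    split_ifs
    · exact h0'
    · rw [mul_zero]
  · intro f a _ c _
    exact rMat_mul_twoWeightAt (Complex.exp_ne_zero η) _ _ _ _ _ _ _

/-- Commutation at points fails to be known only for y = qx and y = x/q. The commutator is a
polynomial in x and y that vanishes for infinitely many y at each of infinitely many x, so all its
coefficients vanish. -/
theorem commute_coeff_chainPoly (i j : ℕ) :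
    Commute ((chainPoly η ℓ σ).coeff i) ((chainPoly η ℓ σ).coeff j) := by
  set p := chainPoly η ℓ σ with hp
  have hdeg : p.natDegree ≤ F := natDegree_chainPoly_le η ℓ σ
  by_cases hi : i < F + 1
  swap
  · rw [Polynomial.coeff_eq_zero_of_natDegree_lt (p := p) (n := i) (by omega)]
    exact Commute.zero_left _
  by_cases hj : j < F + 1
  swap
  · rw [Polynomial.coeff_eq_zero_of_natDegree_lt (p := p) (n := j) (by omega)]
    exact Commute.zero_right _
  refine op_ext fun k' k => sub_eq_zero.1 ?_
  set c : ℕ → ℕ → ℂ := fun i j => entry (p.coeff i * p.coeff j) k' k -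
    entry (p.coeff j * p.coeff i) k' k with hc
  have hcomm : ∀ x y : ℂ, y - Complex.exp η * x ≠ 0 → x - Complex.exp η * y ≠ 0 →
      ∑ i ∈ Finset.range (F + 1), x ^ i * ∑ j ∈ Finset.range (F + 1), y ^ j * c i j = 0 := by
    intro x y hxy hyx
    have h := congrArg (fun a => entry a k' k) (commute_transferAt η ℓ σ hxy hyx).eq
    have hmul : ∀ x y : ℂ, entry (transferAt η ℓ σ x * transferAt η ℓ σ y) k' k =
        ∑ i ∈ Finset.range (F + 1), ∑ j ∈ Finset.range (F + 1),
          x ^ i * (y ^ j * entry (p.coeff i * p.coeff j) k' k) := by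
      intro x y
      rw [transferAt_eq_sum, transferAt_eq_sum, Finset.sum_mul_sum]
      simp only [entry, LinearMap.sum_apply, Finsupp.finsetSum_apply, smul_mul_smul_comm,
        LinearMap.smul_apply, Finsupp.smul_apply, smul_eq_mul, mul_assoc, hp]
    simp only [hmul] at h
    rw [← sub_eq_zero, Finset.sum_comm (f := fun i j =>
      y ^ i * (x ^ j * entry (p.coeff i * p.coeff j) k' k)), ← Finset.sum_sub_distrib] at h
    rw [← h]
    refine Finset.sum_congr rfl fun i _ => ?_
    rw [← Finset.sum_sub_distrib, Finset.mul_sum]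
    refine Finset.sum_congr rfl fun j _ => ?_
    rw [hc]
    ring
  have hinf : ∀ x : ℂ, x ≠ 0 →
      {y : ℂ | y - Complex.exp η * x ≠ 0 ∧ x - Complex.exp η * y ≠ 0}.Infinite := by
    intro x _
    refine Set.infinite_of_finite_compl (Set.Finite.subset (s := {Complex.exp η * x,
      x / Complex.exp η}) (by simp) ?_)
    intro y hy
    simp only [Set.mem_compl_iff, Set.mem_ofPred_eq, not_and_or, not_not] at hy
    rcases hy with hy | hy
    · left; linear_combination hy
    · right
      rw [Set.mem_singleton_iff, eq_div_iff (Complex.exp_ne_zero η)]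
      linear_combination -hy
  have h0 : ({x : ℂ | x ≠ 0}).Infinite :=
    Set.infinite_of_finite_compl (Set.Finite.subset (s := {0}) (by simp) fun y hy => by
      simpa using hy)
  refine coeff_eq_zero_of_infinite (c := fun i => c i j) h0 (fun x hx => ?_) hi
  refine coeff_eq_zero_of_infinite
    (c := fun j => ∑ i ∈ Finset.range (F + 1), x ^ i * c i j) (hinf x hx) (fun y hy => ?_) hj
  rw [← hcomm x y hy.1 hy.2]
  simp only [Finset.mul_sum]
  rw [Finset.sum_comm]
  refine Finset.sum_congr rfl fun i _ => Finset.sum_congr rfl fun j _ => ?_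
  ring

end Commutativity

end RelToda

/-! ### Analytic estimates and the local kernel -/

namespace RelToda

/-! ### The infinite `q`-Pochhammer symbol -/

section QPochhammer

variable {q : ℂ}

theorem multipliable_qPochInf (hq1 : ‖q‖ < 1) (x : ℂ) :
    Multipliable fun k : ℕ => 1 - q ^ k * x := by
  have : Summable fun k : ℕ => ‖-(q ^ k * x)‖ := by
    simp only [norm_neg, norm_mul, norm_pow]
    exact (summable_geometric_of_lt_one (norm_nonneg _) hq1).mul_right _
  simpa [sub_eq_add_neg] using multipliable_one_add_of_summable this

theorem qPochInf_eq (hq1 : ‖q‖ < 1) (x : ℂ) :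
    qPochInf q x = (1 - x) * qPochInf q (q * x) := by
  have h : (fun k : ℕ => 1 - q ^ (k + 1) * x) = fun k : ℕ => 1 - q ^ k * (q * x) := by
    funext k; ring
  rw [qPochInf, tprod_eq_zero_mul' (by rw [h]; exact multipliable_qPochInf hq1 _), h, pow_zero,
    one_mul, qPochInf]

theorem qPochInf_zero : qPochInf q 0 = 1 := by simp [qPochInf]

theorem qPochInf_eq_mul (hq1 : ‖q‖ < 1) (x : ℂ) (n : ℕ) :
    qPochInf q x = qPoch q x n * qPochInf q (q ^ n * x) := by
  induction n with
  | zero => simp [qPoch]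
  | succ n ih =>
    rw [ih, qPochInf_eq hq1 (q ^ n * x), qPoch, qPoch, Finset.prod_range_succ, pow_succ', mul_assoc,
      mul_assoc q]

theorem differentiable_qPochInf (hq1 : ‖q‖ < 1) : Differentiable ℂ (qPochInf q) := by
  intro x
  have hu : Summable fun k : ℕ => ‖q‖ ^ k * (‖x‖ + 1) :=
    (summable_geometric_of_lt_one (norm_nonneg _) hq1).mul_right _
  have h := (hu.hasProdLocallyUniformlyOn_nat_one_add (f := fun k x => -(q ^ k * x))
    (Metric.isOpen_ball (x := (0 : ℂ)) (ε := ‖x‖ + 1)) (.of_forall fun n y hy => by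
      rw [norm_neg, norm_mul, norm_pow]
      exact mul_le_mul_of_nonneg_left (by simpa using (Metric.mem_ball.1 hy).le) (by positivity))
    (fun n => by fun_prop)).differentiableOn
    (.of_forall fun s => by
      simpa [Finset.prod_fn] using DifferentiableOn.finsetProd (fun _ _ => by fun_prop))
    Metric.isOpen_ball
  have h2 := h.differentiableAt (x := x) (Metric.isOpen_ball.mem_nhds (by simp))
  simp only [← sub_eq_add_neg] at h2
  exact h2

theorem exists_norm_qPochInf_le (hq1 : ‖q‖ < 1) (R : ℝ) :
    ∃ C, 0 ≤ C ∧ ∀ x, ‖x‖ ≤ R → ‖qPochInf q x‖ ≤ C := by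
  obtain ⟨C, hC⟩ := (isCompact_closedBall (0 : ℂ) R).exists_bound_of_continuousOn
    (differentiable_qPochInf hq1).continuous.continuousOn
  exact ⟨max C 0, le_max_right _ _, fun x hx => (hC x (by simpa using hx)).trans (le_max_left _ _)⟩

theorem one_sub_pow_ne_zero (hq1 : ‖q‖ < 1) (n : ℕ) : 1 - q ^ (n + 1) ≠ 0 := by
  intro h
  have h1 : ‖q ^ (n + 1)‖ < 1 := by
    rw [norm_pow]
    exact pow_lt_one₀ (norm_nonneg _) hq1 (Nat.succ_ne_zero n)
  rw [← sub_eq_zero.1 h, norm_one] at h1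
  exact lt_irrefl _ h1

theorem qPoch_self_succ (n : ℕ) : qPoch q q (n + 1) = qPoch q q n * (1 - q ^ (n + 1)) := by
  rw [qPoch, Finset.prod_range_succ, ← pow_succ]
  rfl

theorem qPoch_self_ne_zero (hq1 : ‖q‖ < 1) (n : ℕ) : qPoch q q n ≠ 0 := by
  rw [qPoch, Finset.prod_ne_zero_iff]
  intro k _
  rw [← pow_succ]
  exact one_sub_pow_ne_zero hq1 k

theorem qPochInf_self_ne_zero (hq1 : ‖q‖ < 1) : qPochInf q q ≠ 0 := by
  rw [qPochInf]
  simp only [sub_eq_add_neg]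
  refine tprod_one_add_ne_zero_of_summable (fun k => ?_) ?_
  · rw [← sub_eq_add_neg, ← pow_succ]
    exact one_sub_pow_ne_zero hq1 k
  · simp only [norm_neg, norm_mul, norm_pow]
    exact (summable_geometric_of_lt_one (norm_nonneg _) hq1).mul_right _

theorem norm_inv_qPoch_le (hq1 : ‖q‖ < 1) (n : ℕ) :
    ‖(qPoch q q n)⁻¹‖ ≤ (1 - ‖q‖)⁻¹ ^ n := by
  have h0 : 0 < 1 - ‖q‖ := sub_pos.2 hq1
  rw [norm_inv, inv_pow]
  refine inv_anti₀ (pow_pos h0 n) ?_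
  rw [qPoch, norm_prod]
  calc (1 - ‖q‖) ^ n = ∏ k ∈ Finset.range n, (1 - ‖q‖) := by simp
    _ ≤ _ := by
      refine Finset.prod_le_prod (fun _ _ => h0.le) fun k _ => ?_
      have h1 := norm_sub_norm_le (1 : ℂ) (q ^ k * q)
      have h2 : ‖q ^ k * q‖ ≤ ‖q‖ := by
        rw [norm_mul, norm_pow]
        exact mul_le_of_le_one_left (norm_nonneg _) (pow_le_one₀ (norm_nonneg _) hq1.le)
      rw [norm_one] at h1
      linarith

/-- Passing from a/q^j to a/q^{j+1} brings in the factor 1 − a/q^{j+1}, whose norm times |q|^{j+1}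
is at most 1 + |a|; the exponents 1, …, j add up to j(j+1)/2. -/
theorem exists_norm_qPochInf_div_le (hq0 : q ≠ 0) (hq1 : ‖q‖ < 1) (a : ℂ) :
    ∃ C D : ℝ, 0 ≤ C ∧ 1 ≤ D ∧
      ∀ j : ℕ, ‖qPochInf q (a / q ^ j)‖ * ‖q‖ ^ (j * (j + 1) / 2) ≤ C * D ^ j := by
  refine ⟨‖qPochInf q a‖, 1 + ‖a‖, norm_nonneg _, by simp, fun j => ?_⟩
  induction j with
  | zero => simp
  | succ j ih =>
    have h1 : qPochInf q (a / q ^ (j + 1)) = (1 - a / q ^ (j + 1)) * qPochInf q (a / q ^ j) := by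
      rw [qPochInf_eq hq1, pow_succ']
      congr 2
      field_simp
    have h2 : (j + 1) * (j + 1 + 1) / 2 = j * (j + 1) / 2 + (j + 1) := by
      have : (j + 1) * (j + 1 + 1) = j * (j + 1) + (j + 1) * 2 := by ring
      rw [this, Nat.add_mul_div_right _ _ two_pos]
    have hq : 0 < ‖q‖ := norm_pos_iff.2 hq0
    have h3 : ‖1 - a / q ^ (j + 1)‖ * ‖q‖ ^ (j + 1) ≤ 1 + ‖a‖ := by
      rw [← norm_pow, ← norm_mul, sub_mul, one_mul, div_mul_cancel₀ _ (pow_ne_zero _ hq0)]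
      refine (norm_sub_le _ _).trans (add_le_add_left ?_ _)
      rw [norm_pow]
      exact pow_le_one₀ hq.le hq1.le
    calc _ = (‖1 - a / q ^ (j + 1)‖ * ‖q‖ ^ (j + 1)) *
          (‖qPochInf q (a / q ^ j)‖ * ‖q‖ ^ (j * (j + 1) / 2)) := by
          rw [h1, h2, norm_mul, pow_add]; ring
      _ ≤ (1 + ‖a‖) * (‖qPochInf q a‖ * (1 + ‖a‖) ^ j) :=
          mul_le_mul h3 ih (by positivity) (by positivity)
      _ = _ := by ring

end QPochhammer

/-! ### Gaussian sums -/

section Gaussian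

theorem summable_pow_mul_pow_sq {r : ℝ} (hr0 : 0 ≤ r) (hr1 : r < 1) {D : ℝ} (hD : 0 ≤ D) :
    Summable fun n : ℕ => D ^ n * r ^ (n ^ 2) := by
  have ht : Filter.Tendsto (fun n : ℕ => D * r ^ n) Filter.atTop (nhds 0) := by
    simpa using (tendsto_pow_atTop_nhds_zero_of_lt_one hr0 hr1).const_mul D
  refine (summable_geometric_of_lt_one (r := (1 / 2 : ℝ)) (by norm_num)
    (by norm_num)).of_norm_bounded_eventually_nat ?_
  filter_upwards [ht.eventually_le_const (by norm_num : (0 : ℝ) < 1 / 2)] with n hn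
  rw [Real.norm_of_nonneg (by positivity), pow_two, pow_mul, ← mul_pow]
  exact pow_le_pow_left₀ (by positivity) hn n

theorem summable_pi_prod {F : ℕ} {g : Fin F → ℕ → ℝ} (h0 : ∀ f n, 0 ≤ g f n)
    (hg : ∀ f, Summable (g f)) : Summable fun n : Fin F → ℕ => ∏ f, g f (n f) := by
  induction F with
  | zero => exact Summable.of_finite
  | succ F ih =>
    have h := (hg 0).mul_of_nonneg (ih (fun f => h0 f.succ) fun f => hg f.succ) (h0 0)
      fun n => Finset.prod_nonneg fun f _ => h0 _ _
    rw [← (Fin.consEquiv fun _ => ℕ).summable_iff]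
    refine h.congr fun p => ?_
    simp [Fin.prod_univ_succ, Fin.consEquiv]

end Gaussian

/-! ### The local kernel of the `Q`-operators -/

section LocalKernel

/-- The function `λⁿ q^{n²} Uⁿ (q^{n+1} U; q)_∞ / (q; q)_n`. -/
noncomputable def localG (q lam : ℂ) (n : ℕ) (U : ℂ) : ℂ :=
  lam ^ n * q ^ (n ^ 2) * U ^ n * qPochInf q (q ^ (n + 1) * U) / qPoch q q n

variable {q : ℂ} (lam : ℂ)

/-- With `mul_localG_mul` this forms a pair of q-difference relations, one at fixed n and one
raising n. They are the only algebraic properties of `localG` used in the Baxter equation. -/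
theorem localG_div (hq0 : q ≠ 0) (hq1 : ‖q‖ < 1) (n : ℕ) (U : ℂ) :
    localG q lam n (U / q) = ((q ^ n)⁻¹ - U) * localG q lam n U := by
  have h1 : q ^ (n + 1) * (U / q) = q ^ n * U := by
    rw [pow_succ]; field_simp
  rw [localG, h1, qPochInf_eq hq1, localG, ← mul_assoc q, ← pow_succ', div_pow]
  field_simp

theorem mul_localG_mul (hq0 : q ≠ 0) (hq1 : ‖q‖ < 1) (n : ℕ) (U : ℂ) :
    lam * U * localG q lam n (q * U) = ((q ^ (n + 1))⁻¹ - 1) * localG q lam (n + 1) U := by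
  have h1 : q ^ (n + 1) * (q * U) = q ^ (n + 1 + 1) * U := by ring
  have := one_sub_pow_ne_zero hq1 n
  have := qPoch_self_ne_zero hq1 n
  have h2 : (q ^ (n + 1))⁻¹ - 1 = (1 - q ^ (n + 1)) / q ^ (n + 1) := by
    rw [sub_div, div_self (pow_ne_zero _ hq0), one_div]
  have h3 : q ^ ((n + 1) ^ 2) = q ^ (n ^ 2) * q ^ n * q ^ (n + 1) := by
    rw [← pow_add, ← pow_add]; congr 1; ring
  rw [h2, localG, h1, localG, qPoch_self_succ, mul_pow, h3, pow_succ lam, pow_succ U]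
  generalize 1 - q ^ (n + 1) = w at *
  field_simp

theorem localG_zero_right (n : ℕ) : localG q lam n 0 = if n = 0 then 1 else 0 := by
  split_ifs with h
  · subst h; simp [localG, qPoch, qPochInf_zero]
  · simp [localG, h]

theorem differentiable_localG (hq1 : ‖q‖ < 1) (n : ℕ) : Differentiable ℂ (localG q lam n) := by
  have := (differentiable_qPochInf hq1).comp
    ((differentiable_id).const_mul (q ^ (n + 1)))
  have h2 : Differentiable ℂ fun U => qPochInf q (q ^ (n + 1) * U) := this
  unfold localG
  fun_prop

theorem norm_localG_le (hq1 : ‖q‖ < 1) {R C : ℝ}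
    (hC : ∀ x, ‖x‖ ≤ R → ‖qPochInf q x‖ ≤ C) (n : ℕ) {U : ℂ} (hU : ‖U‖ ≤ R) :
    ‖localG q lam n U‖ ≤ C * ((‖lam‖ * R * (1 - ‖q‖)⁻¹) ^ n * ‖q‖ ^ (n ^ 2)) := by
  have hR : 0 ≤ R := (norm_nonneg U).trans hU
  have h1 : ‖qPochInf q (q ^ (n + 1) * U)‖ ≤ C := by
    refine hC _ ?_
    rw [norm_mul, norm_pow]
    exact (mul_le_of_le_one_left (norm_nonneg _) (pow_le_one₀ (norm_nonneg _) hq1.le)).trans hU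
  have h2 := norm_inv_qPoch_le hq1 n
  have h3 : 0 ≤ (1 - ‖q‖)⁻¹ := inv_nonneg.2 (sub_pos.2 hq1).le
  have hC0 : 0 ≤ C := (norm_nonneg _).trans h1
  rw [localG, div_eq_mul_inv, norm_mul, norm_mul, norm_mul, norm_mul, norm_pow, norm_pow, norm_pow]
  calc ‖lam‖ ^ n * ‖q‖ ^ n ^ 2 * ‖U‖ ^ n * ‖qPochInf q (q ^ (n + 1) * U)‖ * ‖(qPoch q q n)⁻¹‖
      ≤ ‖lam‖ ^ n * ‖q‖ ^ n ^ 2 * R ^ n * C * (1 - ‖q‖)⁻¹ ^ n := by gcongr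
    _ = _ := by rw [mul_pow, mul_pow]; ring

/-- The factor q^{n²} gives a summable bound uniform on discs, hence both convergence and
analyticity of the kernels. -/
theorem exists_bound_localG (hq1 : ‖q‖ < 1) (R : ℝ) :
    ∃ g : ℕ → ℝ, (∀ n, 0 ≤ g n) ∧ Summable g ∧ ∀ n U, ‖U‖ ≤ R → ‖localG q lam n U‖ ≤ g n := by
  obtain ⟨C, hC0, hC⟩ := exists_norm_qPochInf_le hq1 |R|
  have h3 : 0 ≤ (1 - ‖q‖)⁻¹ := inv_nonneg.2 (sub_pos.2 hq1).le
  refine ⟨fun n => C * ((‖lam‖ * |R| * (1 - ‖q‖)⁻¹) ^ n * ‖q‖ ^ (n ^ 2)), fun n => by positivity,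
    (summable_pow_mul_pow_sq (norm_nonneg q) hq1 (by positivity)).mul_left C, fun n U hU => ?_⟩
  exact norm_localG_le lam hq1 hC n (hU.trans (le_abs_self R))

theorem qPochInf_ratio (hq1 : ‖q‖ < 1) (n : ℕ) :
    qPochInf q (q ^ (n + 1)) / qPochInf q q = (qPoch q q n)⁻¹ := by
  have h := qPochInf_eq_mul hq1 q n
  have h0 := qPochInf_self_ne_zero hq1
  have h1 := qPoch_self_ne_zero hq1 n
  rw [pow_succ, div_eq_iff h0, h]
  field_simp

theorem norm_exp_lt_one {η : ℂ} (hη : η.re < 0) : ‖Complex.exp η‖ < 1 := by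
  rw [Complex.norm_exp]
  exact Real.exp_lt_one_iff.2 hη

/-- At an integer n the quotient (q^{1+n};q)_∞/(q;q)_∞ collapses to 1/(q;q)_n, and one infinite
product in the spectral variable remains. -/
theorem gFun_plus {η : ℂ} (hη : η.re < 0) (ℓ : ℂ) (n : ℕ) (s : ℂ) :
    gFun η 0 ℓ (n + s) n = localG (Complex.exp η) (Complex.exp ℓ) n (Complex.exp (η * s)) := by
  have hr := qPochInf_ratio (norm_exp_lt_one hη) n
  have e1 : Complex.exp (η * (1 + (n + s))) =
      Complex.exp η ^ (n + 1) * Complex.exp (η * s) := by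
    rw [← Complex.exp_nat_mul, ← Complex.exp_add]; congr 1; push_cast; ring
  have e2 : Complex.exp (η * (1 + n)) = Complex.exp η ^ (n + 1) := by
    rw [← Complex.exp_nat_mul]; congr 1; push_cast; ring
  have e3 : Complex.exp (η * ((n + s) * n)) =
      Complex.exp η ^ (n ^ 2) * Complex.exp (η * s) ^ n := by
    rw [← Complex.exp_nat_mul, ← Complex.exp_nat_mul, ← Complex.exp_add]
    congr 1; push_cast; ring
  rw [gFun, e1, e2, e3, mul_div_assoc, hr, mul_comm ℓ, Complex.exp_nat_mul, zero_mul,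
    Complex.exp_zero, localG]
  ring

theorem gFun_minus {η : ℂ} (hη : η.re < 0) (ℓ : ℂ) (n : ℕ) (s : ℂ) :
    gFun η 0 ℓ n (n - s) = Complex.exp (-(ℓ * s)) *
      localG (Complex.exp η) (Complex.exp ℓ) n (Complex.exp (-(η * s))) := by
  have hr := qPochInf_ratio (norm_exp_lt_one hη) n
  have e1 : Complex.exp (η * (1 + (n - s))) =
      Complex.exp η ^ (n + 1) * Complex.exp (-(η * s)) := by
    rw [← Complex.exp_nat_mul, ← Complex.exp_add]; congr 1; push_cast; ring
  have e2 : Complex.exp (η * (1 + n)) = Complex.exp η ^ (n + 1) := by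
    rw [← Complex.exp_nat_mul]; congr 1; push_cast; ring
  have e3 : Complex.exp (η * (n * (n - s))) =
      Complex.exp η ^ (n ^ 2) * Complex.exp (-(η * s)) ^ n := by
    rw [← Complex.exp_nat_mul, ← Complex.exp_nat_mul, ← Complex.exp_add]
    congr 1; push_cast; ring
  have e4 : Complex.exp (ℓ * (n - s)) = Complex.exp (-(ℓ * s)) * Complex.exp ℓ ^ n := by
    rw [← Complex.exp_nat_mul, ← Complex.exp_add]; congr 1; ring
  rw [gFun, e1, e2, e3, e4, mul_div_right_comm, hr, zero_mul, Complex.exp_zero, localG]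
  ring

end LocalKernel

end RelToda

/-! ### From entire kernels to the coefficients of the Baxter series -/

namespace RelToda

/-! ### Entire functions and their coefficients -/

section Entire

theorem exists_hasSum_of_differentiable {f : ℂ → ℂ} (hf : Differentiable ℂ f) :
    ∃ a : ℕ → ℂ, ∀ x, HasSum (fun N => a N * x ^ N) (f x) := by
  refine ⟨fun N => (N.factorial : ℂ)⁻¹ * iteratedDeriv N f 0, fun x => ?_⟩
  refine (Complex.hasSum_taylorSeries_of_entire hf 0 x).congr_fun ?_
  intro N
  simp only [sub_zero, smul_eq_mul]
  ring

theorem eq_of_hasSum_pow {a b : ℕ → ℂ} {f : ℂ → ℂ} (ha : ∀ x, HasSum (fun N => a N * x ^ N) (f x))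
    (hb : ∀ x, HasSum (fun N => b N * x ^ N) (f x)) : a = b := by
  have h : ∀ {a : ℕ → ℂ}, (∀ x, HasSum (fun N => a N * x ^ N) (f x)) →
      HasFPowerSeriesAt f (FormalMultilinearSeries.ofScalars ℂ a) 0 := by
    intro a ha
    rw [hasFPowerSeriesAt_iff]
    refine .of_forall fun z => ?_
    simpa [FormalMultilinearSeries.coeff_ofScalars, mul_comm] using ha z
  have h2 := (h ha).eq_formalMultilinearSeries (h hb)
  funext N
  simpa [FormalMultilinearSeries.coeff_ofScalars] using congrArg (fun p => p.coeff N) h2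

theorem hasSum_pow_mul {a : ℕ → ℂ} {x s : ℂ} (h : HasSum (fun N => a N * x ^ N) s) (F : ℕ) :
    HasSum (fun N => (if F ≤ N then a (N - F) else 0) * x ^ N) (x ^ F * s) := by
  have h1 := (add_left_injective F).hasSum_iff (f := fun N => (if F ≤ N then a (N - F) else 0) *
    x ^ N) (a := x ^ F * s) (fun N hN => by
      rw [if_neg, zero_mul]
      exact fun hF => hN ⟨N - F, Nat.sub_add_cancel hF⟩)
  rw [← h1]
  refine (h.mul_left (x ^ F)).congr_fun fun N => ?_
  simp only [Function.comp, Nat.le_add_left, if_true, Nat.add_sub_cancel]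
  ring

theorem hasSum_polynomial_mul {F : ℕ} {p a : ℕ → ℂ} (hp : ∀ i, F < i → p i = 0) {x s : ℂ}
    (h : HasSum (fun N => a N * x ^ N) s) :
    HasSum (fun N => (∑ z ∈ Finset.HasAntidiagonal.antidiagonal N, p z.1 * a z.2) * x ^ N)
      ((∑ i ∈ Finset.range (F + 1), x ^ i * p i) * s) := by
  have hp' : HasSum (fun i => p i * x ^ i) (∑ i ∈ Finset.range (F + 1), x ^ i * p i) := by
    have : ∑ i ∈ Finset.range (F + 1), x ^ i * p i = ∑ i ∈ Finset.range (F + 1), p i * x ^ i :=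
      Finset.sum_congr rfl fun i _ => mul_comm _ _
    rw [this]
    refine hasSum_sum_of_ne_finset_zero fun i hi => ?_
    rw [Finset.mem_range] at hi
    rw [hp i (by omega), zero_mul]
  have hs := summable_norm_sum_mul_antidiagonal_of_summable_norm hp'.summable.norm h.summable.norm
  have ht := tsum_mul_tsum_eq_tsum_sum_antidiagonal_of_summable_norm hp'.summable.norm
    h.summable.norm
  rw [hp'.tsum_eq, h.tsum_eq] at ht
  rw [ht]
  refine hs.of_norm.hasSum.congr_fun fun N => ?_
  rw [Finset.sum_mul]
  refine Finset.sum_congr rfl fun z hz => ?_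
  rw [← Finset.HasAntidiagonal.mem_antidiagonal.1 hz, pow_add]
  ring

end Entire

/-! ### Matrix elements of the coefficients of the Baxter series -/

section Coefficients

variable {F : ℕ}

theorem continuous_toFormal : Continuous (toFormal (F := F)) := continuous_induced_dom

instance : ContinuousAdd (Op F) where
  continuous_add := by
    refine continuous_induced_rng.2 ?_
    change Continuous fun p : Op F × Op F => toFormal p.1 + toFormal p.2
    exact (continuous_toFormal.comp continuous_fst).add (continuous_toFormal.comp continuous_snd)

instance : ContinuousSMul ℂ (Op F) where
  continuous_smul := by
    refine continuous_induced_rng.2 ?_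
    change Continuous fun p : ℂ × Op F => p.1 • toFormal p.2
    exact continuous_fst.smul (continuous_toFormal.comp continuous_snd)

theorem entry_one (k' k : Fin F → ℤ) :
    entry (1 : Op F) k' k = if k' = k then 1 else 0 := by
  rw [← monoOp_one, entry_monoOp, add_zero]

theorem entry_add (a b : Op F) (k' k : Fin F → ℤ) :
    entry (a + b) k' k = entry a k' k + entry b k' k := rfl

theorem entry_smul (c : ℂ) (a : Op F) (k' k : Fin F → ℤ) :
    entry (c • a) k' k = c * entry a k' k := rfl

theorem entry_sum {ι : Type*} (s : Finset ι) (a : ι → Op F) (k' k : Fin F → ℤ) :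
    entry (∑ i ∈ s, a i) k' k = ∑ i ∈ s, entry (a i) k' k := by
  simp only [entry, LinearMap.sum_apply, Finsupp.finsetSum_apply]

/-- The product with an operator whose matrix has finite rows. -/
theorem entry_mul {a : Op F} {k' : Fin F → ℤ} {s : Finset (Fin F → ℤ)}
    (hs : ∀ j, j ∉ s → entry a k' j = 0) (b : Op F) (k : Fin F → ℤ) :
    entry (a * b) k' k = ∑ j ∈ s, entry a k' j * entry b j k := by
  have h : ∀ x : (Fin F → ℤ) →₀ ℂ, a x k' = ∑ j ∈ s, entry a k' j * x j := by
    intro x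
    induction x using Finsupp.induction_linear with
    | zero => simp
    | add x y hx hy =>
      rw [map_add, Finsupp.add_apply, hx, hy, ← Finset.sum_add_distrib]
      exact Finset.sum_congr rfl fun j _ => by rw [Finsupp.add_apply, mul_add]
    | single i c =>
      have e : a (Finsupp.single i c) k' = entry a k' i * c := by
        rw [← mul_one c, ← smul_eq_mul, ← Finsupp.smul_single, map_smul, Finsupp.smul_apply,
          smul_eq_mul, smul_eq_mul, mul_one, mul_comm]
        rfl
      rw [e]
      simp only [Finsupp.single_apply, mul_ite, mul_zero, Finset.sum_ite_eq]
      split_ifs with hi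
      · rfl
      · rw [hs i hi, zero_mul]
  exact h _

theorem neg_one_pow_mul_eq_smul {A : Type*} [Ring A] [Algebra ℂ A] (i : ℕ) (a : A) :
    (-1) ^ i * a = (-1 : ℂ) ^ i • a := by
  rcases Nat.even_or_odd i with h | h <;> simp [h.neg_one_pow]

theorem coeff_transferSeries_op (t : ℕ → Op F) (i : ℕ) :
    PowerSeries.coeff i (transferSeries F t) = if i ≤ F then (-1 : ℂ) ^ i • t (F - i) else 0 := by
  refine (coeff_transferSeries F t i).trans ?_
  rw [neg_one_pow_mul_eq_smul]

theorem constantCoeff_transferSeries_op (t : ℕ → Op F) :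
    PowerSeries.constantCoeff (transferSeries F t) = t F :=
  constantCoeff_transferSeries F t

/-- The recursion of the Baxter equation, for families of matrix elements. -/
def IsMatrixSolution (q lam : ℂ) (t : ℕ → Op F) (s : (Fin F → ℤ) → Finset (Fin F → ℤ))
    (φ : ℕ → (Fin F → ℤ) → (Fin F → ℤ) → ℂ) : Prop :=
  ∀ N k' k, ∑ z ∈ Finset.HasAntidiagonal.antidiagonal N, ∑ j ∈ s k',
      entry (PowerSeries.coeff z.1 (transferSeries F t)) k' j * φ z.2 j k =
    (if F ≤ N then (-lam) ^ F * (q ^ (N - F) * ∑ j ∈ s k', entry (t 0) k' j * φ (N - F) j k)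
      else 0) + q⁻¹ ^ N * φ N k' k

theorem IsBaxterSolution.isMatrixSolution {q lam : ℂ} {t : ℕ → Op F}
    {s : (Fin F → ℤ) → Finset (Fin F → ℤ)}
    (hs : ∀ i k' j, j ∉ s k' → entry (t i) k' j = 0) {Q : PowerSeries (Op F)}
    (hQ : IsBaxterSolution F q lam t Q) :
    IsMatrixSolution q lam t s fun N => entry (PowerSeries.coeff N Q) := by
  have hsτ : ∀ i k' j, j ∉ s k' →
      entry (PowerSeries.coeff i (transferSeries F t)) k' j = 0 := by
    intro i k' j hj
    rw [coeff_transferSeries_op]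
    split_ifs
    · rw [entry_smul, hs _ _ _ hj, mul_zero]
    · rfl
  intro N k' k
  have h := congrArg (fun a => entry a k' k) (isBaxterSolution_iff.1 hQ N)
  simp only [entry_sum, entry_add, entry_smul] at h
  rw [Finset.sum_congr rfl fun z _ => entry_mul (hsτ z.1 k') _ k] at h
  rw [h]
  congr 1
  split_ifs
  · rw [smul_mul_smul_comm, entry_smul, entry_mul (hs 0 k'), mul_assoc]
  · rfl

/-- The Taylor coefficients of a candidate kernel are not known to be operators with finite columns.
The rows of the t_j are finite, so the recursion makes sense for arbitrary families of matrix
elements, and 1 − q^{-N} ≠ 0 again gives uniqueness. -/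
theorem IsMatrixSolution.eq {q lam : ℂ} (hF : F ≠ 0) (hq : ∀ N : ℕ, N ≠ 0 → q ^ N ≠ 1)
    {t : ℕ → Op F} (ht : t F = 1) {s : (Fin F → ℤ) → Finset (Fin F → ℤ)} (hs : ∀ k, k ∈ s k)
    {φ ψ : ℕ → (Fin F → ℤ) → (Fin F → ℤ) → ℂ} (hφ : IsMatrixSolution q lam t s φ)
    (hψ : IsMatrixSolution q lam t s ψ) (h0 : φ 0 = ψ 0) : φ = ψ := by
  have hq' : ∀ N : ℕ, N ≠ 0 → (1 : ℂ) - q⁻¹ ^ N ≠ 0 := by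
    intro N hN h
    refine hq N hN ?_
    rw [inv_pow, sub_eq_zero, eq_comm, inv_eq_one] at h
    exact h
  funext N
  induction N using Nat.strong_induction_on with
  | _ N ih =>
    rcases Nat.eq_zero_or_pos N with rfl | hN
    · exact h0
    funext k' k
    have h1 : ∀ χ : ℕ → (Fin F → ℤ) → (Fin F → ℤ) → ℂ, ∑ z ∈ Finset.HasAntidiagonal.antidiagonal N, ∑ j ∈ s k',
        entry (PowerSeries.coeff z.1 (transferSeries F t)) k' j * χ z.2 j k =
        χ N k' k + ∑ z ∈ (Finset.HasAntidiagonal.antidiagonal N).erase (0, N), ∑ j ∈ s k',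
        entry (PowerSeries.coeff z.1 (transferSeries F t)) k' j * χ z.2 j k := by
      intro χ
      rw [← Finset.add_sum_erase _ _ (Finset.HasAntidiagonal.mem_antidiagonal (a := (0, N)).2 (zero_add N))]
      congr 1
      rw [PowerSeries.coeff_zero_eq_constantCoeff_apply, constantCoeff_transferSeries_op, ht]
      simp [entry_one, hs]
    have h2 : ∑ z ∈ (Finset.HasAntidiagonal.antidiagonal N).erase (0, N), ∑ j ∈ s k',
        entry (PowerSeries.coeff z.1 (transferSeries F t)) k' j * φ z.2 j k =
        ∑ z ∈ (Finset.HasAntidiagonal.antidiagonal N).erase (0, N), ∑ j ∈ s k',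
        entry (PowerSeries.coeff z.1 (transferSeries F t)) k' j * ψ z.2 j k := by
      refine Finset.sum_congr rfl fun z hz => ?_
      rw [ih z.2]
      have h3 := Finset.mem_erase.1 hz
      have h4 := Finset.HasAntidiagonal.mem_antidiagonal.1 h3.2
      rcases Nat.lt_or_ge z.2 N with h | h
      · exact h
      · exact absurd (Prod.ext (by simp; omega) (by simp; omega)) h3.1
    have h3 := hφ N k' k
    have h4 := hψ N k' k
    rw [h1, h2] at h3
    rw [h1] at h4
    have h5 : (if F ≤ N then (-lam) ^ F * (q ^ (N - F) * ∑ j ∈ s k', entry (t 0) k' j *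
        φ (N - F) j k) else 0) = if F ≤ N then (-lam) ^ F * (q ^ (N - F) * ∑ j ∈ s k',
        entry (t 0) k' j * ψ (N - F) j k) else 0 := by
      split_ifs
      · rw [ih (N - F) (by omega)]
      · rfl
    rw [h5] at h3
    refine mul_left_cancel₀ (hq' N hN.ne') ?_
    linear_combination h3 - h4

/-- An entire solution of the Baxter equation is the sum of the Baxter series. -/
theorem hasSum_baxterJ {q lam : ℂ} (hF : F ≠ 0) (hq0 : q ≠ 0) (hq1 : ‖q‖ < 1)
    {t : ℕ → Op F} (ht : t F = 1) (hcomm : ∀ i j, Commute (t i) (t j))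
    {s : (Fin F → ℤ) → Finset (Fin F → ℤ)} (hs : ∀ k, k ∈ s k)
    (hst : ∀ i k' j, j ∉ s k' → entry (t i) k' j = 0) {K : ℂ → (Fin F → ℤ) → (Fin F → ℤ) → ℂ}
    (hK0 : K 0 = entry 1) (hK : ∀ k' k, Differentiable ℂ fun x => K x k' k)
    (hB : ∀ x k' k, ∑ j ∈ s k', (∑ i ∈ Finset.range (F + 1),
        x ^ i * entry (PowerSeries.coeff i (transferSeries F t)) k' j) * K x j k =
      (-(lam * x)) ^ F * ∑ j ∈ s k', entry (t 0) k' j * K (q * x) j k + K (q⁻¹ * x) k' k)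
    (x : ℂ) (k' k : Fin F → ℤ) :
    HasSum (fun N => x ^ N * entry (PowerSeries.coeff N (baxterJ F q lam t)) k' k) (K x k' k) := by
  choose a ha using fun k' k => exists_hasSum_of_differentiable (hK k' k)
  have hq : ∀ N : ℕ, N ≠ 0 → q ^ N ≠ 1 := by
    intro N hN h
    have := congrArg norm h
    rw [norm_pow, norm_one] at this
    exact (pow_lt_one₀ (norm_nonneg _) hq1 hN).ne this
  obtain ⟨hJ, hJ0⟩ := (isBaxterSolution_iff_eq_baxterJ hF hq0 hq1 lam t ht hcomm _).2 rfl
  have hJm := hJ.isMatrixSolution hst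
  -- Both sides of `hB` are entire in x, and equality of their Taylor coefficients is the recursion.
  have ham : IsMatrixSolution q lam t s fun N k' k => a k' k N := by
    intro N k' k
    refine congrFun (eq_of_hasSum_pow (f := fun x => ∑ j ∈ s k', (∑ i ∈ Finset.range (F + 1),
        x ^ i * entry (PowerSeries.coeff i (transferSeries F t)) k' j) * K x j k)
      (a := fun N => ∑ z ∈ Finset.HasAntidiagonal.antidiagonal N, ∑ j ∈ s k',
        entry (PowerSeries.coeff z.1 (transferSeries F t)) k' j * a j k z.2)
      (b := fun N => (if F ≤ N then (-lam) ^ F * (q ^ (N - F) *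
        ∑ j ∈ s k', entry (t 0) k' j * a j k (N - F)) else 0) + q⁻¹ ^ N * a k' k N)
      (fun x => ?_) fun x => ?_) N
    · have h := hasSum_sum fun j (_ : j ∈ s k') => hasSum_polynomial_mul (F := F)
        (p := fun i => entry (PowerSeries.coeff i (transferSeries F t)) k' j)
        (fun i hi => by rw [coeff_transferSeries_op, if_neg (by omega)]; rfl) (ha j k x)
      refine h.congr_fun fun N => ?_
      rw [Finset.sum_comm, Finset.sum_mul]
    · rw [hB]
      have h1 : HasSum (fun N => ((-lam) ^ F * (q ^ N * ∑ j ∈ s k', entry (t 0) k' j *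
          a j k N)) * x ^ N)
          ((-lam) ^ F * ∑ j ∈ s k', entry (t 0) k' j * K (q * x) j k) := by
        refine ((hasSum_sum fun j (_ : j ∈ s k') => (ha j k (q * x)).mul_left
          (entry (t 0) k' j)).mul_left ((-lam) ^ F)).congr_fun fun N => ?_
        rw [mul_assoc, Finset.mul_sum, Finset.sum_mul]
        congr 1
        refine Finset.sum_congr rfl fun j _ => ?_
        rw [mul_pow]
        ring
      have h2 := (hasSum_pow_mul h1 F).add (ha k' k (q⁻¹ * x))
      have e : ∀ w : ℂ, x ^ F * ((-lam) ^ F * w) = (-(lam * x)) ^ F * w := by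
        intro w
        rw [← neg_mul, mul_pow]
        ring
      rw [e] at h2
      refine h2.congr_fun fun N => ?_
      rw [mul_pow]
      split_ifs <;> ring
  have h0 : ∀ k' k, a k' k 0 = entry (1 : Op F) k' k := by
    intro k' k
    rw [← hK0]
    refine HasSum.unique ?_ (ha k' k 0)
    have := hasSum_single (f := fun N => a k' k N * 0 ^ N) 0 (fun N hN => by simp [hN])
    simpa using this
  have heq := hJm.eq hF hq ht hs ham (by
    funext k' k
    rw [h0, PowerSeries.coeff_zero_eq_constantCoeff_apply, hJ0])
  refine (ha k' k x).congr_fun fun N => ?_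
  have h1 := congrFun (congrFun (congrFun heq N) k') k
  rw [mul_comm, ← h1]

end Coefficients

end RelToda

/-! ### The kernels of Q_± as solutions of the Baxter equation -/

namespace RelToda

/-! ### The kernel of the `Q`-operators -/

section Kernel

variable {F : ℕ} (q lam : ℂ) (ρ : Equiv.Perm (Fin F)) (ε : ℤ)

/-- The condition `m_f = ε (n_{ρ f} - n_f)` on the occupation numbers. -/
def Compat (m : Fin F → ℤ) (n : Fin F → ℕ) : Prop := ∀ f, m f = ε * ((n (ρ f) : ℤ) - n f)

instance (m : Fin F → ℤ) (n : Fin F → ℕ) : Decidable (Compat ρ ε m n) :=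
  inferInstanceAs (Decidable (∀ _, _))

/-- The contribution of the occupation numbers `n` to the kernel of a `Q`-operator. -/
noncomputable def kernelTerm (W : Fin F → ℂ) (m : Fin F → ℤ) (n : Fin F → ℕ) : ℂ :=
  if Compat ρ ε m n then ∏ f, localG q lam (n f) (W f) else 0

/-- The kernel of a `Q`-operator. -/
noncomputable def kernel (W : Fin F → ℂ) (m : Fin F → ℤ) : ℂ := ∑' n, kernelTerm q lam ρ ε W m n

variable {q}

theorem exists_bound_kernelTerm (hq1 : ‖q‖ < 1) (R : Fin F → ℝ) :
    ∃ g : (Fin F → ℕ) → ℝ, Summable g ∧ ∀ W : Fin F → ℂ, (∀ f, ‖W f‖ ≤ R f) → ∀ m n,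
      ‖kernelTerm q lam ρ ε W m n‖ ≤ g n := by
  choose g hg0 hgs hg using fun f => exists_bound_localG lam hq1 (R f)
  refine ⟨fun n => ∏ f, g f (n f), summable_pi_prod hg0 hgs, fun W hW m n => ?_⟩
  rw [kernelTerm]
  split_ifs
  · rw [norm_prod]
    exact Finset.prod_le_prod (fun _ _ => norm_nonneg _) fun f _ => hg f _ _ (hW f)
  · rw [norm_zero]
    exact Finset.prod_nonneg fun f _ => hg0 f _

theorem summable_kernelTerm (hq1 : ‖q‖ < 1) (W : Fin F → ℂ) (m : Fin F → ℤ) :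
    Summable (kernelTerm q lam ρ ε W m) := by
  obtain ⟨g, hg, h⟩ := exists_bound_kernelTerm lam ρ ε hq1 fun f => ‖W f‖
  exact hg.of_norm_bounded fun n => h W (fun _ => le_rfl) m n

theorem hasSum_kernel (hq1 : ‖q‖ < 1) (W : Fin F → ℂ) (m : Fin F → ℤ) :
    HasSum (kernelTerm q lam ρ ε W m) (kernel q lam ρ ε W m) :=
  (summable_kernelTerm lam ρ ε hq1 W m).hasSum

theorem differentiable_kernel (hq1 : ‖q‖ < 1) (y : Fin F → ℂ) (m : Fin F → ℤ) :
    Differentiable ℂ fun x => kernel q lam ρ ε (fun f => x * y f) m := by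
  intro x
  obtain ⟨g, hg, h⟩ := exists_bound_kernelTerm lam ρ ε hq1 fun f => (‖x‖ + 1) * ‖y f‖
  refine (Complex.differentiableOn_tsum_of_summable_norm hg (fun n => ?_) Metric.isOpen_ball
    (fun n w hw => h (fun f => w * y f) (fun f => ?_) m n)).differentiableAt
    (Metric.isOpen_ball.mem_nhds (Metric.mem_ball_self (x := x) one_pos))
  · refine Differentiable.differentiableOn ?_
    by_cases hc : Compat ρ ε m n
    · simp only [kernelTerm, if_pos hc]
      refine Differentiable.fun_finsetProd fun f _ => ?_
      exact (differentiable_localG lam hq1 (n f)).comp (differentiable_id.mul_const (y f))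
    · simp only [kernelTerm, if_neg hc]
      exact differentiable_const 0
  · rw [norm_mul]
    refine mul_le_mul_of_nonneg_right ?_ (norm_nonneg _)
    have h1 := (Metric.mem_ball.1 hw).le
    rw [dist_eq_norm] at h1
    calc ‖w‖ = ‖x + (w - x)‖ := by congr 1; ring
      _ ≤ _ := (norm_add_le _ _).trans (by linarith)

theorem kernel_zero (m : Fin F → ℤ) :
    kernel q lam ρ ε (fun _ => 0) m = if m = 0 then 1 else 0 := by
  rw [kernel, tsum_eq_single 0]
  · rw [kernelTerm]
    have : Compat ρ ε m 0 ↔ m = 0 := by simp [Compat, funext_iff]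
    simp [this, localG_zero_right]
  · intro n hn
    obtain ⟨f, hf⟩ := Function.ne_iff.1 hn
    rw [kernelTerm]
    split_ifs
    · exact Finset.prod_eq_zero (Finset.mem_univ f)
        (by rw [localG_zero_right, if_neg (show n f ≠ 0 from hf)])
    · rfl

/-- The local weights of the Baxter equation. -/
noncomputable def mixWeight (c U : ℂ) (a b : ℕ) : ℂ :=
  if a = 0 then (if b = 0 then 1 - U else U - c) else if b = 0 then 1 - c else 0

/-- The transfer matrix changes both the occupation number and the argument, yet by the two
q-difference relations the result is always a multiple of the same `localG`. For n = 0, a = 1 the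
left side is zero by the cutoff and the right side because 1 − q^0 = 0. -/
theorem ell_mul_localG (hq0 : q ≠ 0) (hq1 : ‖q‖ < 1) (n : ℕ) (U : ℂ) (a b : Fin 2) :
    ell lam U a b * (if (a : ℕ) ≤ n then
        localG q lam (n - a) (U * q ^ (-((b : ℕ) - (a : ℕ) : ℤ))) else 0) =
      mixWeight (q ^ n)⁻¹ U a b * localG q lam n U := by
  fin_cases a <;> fin_cases b
  · simp [ell, mixWeight]
  · have := localG_div lam hq0 hq1 n U
    rw [div_eq_mul_inv] at this
    simp [ell, mixWeight, this]
    ring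
  · rcases Nat.eq_zero_or_pos n with rfl | hn
    · simp [ell, mixWeight]
    · obtain ⟨m, rfl⟩ := Nat.exists_eq_succ_of_ne_zero hn.ne'
      have := mul_localG_mul lam hq0 hq1 m U
      rw [mul_comm q] at this
      simp [ell, mixWeight, this]
      ring
  · simp [ell, mixWeight]

theorem sum_fin_two_eq {M : Type*} [AddCommMonoid M] (g : (Fin F → ℕ) → M) :
    ∑ a : Fin F → Fin 2, g (fun f => (a f : ℕ)) =
      ∑ a ∈ Fintype.piFinset (fun _ : Fin F => Finset.range 2), g a := by
  refine Finset.sum_nbij' (fun a f => (a f : ℕ)) (fun a f => Fin.ofNat 2 (a f)) ?_ ?_ ?_ ?_ ?_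
  · intro a _
    exact Fintype.mem_piFinset.2 fun f => Finset.mem_range.2 (a f).2
  · intro a _
    exact Finset.mem_univ _
  · intro a _
    funext f
    simp
  · intro a ha
    funext f
    rw [Fintype.mem_piFinset] at ha
    simpa using Nat.mod_eq_of_lt (Finset.mem_range.1 (ha f))
  · intro a _
    rfl

variable {ρ}

/-- The matrices with rows (1 − U, U − c) and (1 − c, 0) share the eigenvector (1, 1) of eigenvalue
1 − c, and their other eigenvalue is c − U. They are simultaneously triangular, so the trace of
their product is a sum of two products. -/
theorem sum_prod_mixWeight [NeZero F] (hρ : IsTransitive ρ) (c U : Fin F → ℂ) :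
    ∑ a : Fin F → Fin 2, ∏ f, mixWeight (c f) (U f) (a f) (a (ρ f)) =
      ∏ f, (1 - c f) + ∏ f, (c f - U f) := by
  have h := cycSum_eq_add hρ (fun _ => 1) (fun f => mixWeight (c f) (U f))
    (fun f _ μ => if μ = 1 then c f - U f else 0) (fun f => 1 - c f) ?_ ?_ ?_ ?_
  · rw [sum_fin_two_eq fun a => ∏ f, mixWeight (c f) (U f) (a f) (a (ρ f))]
    refine h.trans ?_
    congr 1
    simp
  · intro f
    simp [Finset.sum_range_succ, mixWeight]
  · simp
  · simp
  · intro f ν hν j hj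
    interval_cases ν
    interval_cases j <;> simp [mixWeight]

/-- The Baxter equation for the kernel. -/
theorem kernel_baxter [NeZero F] (hρ : IsTransitive ρ) (hq0 : q ≠ 0) (hq1 : ‖q‖ < 1)
    (W : Fin F → ℂ) (m : Fin F → ℤ) :
    ∑ a : Fin F → Fin 2, (∏ f, ell lam (W f) (a f) (a (ρ f))) *
      kernel q lam ρ ε (fun f => W f * q ^ (-((a (ρ f) : ℕ) - (a f : ℕ) : ℤ)))
        (fun f => m f - ε * ((a (ρ f) : ℕ) - (a f : ℕ) : ℤ)) =
    (∏ f, -(lam * W f)) * kernel q lam ρ ε (fun f => q * W f) m +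
      kernel q lam ρ ε (fun f => W f / q) m := by
  -- Reindexing by n + a absorbs the shift of m; the occupation numbers not of this form contribute
  -- zero by `ell_mul_localG`.
  have h1 : ∀ a : Fin F → Fin 2, HasSum (fun n : Fin F → ℕ => if Compat ρ ε m n then
      ∏ f, mixWeight (q ^ n f)⁻¹ (W f) (a f) (a (ρ f)) * localG q lam (n f) (W f) else 0)
      ((∏ f, ell lam (W f) (a f) (a (ρ f))) *
      kernel q lam ρ ε (fun f => W f * q ^ (-((a (ρ f) : ℕ) - (a f : ℕ) : ℤ)))
        (fun f => m f - ε * ((a (ρ f) : ℕ) - (a f : ℕ) : ℤ))) := by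
    intro a
    have hinj : Function.Injective fun (n : Fin F → ℕ) f => n f + (a f : ℕ) := by
      intro n n' h
      funext f
      exact Nat.add_right_cancel (congrFun h f)
    refine (hinj.hasSum_iff ?_).1 ?_
    · intro n hn
      split_ifs
      · have : ∃ f, ¬ (a f : ℕ) ≤ n f := by
          by_contra hcon
          push Not at hcon
          exact hn ⟨fun f => n f - a f, funext fun f => Nat.sub_add_cancel (hcon f)⟩
        obtain ⟨f, hf⟩ := this
        refine Finset.prod_eq_zero (Finset.mem_univ f) ?_
        rw [← ell_mul_localG lam hq0 hq1, if_neg hf, mul_zero]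
      · rfl
    · refine ((hasSum_kernel lam ρ ε hq1 _ _).mul_left _).congr_fun fun n => ?_
      have hiff : Compat ρ ε m (fun f => n f + (a f : ℕ)) ↔
          Compat ρ ε (fun f => m f - ε * ((a (ρ f) : ℕ) - (a f : ℕ) : ℤ)) n := by
        refine forall_congr' fun f => ?_
        push_cast
        constructor <;> intro h <;> linear_combination h
      simp only [Function.comp, kernelTerm, hiff]
      split_ifs
      · rw [← Finset.prod_mul_distrib]
        refine Finset.prod_congr rfl fun f _ => ?_
        rw [← ell_mul_localG lam hq0 hq1, if_pos (Nat.le_add_left _ _), Nat.add_sub_cancel]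
      · rw [mul_zero]
  -- Raising all n_f by one preserves their differences, and the terms with some n_f = 0 vanish
  -- through the factor 1 − q^{-n_f}.
  have h2 : HasSum (fun n : Fin F → ℕ => if Compat ρ ε m n then
      ∏ f, (1 - (q ^ n f)⁻¹) * localG q lam (n f) (W f) else 0)
      ((∏ f, -(lam * W f)) * kernel q lam ρ ε (fun f => q * W f) m) := by
    have hinj : Function.Injective fun (n : Fin F → ℕ) f => n f + 1 := by
      intro n n' h
      funext f
      exact Nat.add_right_cancel (congrFun h f)
    refine (hinj.hasSum_iff ?_).1 ?_
    · intro n hn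
      split_ifs
      · have : ∃ f, n f = 0 := by
          by_contra hcon
          push Not at hcon
          exact hn ⟨fun f => n f - 1, funext fun f =>
            Nat.sub_add_cancel (Nat.one_le_iff_ne_zero.2 (hcon f))⟩
        obtain ⟨f, hf⟩ := this
        refine Finset.prod_eq_zero (Finset.mem_univ f) ?_
        rw [hf]
        simp
      · rfl
    · refine ((hasSum_kernel lam ρ ε hq1 _ _).mul_left _).congr_fun fun n => ?_
      have hiff : Compat ρ ε m (fun f => n f + 1) ↔ Compat ρ ε m n := by
        refine forall_congr' fun f => ?_
        push_cast
        rw [add_sub_add_right_eq_sub]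
      simp only [Function.comp, kernelTerm, hiff]
      split_ifs
      · rw [← Finset.prod_mul_distrib]
        refine Finset.prod_congr rfl fun f _ => ?_
        linear_combination mul_localG_mul lam hq0 hq1 (n f) (W f)
      · rw [mul_zero]
  have h3 := h2.add (hasSum_kernel lam ρ ε hq1 (fun f => W f / q) m)
  refine (hasSum_sum fun a (_ : a ∈ Finset.univ) => h1 a).unique (h3.congr_fun fun n => ?_)
  simp only [kernelTerm]
  split_ifs
  · simp only [Finset.prod_mul_distrib]
    rw [← Finset.sum_mul, sum_prod_mixWeight hρ, add_mul]
    congr 1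
    rw [← Finset.prod_mul_distrib]
    exact Finset.prod_congr rfl fun f _ => (localG_div lam hq0 hq1 _ _).symm
  · simp

end Kernel

/-! ### The Baxter series of the chain -/

section Chain

variable {F : ℕ} (η ℓ : ℂ) (σ : Fin F → ℂ)

theorem transferSeries_tCoeff (i : ℕ) :
    PowerSeries.coeff i (transferSeries F (tCoeff F η ℓ σ)) = (chainPoly η ℓ σ).coeff i :=
  transferSeries_transferCoeff (A := Op F) _ _ _ _ (fun f g _ => commute_uOp η σ f g)
    (commute_uOp_vOp η σ) i

theorem tCoeff_eq (j : ℕ) :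
    tCoeff F η ℓ σ j = (-1 : ℂ) ^ (F - j) • (chainPoly η ℓ σ).coeff (F - j) :=
  (transferCoeff_eq (A := Op F) _ _ _ _ (fun f g _ => commute_uOp η σ f g)
    (commute_uOp_vOp η σ) j).trans (neg_one_pow_mul_eq_smul _ _)

theorem transferMatrix_eq_tCoeff :
    transferMatrix (Complex.exp (η / 2)) (Complex.exp ℓ) (uOp η σ) vOp =
        transferLaurent F (tCoeff F η ℓ σ) :=
  transferMatrix_eq_transferLaurent (A := Op F) _ _ _ _ (fun f g _ => commute_uOp η σ f g)
    (commute_uOp_vOp η σ)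

theorem uSq_ne_zero (k : Fin F → ℤ) (f : Fin F) : uSq η σ k f ≠ 0 := Complex.exp_ne_zero _

theorem entry_transferAt_eq_sum (x : ℂ) (k' j : Fin F → ℤ) : entry (transferAt η ℓ σ x) k' j =
    ∑ i ∈ Finset.range (F + 1), x ^ i * entry ((chainPoly η ℓ σ).coeff i) k' j := by
  rw [transferAt_eq_sum, entry_sum]
  rfl

variable [NeZero F]

theorem tCoeff_top : tCoeff F η ℓ σ F = 1 := by
  rw [tCoeff_eq, Nat.sub_self, pow_zero, one_smul]
  exact coeff_zero_transferPoly (A := Op F) _ _ _ _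

theorem neg_one_pow_mul_cancel {A : Type*} [Ring A] (n : ℕ) (a : A) :
    (-1) ^ n * ((-1) ^ n * a) = a := by
  rw [← mul_assoc, ← pow_add, ← two_mul, pow_mul, neg_one_sq, one_pow, one_mul]

theorem tCoeff_zero : tCoeff F η ℓ σ 0 = ((List.ofFn fun f => uOp η σ f ^ 2).prod).val := by
  refine (transferCoeff_eq (A := Op F) _ _ _ _ (fun f g _ => commute_uOp η σ f g)
    (commute_uOp_vOp η σ) 0).trans ?_
  rw [Nat.sub_zero]
  refine (congrArg _ (coeff_top_transferPoly (A := Op F) _ _ _ _)).trans ?_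
  exact neg_one_pow_mul_cancel F _

theorem commute_tCoeff (i j : ℕ) : Commute (tCoeff F η ℓ σ i) (tCoeff F η ℓ σ j) := by
  rw [tCoeff_eq, tCoeff_eq]
  exact ((commute_coeff_chainPoly η ℓ σ _ _).smul_left _).smul_right _

/-- The product of the `u_f²`. -/
noncomputable def uSqProd (k : Fin F → ℤ) : ℂ := ∏ f, uSq η σ k f

theorem uSqProd_ne_zero {F : ℕ} (η : ℂ) (σ : Fin F → ℂ) (k : Fin F → ℤ) : uSqProd η σ k ≠ 0 :=
  Finset.prod_ne_zero_iff.2 fun f _ => uSq_ne_zero η σ k f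

theorem tCoeff_zero_eq_monoOp : tCoeff F η ℓ σ 0 = monoOp (uSqProd η σ) 0 := by
  rw [tCoeff_zero]
  have h : ∀ f, ((uOp η σ f ^ 2 : (Op F)ˣ) : Op F) =
      monoOp (fun k => (fun (f : Fin F) (κ : ℤ) => Complex.exp (η * (σ f + κ))) f (k f))
        (Pi.single f ((0 : Fin F → ℤ) f)) := by
    intro f
    rw [pow_two, Units.val_mul]
    change diagOp _ * diagOp _ = _
    rw [diagOp_eq_monoOp, monoOp_mul, Pi.zero_apply, Pi.single_zero, add_zero]
    congr 1
    funext k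
    rw [sub_zero, ← Complex.exp_add]
    congr 1
    ring
  have h2 := map_list_prod (Units.coeHom (Op F)) (List.ofFn fun f => uOp η σ f ^ 2)
  rw [List.map_ofFn] at h2
  refine h2.trans ?_
  have h3 : (Units.coeHom (Op F) ∘ fun f => uOp η σ f ^ 2) = fun f =>
      monoOp (fun k => (fun (f : Fin F) (κ : ℤ) => Complex.exp (η * (σ f + κ))) f (k f))
        (Pi.single f ((0 : Fin F → ℤ) f)) := funext h
  rw [h3, prod_ofFn_monoOp (fun (f : Fin F) (κ : ℤ) => Complex.exp (η * (σ f + κ)))]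
  rfl

theorem inverse_tCoeff_zero :
    Ring.inverse (tCoeff F η ℓ σ 0) = monoOp (fun k => (uSqProd η σ k)⁻¹) 0 := by
  have h1 : ∀ c d : (Fin F → ℤ) → ℂ, (∀ k, c k * d k = 1) → monoOp c 0 * monoOp d 0 = 1 := by
    intro c d h
    rw [monoOp_mul, add_zero, ← monoOp_one]
    congr 1
    funext k
    rw [sub_zero, h]
  let U : (Op F)ˣ := ⟨monoOp (uSqProd η σ) 0, monoOp (fun k => (uSqProd η σ k)⁻¹) 0,
    h1 _ _ fun k => mul_inv_cancel₀ (uSqProd_ne_zero η σ k),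
    h1 _ _ fun k => inv_mul_cancel₀ (uSqProd_ne_zero η σ k)⟩
  rw [tCoeff_zero_eq_monoOp]
  exact Ring.inverse_unit U

theorem tBar_top : tBar F η ℓ σ F = 1 := by
  rw [tBar, Nat.sub_self]
  refine Ring.inverse_mul_cancel _ ?_
  rw [tCoeff_zero]
  exact Units.isUnit _

theorem commute_tBar (i j : ℕ) : Commute (tBar F η ℓ σ i) (tBar F η ℓ σ j) := by
  have h : ∀ i, Commute (Ring.inverse (tCoeff F η ℓ σ 0)) (tCoeff F η ℓ σ i) := by
    intro i
    rw [tCoeff_zero, Ring.inverse_unit]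
    have := commute_tCoeff η ℓ σ 0 i
    rw [tCoeff_zero] at this
    exact this.units_inv_left
  exact ((Commute.refl _).mul_right (h _)).mul_left ((h _).symm.mul_right (commute_tCoeff η ℓ σ _ _))

/-- The basis vectors that the transfer matrix maps to `|k⟩`. -/
def preds (k : Fin F → ℤ) : Finset (Fin F → ℤ) :=
  Finset.univ.image fun a : Fin F → Fin 2 => k - fwd fun f => (a f : ℕ)

theorem self_mem_preds (k : Fin F → ℤ) : k ∈ preds k := by
  refine Finset.mem_image.2 ⟨0, Finset.mem_univ _, ?_⟩
  funext f
  simp [fwd]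

theorem entry_transferAt (x : ℂ) (k' j : Fin F → ℤ) : entry (transferAt η ℓ σ x) k' j =
    ∑ a : Fin F → Fin 2, if j = k' - fwd (fun f => (a f : ℕ)) then
      (∏ f, ell (Complex.exp ℓ) (x * uSq η σ k' f) (a f) (a (f + 1))) *
        (gauge η σ k' / gauge η σ j) else 0 := by
  rw [transferAt, chainPoly, evalAt_transferPoly, entry_sum]
  refine Finset.sum_congr rfl fun a _ => ?_
  rw [entry_monoOp]
  by_cases h : j = k' - fwd (fun f => (a f : ℕ))
  · rw [if_pos h, if_pos (by rw [h]; abel), ← h]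
  · rw [if_neg h, if_neg (fun h' => h (by rw [h']; abel))]

theorem entry_coeff_chainPoly {k' j : Fin F → ℤ} (hj : j ∉ preds k') (i : ℕ) :
    entry ((chainPoly η ℓ σ).coeff i) k' j = 0 := by
  by_cases hi : i < F + 1
  · refine coeff_eq_zero_of_infinite (c := fun i => entry ((chainPoly η ℓ σ).coeff i) k' j)
      Set.infinite_univ (fun x _ => ?_) hi
    rw [← entry_transferAt_eq_sum, entry_transferAt]
    refine Finset.sum_eq_zero fun a _ => if_neg ?_
    rintro rfl
    exact hj (Finset.mem_image_of_mem _ (Finset.mem_univ _))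
  · have := natDegree_chainPoly_le η ℓ σ
    rw [Polynomial.coeff_eq_zero_of_natDegree_lt (p := chainPoly η ℓ σ) (n := i) (by omega)]
    rfl

theorem entry_tCoeff {k' j : Fin F → ℤ} (hj : j ∉ preds k') (i : ℕ) :
    entry (tCoeff F η ℓ σ i) k' j = 0 := by
  rw [tCoeff_eq, entry_smul, entry_coeff_chainPoly η ℓ σ hj, mul_zero]

theorem entry_tBar_eq (i : ℕ) (k' j : Fin F → ℤ) : entry (tBar F η ℓ σ i) k' j =
    (uSqProd η σ k')⁻¹ * entry (tCoeff F η ℓ σ (F - i)) k' j := by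
  rw [tBar, inverse_tCoeff_zero, entry_monoOp_mul, sub_zero]

theorem entry_tBar {k' j : Fin F → ℤ} (hj : j ∉ preds k') (i : ℕ) :
    entry (tBar F η ℓ σ i) k' j = 0 := by
  rw [entry_tBar_eq, entry_tCoeff η ℓ σ hj, mul_zero]

/-- A sum over the rows of a transfer matrix. -/
theorem sum_preds (k' : Fin F → ℤ) (w : (Fin F → Fin 2) → ℂ) (φ : (Fin F → ℤ) → ℂ) :
    ∑ j ∈ preds k', (∑ a : Fin F → Fin 2, if j = k' - fwd (fun f => (a f : ℕ)) then w a else 0) *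
      φ j = ∑ a : Fin F → Fin 2, w a * φ (k' - fwd fun f => (a f : ℕ)) := by
  simp only [Finset.sum_mul, ite_mul, zero_mul]
  rw [Finset.sum_comm]
  refine Finset.sum_congr rfl fun a _ => ?_
  have ha : (k' - fwd fun f => (a f : ℕ)) ∈ preds k' :=
    Finset.mem_image.2 ⟨a, Finset.mem_univ _, rfl⟩
  rw [Finset.sum_ite_eq', if_pos ha]

/-- The matrix elements of the Baxter series of `{t}`. -/
noncomputable def plusKernel (x : ℂ) (k' k : Fin F → ℤ) : ℂ :=
  gauge η σ k' / gauge η σ k * kernel (Complex.exp η) (Complex.exp ℓ) (nextPerm F) 1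
    (fun f => x * uSq η σ k' f) (k' - k)

/-- The matrix elements of the Baxter series of `{t̄}`. -/
noncomputable def minusKernel (x : ℂ) (k' k : Fin F → ℤ) : ℂ :=
  gauge η σ k' / gauge η σ k * kernel (Complex.exp η) (Complex.exp ℓ) (nextPerm F).symm (-1)
    (fun f => x * (uSq η σ k' f)⁻¹) (k' - k)

theorem entry_tCoeff_zero (k' j : Fin F → ℤ) :
    entry (tCoeff F η ℓ σ 0) k' j = if k' = j then uSqProd η σ k' else 0 := by
  rw [tCoeff_zero_eq_monoOp, entry_monoOp, add_zero]

/-- The kernel is entire, equals the identity at x = 0 and solves the Baxter equation by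
`kernel_baxter`; uniqueness then identifies its Taylor coefficients with those of J. -/
theorem hasSum_plusKernel {η : ℂ} (hη : η.re < 0) (x : ℂ) (k' k : Fin F → ℤ) :
    HasSum (fun N => x ^ N * entry (PowerSeries.coeff N
      (baxterJ F (Complex.exp η) (Complex.exp ℓ) (tCoeff F η ℓ σ))) k' k)
      (plusKernel η ℓ σ x k' k) := by
  have hq0 := Complex.exp_ne_zero η
  have hq1 := norm_exp_lt_one hη
  refine hasSum_baxterJ (NeZero.ne F) hq0 hq1 (tCoeff_top η ℓ σ)
    (commute_tCoeff η ℓ σ) self_mem_preds (fun i k' j hj => entry_tCoeff η ℓ σ hj i) ?_ ?_ ?_ x k' k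
  · funext k' k
    simp only [plusKernel, zero_mul]
    rw [kernel_zero, entry_one]
    by_cases h : k' = k
    · rw [h, sub_self, if_pos rfl, if_pos rfl, mul_one, div_self (gauge_ne_zero η σ k)]
    · rw [if_neg h, if_neg (sub_ne_zero.2 h), mul_zero]
  · intro k' k
    exact (differentiable_kernel _ _ _ hq1 _ _).const_mul _
  · intro x k' k
    simp only [transferSeries_tCoeff, ← entry_transferAt_eq_sum]
    have h1 : ∀ j, entry (transferAt η ℓ σ x) k' j * plusKernel η ℓ σ x j k =
        (∑ a : Fin F → Fin 2, if j = k' - fwd (fun f => (a f : ℕ)) then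
          ∏ f, ell (Complex.exp ℓ) (x * uSq η σ k' f) (a f) (a (f + 1)) else 0) *
        (gauge η σ k' / gauge η σ k * kernel (Complex.exp η) (Complex.exp ℓ) (nextPerm F) 1
          (fun f => x * uSq η σ j f) (j - k)) := by
      intro j
      rw [entry_transferAt, plusKernel]
      have := gauge_ne_zero η σ j
      simp only [← ite_zero_mul, ← Finset.sum_mul]
      field_simp
    rw [Finset.sum_congr rfl fun j _ => h1 j, sum_preds]
    have h2 := kernel_baxter (Complex.exp ℓ) 1 (isTransitive_nextPerm F) hq0 hq1
      (fun f => x * uSq η σ k' f) (k' - k)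
    simp only [entry_tCoeff_zero, ite_mul, zero_mul, Finset.sum_ite_eq, self_mem_preds, if_true]
    have h3 : (∏ f, -(Complex.exp ℓ * (x * uSq η σ k' f))) =
        (-(Complex.exp ℓ * x)) ^ F * uSqProd η σ k' := by
      simp only [← mul_assoc, ← neg_mul]
      rw [Finset.prod_mul_distrib, Finset.prod_const, Finset.card_univ, Fintype.card_fin, uSqProd]
    rw [h3] at h2
    rw [plusKernel, plusKernel]
    have h4 : ∀ a : Fin F → Fin 2, k' - fwd (fun f => (a f : ℕ)) - k = fun f =>
        (k' - k) f - 1 * ((a (nextPerm F f) : ℕ) - (a f : ℕ) : ℤ) := by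
      intro a
      funext f
      simp only [Pi.sub_apply, fwd, nextPerm, Equiv.coe_addRight]
      ring
    have h5 : ∀ a : Fin F → Fin 2, (fun f => x * uSq η σ (k' - fwd fun f => (a f : ℕ)) f) =
        fun f => x * uSq η σ k' f *
          Complex.exp η ^ (-((a (nextPerm F f) : ℕ) - (a f : ℕ) : ℤ)) := by
      intro a
      funext f
      rw [uSq_sub, mul_assoc]
      rfl
    simp only [h4, h5]
    have h6 : (fun f => Complex.exp η * x * uSq η σ k' f) =
        fun f => Complex.exp η * (x * uSq η σ k' f) := funext fun f => mul_assoc _ _ _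
    have h7 : (fun f => (Complex.exp η)⁻¹ * x * uSq η σ k' f) =
        fun f => x * uSq η σ k' f / Complex.exp η := funext fun f => by
      rw [div_eq_mul_inv]; ring
    rw [h6, h7]
    have h8 : ∀ (g A B C D : ℂ), A * (C * (g * B)) + g * D = g * (A * C * B + D) := by
      intros; ring
    rw [h8, ← h2, Finset.mul_sum]
    refine Finset.sum_congr rfl fun a _ => ?_
    rw [mul_left_comm]
    rfl

/-- This is T̄(X) = (−X)^F t_0⁻¹ T(1/X), which reduces the second Baxter equation to the same
transfer matrix. -/
theorem sum_transferSeries_tBar {x : ℂ} (hx : x ≠ 0) (k' j : Fin F → ℤ) :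
    ∑ i ∈ Finset.range (F + 1),
      x ^ i * entry (PowerSeries.coeff i (transferSeries F (tBar F η ℓ σ))) k' j =
    (-x) ^ F * (uSqProd η σ k')⁻¹ * entry (transferAt η ℓ σ x⁻¹) k' j := by
  rw [entry_transferAt_eq_sum, ← Finset.sum_range_reflect, Finset.mul_sum]
  refine Finset.sum_congr rfl fun i hi => ?_
  rw [Finset.mem_range] at hi
  have e1 : F + 1 - 1 - i = F - i := by omega
  rw [e1, coeff_transferSeries_op, if_pos (Nat.sub_le _ _), entry_smul, entry_tBar_eq, tCoeff_eq,
    entry_smul, show F - (F - (F - (F - i))) = i by omega]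
  have e2 : (-x) ^ F = (-1) ^ (F - i) * (-1) ^ i * (x ^ (F - i) * x ^ i) := by
    rw [← pow_add, ← pow_add, Nat.sub_add_cancel (by omega), ← mul_pow, neg_one_mul]
  rw [e2, inv_pow]
  field_simp

/-- Inverting the argument transposes the local weights, up to a factor that cancels round the
cycle. Transposition reverses the chain, which is why `minusKernel` uses the inverse permutation and
ε = −1. -/
theorem neg_mul_ell_inv (lam : ℂ) {V : ℂ} (hV : V ≠ 0) (hlam : lam ≠ 0) (a b : Fin 2) :
    -V * ell lam V⁻¹ a b = ell lam V b a * (-lam) ^ ((a : ℕ) - (b : ℕ) : ℤ) := by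
  fin_cases a <;> fin_cases b <;> simp [ell] <;> field_simp
  ring

theorem hasSum_minusKernel {η : ℂ} (hη : η.re < 0) (x : ℂ) (k' k : Fin F → ℤ) :
    HasSum (fun N => x ^ N * entry (PowerSeries.coeff N
      (baxterJ F (Complex.exp η) (Complex.exp ℓ) (tBar F η ℓ σ))) k' k)
      (minusKernel η ℓ σ x k' k) := by
  have hq0 := Complex.exp_ne_zero η
  have hq1 := norm_exp_lt_one hη
  have hK0 : minusKernel η ℓ σ 0 = entry 1 := by
    funext k' k
    simp only [minusKernel, zero_mul]
    rw [kernel_zero, entry_one]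
    by_cases h : k' = k
    · rw [h, sub_self, if_pos rfl, if_pos rfl, mul_one, div_self (gauge_ne_zero η σ k)]
    · rw [if_neg h, if_neg (sub_ne_zero.2 h), mul_zero]
  refine hasSum_baxterJ (NeZero.ne F) hq0 hq1 (tBar_top η ℓ σ)
    (commute_tBar η ℓ σ) self_mem_preds (fun i k' j hj => entry_tBar η ℓ σ hj i) hK0 ?_ ?_ x k' k
  · intro k' k
    exact (differentiable_kernel _ _ _ hq1 _ _).const_mul _
  · intro x k' k
    -- The reflection X ↦ 1/X needs x ≠ 0; at x = 0 both sides of the equation are the kernel at 0.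
    rcases eq_or_ne x 0 with rfl | hx
    · have h1 : ∀ j, ∑ i ∈ Finset.range (F + 1),
          (0 : ℂ) ^ i * entry (PowerSeries.coeff i (transferSeries F (tBar F η ℓ σ))) k' j =
          if k' = j then 1 else 0 := by
        intro j
        rw [Finset.sum_eq_single_of_mem 0 (by simp) fun i _ hi => by rw [zero_pow hi, zero_mul],
          coeff_transferSeries_op, if_pos (Nat.zero_le _), Nat.sub_zero, tBar_top, pow_zero,
          pow_zero, one_smul, one_mul, entry_one]
      simp only [h1, ite_mul, zero_mul, one_mul, Finset.sum_ite_eq, self_mem_preds, if_true,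
        mul_zero, neg_zero, zero_pow (NeZero.ne F), zero_add]
    simp only [sum_transferSeries_tBar η ℓ σ hx]
    have h1 : ∀ j, (-x) ^ F * (uSqProd η σ k')⁻¹ * entry (transferAt η ℓ σ x⁻¹) k' j *
        minusKernel η ℓ σ x j k =
        (∑ a : Fin F → Fin 2, if j = k' - fwd (fun f => (a f : ℕ)) then
          ∏ f, ell (Complex.exp ℓ) (x * (uSq η σ k' f)⁻¹) (a (f + 1)) (a f) else 0) *
        (gauge η σ k' / gauge η σ k * kernel (Complex.exp η) (Complex.exp ℓ) (nextPerm F).symm (-1)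
          (fun f => x * (uSq η σ j f)⁻¹) (j - k)) := by
      intro j
      rw [entry_transferAt, minusKernel]
      have hg := gauge_ne_zero η σ j
      simp only [← ite_zero_mul, ← Finset.sum_mul]
      have h2 : ∀ a : Fin F → Fin 2, (-x) ^ F * (uSqProd η σ k')⁻¹ *
          ∏ f, ell (Complex.exp ℓ) (x⁻¹ * uSq η σ k' f) (a f) (a (f + 1)) =
          ∏ f, ell (Complex.exp ℓ) (x * (uSq η σ k' f)⁻¹) (a (f + 1)) (a f) := by
        intro a
        have e1 : (-x) ^ F * (uSqProd η σ k')⁻¹ = ∏ f, -(x * (uSq η σ k' f)⁻¹) := by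
          simp only [← neg_mul]
          rw [Finset.prod_mul_distrib, Finset.prod_const, Finset.card_univ, Fintype.card_fin,
            uSqProd, Finset.prod_inv_distrib]
        rw [e1, ← Finset.prod_mul_distrib]
        have e2 : ∀ f, -(x * (uSq η σ k' f)⁻¹) *
            ell (Complex.exp ℓ) (x⁻¹ * uSq η σ k' f) (a f) (a (f + 1)) =
            ell (Complex.exp ℓ) (x * (uSq η σ k' f)⁻¹) (a (f + 1)) (a f) *
              ((-Complex.exp ℓ) ^ (-((a (f + 1) : ℕ) : ℤ)) *
                (-Complex.exp ℓ) ^ ((a f : ℕ) : ℤ)) := by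
          intro f
          rw [← zpow_add₀ (neg_ne_zero.2 (Complex.exp_ne_zero ℓ)), neg_add_eq_sub,
            ← neg_mul_ell_inv _ (mul_ne_zero hx (inv_ne_zero (uSq_ne_zero η σ k' f)))
            (Complex.exp_ne_zero ℓ), mul_inv, inv_inv]
        have e4 : ∏ f, (-Complex.exp ℓ) ^ (-((a (f + 1) : ℕ) : ℤ)) =
            ∏ f, (-Complex.exp ℓ) ^ (-((a f : ℕ) : ℤ)) :=
          Equiv.prod_comp (nextPerm F) fun f => (-Complex.exp ℓ) ^ (-((a f : ℕ) : ℤ))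
        rw [Finset.prod_congr rfl fun f _ => e2 f, Finset.prod_mul_distrib,
          Finset.prod_mul_distrib, e4, ← Finset.prod_mul_distrib]
        have e3 : ∀ f, (-Complex.exp ℓ) ^ (-((a f : ℕ) : ℤ)) * (-Complex.exp ℓ) ^ ((a f : ℕ) : ℤ) =
            1 := by
          intro f
          rw [← zpow_add₀ (neg_ne_zero.2 (Complex.exp_ne_zero ℓ)), neg_add_cancel, zpow_zero]
        rw [Finset.prod_congr rfl fun f _ => e3 f, Finset.prod_const_one, mul_one]
      simp only [← h2, ← mul_ite_zero, ← Finset.mul_sum]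
      field_simp
    rw [Finset.sum_congr rfl fun j _ => h1 j, sum_preds]
    have h2 := kernel_baxter (Complex.exp ℓ) (-1) (isTransitive_nextPerm F).symm hq0 hq1
      (fun f => x * (uSq η σ k' f)⁻¹) (k' - k)
    have h3 : (∏ f, -(Complex.exp ℓ * (x * (uSq η σ k' f)⁻¹))) =
        (-(Complex.exp ℓ * x)) ^ F * (uSqProd η σ k')⁻¹ := by
      simp only [← mul_assoc, ← neg_mul]
      rw [Finset.prod_mul_distrib, Finset.prod_const, Finset.card_univ, Fintype.card_fin, uSqProd,
        Finset.prod_inv_distrib]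
    rw [h3] at h2
    have ht0 : ∀ j, entry (tBar F η ℓ σ 0) k' j = if k' = j then (uSqProd η σ k')⁻¹ else 0 := by
      intro j
      rw [entry_tBar_eq, Nat.sub_zero, tCoeff_top, entry_one, mul_ite, mul_one, mul_zero]
    simp only [ht0, ite_mul, zero_mul, Finset.sum_ite_eq, self_mem_preds, if_true]
    rw [minusKernel, minusKernel]
    have h6 : (fun f => Complex.exp η * x * (uSq η σ k' f)⁻¹) =
        fun f => Complex.exp η * (x * (uSq η σ k' f)⁻¹) := funext fun f => mul_assoc _ _ _
    have h7 : (fun f => (Complex.exp η)⁻¹ * x * (uSq η σ k' f)⁻¹) =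
        fun f => x * (uSq η σ k' f)⁻¹ / Complex.exp η := funext fun f => by
      rw [div_eq_mul_inv]; ring
    rw [h6, h7]
    have h8 : ∀ (g A B C D : ℂ), A * (C * (g * B)) + g * D = g * (A * C * B + D) := by
      intros; ring
    rw [h8, ← h2, Finset.mul_sum]
    -- Rotating the labels by one site matches the transposed weights, with labels (a_{f+1}, a_f),
    -- to those of the reversed chain, with labels (a_f, a_{f−1}).
    refine Fintype.sum_equiv ((nextPerm F).symm.arrowCongr (Equiv.refl (Fin 2))) _ _ fun a => ?_
    have h9 : ∀ f, ((nextPerm F).symm.arrowCongr (Equiv.refl (Fin 2))) a f = a (f + 1) :=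
      fun f => rfl
    have h10 : ∀ f, (nextPerm F).symm f + 1 = f := fun f => (nextPerm F).apply_symm_apply f
    simp only [h9, h10]
    have h4 : k' - fwd (fun f => (a f : ℕ)) - k = fun f =>
        (k' - k) f - (-1) * ((a f : ℕ) - (a (f + 1) : ℕ) : ℤ) := by
      funext f
      simp only [Pi.sub_apply, fwd]
      ring
    have h5 : (fun f => x * (uSq η σ (k' - fwd fun f => (a f : ℕ)) f)⁻¹) =
        fun f => x * (uSq η σ k' f)⁻¹ *
          Complex.exp η ^ (-((a f : ℕ) - (a (f + 1) : ℕ) : ℤ)) := by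
      funext f
      rw [uSq_sub, mul_inv, ← zpow_neg, mul_assoc, neg_neg, neg_sub]
      rfl
    rw [h4, h5, mul_left_comm]

end Chain

end RelToda

/-! ### Local forms of Q_± and traces over auxiliary spaces -/

namespace RelToda

/-! ### Local forms of the `Q`-operators -/

section LocalForms

variable {F : ℕ}

theorem hasSum_formalOp {ι : Type*} {f : ι → FormalOp F} {A : FormalOp F} :
    HasSum f A ↔ ∀ k' k, HasSum (fun i => f i k' k) (A k' k) := by
  have h := Pi.hasSum (f := fun i k' => f i k') (g := fun k' => A k') (L := .unconditional ι)
  refine h.trans (forall_congr' fun k' => ?_)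
  exact Pi.hasSum

variable (η ℓ : ℂ) (σ : Fin F → ℂ) (θ : ℂ)

theorem exp_sVal (k : Fin F → ℤ) (f : Fin F) :
    Complex.exp (η * sVal σ θ k f) = Complex.exp (η * θ) * uSq η σ k f := by
  rw [uSq, ← Complex.exp_add, sVal]
  congr 1
  ring

theorem exp_neg_sVal (k : Fin F → ℤ) (f : Fin F) :
    Complex.exp (-(η * sVal σ θ k f)) = Complex.exp (-(η * θ)) * (uSq η σ k f)⁻¹ := by
  rw [Complex.exp_neg, exp_sVal, mul_inv, Complex.exp_neg]

theorem entry_diagOp_mul_uvMonomial (c : (Fin F → ℤ) → ℂ) (m k' k : Fin F → ℤ) :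
    entry (diagOp c * (uvMonomial η σ m).val) k' k =
      if k' = k + m then c k' * (gauge η σ k' / gauge η σ k) else 0 := by
  rw [uvMonomial_eq, weylShift_val, diagOp_mul_monoOp, entry_monoOp]
  split_ifs with h
  · rw [h, add_sub_cancel_right]
  · rfl

variable [NeZero F]

theorem compat_nextPerm (k' k : Fin F → ℤ) (n : Fin F → ℕ) :
    Compat (nextPerm F) 1 (k' - k) n ↔ k' = k + fwd n := by
  rw [funext_iff]
  refine forall_congr' fun f => ?_
  simp only [Pi.sub_apply, Pi.add_apply, fwd, nextPerm, Equiv.coe_addRight]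
  constructor <;> intro h <;> linarith

theorem nextPerm_symm_apply (f : Fin F) : (nextPerm F).symm f = f - 1 := by
  rw [Equiv.symm_apply_eq]
  exact (sub_add_cancel f 1).symm

theorem compat_nextPerm_symm (k' k : Fin F → ℤ) (n : Fin F → ℕ) :
    Compat (nextPerm F).symm (-1) (k' - k) n ↔ k' = k + fun f => (n f : ℤ) - n (f - 1) := by
  rw [funext_iff]
  refine forall_congr' fun f => ?_
  simp only [Pi.sub_apply, Pi.add_apply, nextPerm_symm_apply]
  constructor <;> intro h <;> linarith

theorem entry_localPlus {η : ℂ} (hη : η.re < 0) (n : Fin F → ℕ) (k' k : Fin F → ℤ) :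
    entry (localPlus η ℓ σ θ n) k' k = gauge η σ k' / gauge η σ k *
      kernelTerm (Complex.exp η) (Complex.exp ℓ) (nextPerm F) 1
        (fun f => Complex.exp (η * θ) * uSq η σ k' f) (k' - k) n := by
  rw [localPlus, entry_diagOp_mul_uvMonomial, kernelTerm]
  simp only [compat_nextPerm, gFun_plus hη, exp_sVal]
  change (if k' = k + fwd n then _ else _) = _
  split_ifs
  · ring
  · rw [mul_zero]

theorem entry_localMinus {η : ℂ} (hη : η.re < 0) (n : Fin F → ℕ) (k' k : Fin F → ℤ) :
    entry (localMinus η ℓ σ θ n) k' k = Complex.exp (-(ℓ * ∑ f, sVal σ θ k' f)) *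
      (gauge η σ k' / gauge η σ k *
      kernelTerm (Complex.exp η) (Complex.exp ℓ) (nextPerm F).symm (-1)
        (fun f => Complex.exp (-(η * θ)) * (uSq η σ k' f)⁻¹) (k' - k) n) := by
  rw [localMinus, entry_diagOp_mul_uvMonomial, kernelTerm]
  simp only [compat_nextPerm_symm, gFun_minus hη, exp_neg_sVal η]
  rw [Finset.prod_mul_distrib, ← Complex.exp_sum, Finset.sum_neg_distrib, ← Finset.mul_sum]
  split_ifs
  · ring
  · rw [mul_zero, mul_zero]

theorem hasSum_qPlusTerm {η : ℂ} (hη : η.re < 0) : HasSum (qPlusTerm F η ℓ σ θ)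
    (fun k' k => plusKernel η ℓ σ (Complex.exp (η * θ)) k' k) :=
  hasSum_formalOp.2 fun k' k => hasSum_plusKernel ℓ σ hη _ k' k

theorem qPlus_apply {η : ℂ} (hη : η.re < 0) (k' k : Fin F → ℤ) :
    qPlus F η ℓ σ θ k' k = plusKernel η ℓ σ (Complex.exp (η * θ)) k' k :=
  congrFun (congrFun (hasSum_qPlusTerm ℓ σ θ hη).tsum_eq k') k

theorem hasSum_localPlus {η : ℂ} (hη : η.re < 0) :
    HasSum (fun n : Fin F → ℕ => toFormal (localPlus η ℓ σ θ n)) (qPlus F η ℓ σ θ) := by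
  refine hasSum_formalOp.2 fun k' k => ?_
  rw [qPlus_apply ℓ σ θ hη]
  refine ((hasSum_kernel (Complex.exp ℓ) (nextPerm F) 1 (norm_exp_lt_one hη) _ _).mul_left
    (gauge η σ k' / gauge η σ k)).congr_fun fun n => entry_localPlus ℓ σ θ hη n k' k

theorem hasSum_qMinusTerm {η : ℂ} (hη : η.re < 0) : HasSum (qMinusTerm F η ℓ σ θ)
    (fun k' k => Complex.exp (-(ℓ * ∑ f, sVal σ θ k' f)) *
      minusKernel η ℓ σ (Complex.exp (-(η * θ))) k' k) := by
  refine hasSum_formalOp.2 fun k' k => ?_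
  refine ((hasSum_minusKernel ℓ σ hη (Complex.exp (-(η * θ))) k' k).mul_left
    (Complex.exp (-(ℓ * ∑ f, sVal σ θ k' f)))).congr_fun fun N => ?_
  change Complex.exp (-(η * θ)) ^ N * entry (diagOp _ * _) k' k = _
  rw [diagOp_eq_monoOp, entry_monoOp_mul, sub_zero, mul_left_comm]

theorem qMinus_apply {η : ℂ} (hη : η.re < 0) (k' k : Fin F → ℤ) :
    qMinus F η ℓ σ θ k' k = Complex.exp (-(ℓ * ∑ f, sVal σ θ k' f)) *
      minusKernel η ℓ σ (Complex.exp (-(η * θ))) k' k :=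
  congrFun (congrFun (hasSum_qMinusTerm ℓ σ θ hη).tsum_eq k') k

theorem hasSum_localMinus {η : ℂ} (hη : η.re < 0) :
    HasSum (fun n : Fin F → ℕ => toFormal (localMinus η ℓ σ θ n)) (qMinus F η ℓ σ θ) := by
  refine hasSum_formalOp.2 fun k' k => ?_
  rw [qMinus_apply ℓ σ θ hη]
  exact (((hasSum_kernel (Complex.exp ℓ) (nextPerm F).symm (-1) (norm_exp_lt_one hη) _ _).mul_left
    (gauge η σ k' / gauge η σ k)).mul_left _).congr_fun
      fun n => entry_localMinus ℓ σ θ hη n k' k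

end LocalForms

/-! ### The trace over the `q`-oscillator space -/

section Oscillator

theorem oscA_pow_single (n N : ℕ) : (oscA ^ n) (Finsupp.single N 1) =
    if n ≤ N then Finsupp.single (N - n) 1 else 0 := by
  induction n with
  | zero => simp
  | succ n ih =>
    rw [pow_succ', Module.End.mul_apply, ih]
    split_ifs with h1 h2 h2
    · rw [oscA, Finsupp.linearCombination_single, one_smul, if_neg (by omega), Nat.sub_sub]
    · rw [oscA, Finsupp.linearCombination_single, one_smul, if_pos (by omega)]
    · omega
    · exact map_zero _

theorem oscAdag_pow_single (η ℓ : ℂ) (n N : ℕ) : (oscAdag η ℓ ^ n) (Finsupp.single N 1) =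
    Finsupp.single (N + n) (∏ i ∈ Finset.range n, bracket η ℓ (N + i + 1)) := by
  induction n with
  | zero => simp
  | succ n ih =>
    rw [pow_succ', Module.End.mul_apply, ih, oscAdag, Finsupp.linearCombination_single,
      Finsupp.smul_single, smul_eq_mul, Finset.prod_range_succ]
    rfl

variable {F : ℕ} (η ℓ : ℂ) (σ : Fin F → ℂ) (θ : ℂ)

/-- The `m`-th power of `x u_f v_f`. -/
noncomputable def xuvPow (f : Fin F) (m : ℤ) : Op F :=
  Complex.exp (η * θ / 2) ^ m • (uvOp η σ f ^ m : (Op F)ˣ).val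

theorem xuvPow_add (f : Fin F) (m m' : ℤ) :
    xuvPow η σ θ f m * xuvPow η σ θ f m' = xuvPow η σ θ f (m + m') := by
  rw [xuvPow, xuvPow, xuvPow, smul_mul_smul_comm, ← zpow_add₀ (Complex.exp_ne_zero _), zpow_add,
    Units.val_mul]

theorem xuvPow_natCast (f : Fin F) (n : ℕ) :
    (Complex.exp (η * θ / 2) • (uvOp η σ f : Op F)) ^ n = xuvPow η σ θ f n := by
  rw [xuvPow, smul_pow, zpow_natCast, zpow_natCast, Units.val_pow_eq_pow_val]

theorem xuvPow_zero (f : Fin F) : xuvPow η σ θ f 0 = 1 := by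
  rw [xuvPow, zpow_zero, one_smul, zpow_zero, Units.val_one]

theorem xuvPow_eq_monoOp (f : Fin F) (m : ℤ) : xuvPow η σ θ f m =
    monoOp (fun k => Complex.exp (η * θ / 2) ^ m *
      (siteGauge η σ f (k f) / siteGauge η σ f (k f - m))) (Pi.single f m) := by
  rw [xuvPow, uvOp_zpow, weylShift_single, smul_monoOp]

/-- The constants in [N] are made for this identity: a creation operator accompanied by λxuv⁻¹ acts
as one inverse power of xuv and lowers the occupation number in g by one. -/
theorem mul_oscG_succ {η : ℂ} (hη : η.re < 0) (f : Fin F) (N : ℕ) :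
    bracket η ℓ (N + 1) • (((Complex.exp ℓ * Complex.exp (η * θ / 2)) •
      (uOp η σ f * (vOp f)⁻¹ : (Op F)ˣ).val) * oscG η ℓ σ θ f (N + 1)) =
    oscG η ℓ σ θ f N * xuvPow η σ θ f (-1) := by
  have huv : (uOp η σ f * (vOp f)⁻¹ : (Op F)ˣ).val =
      monoOp (fun k => Complex.exp (η * (σ f + k f) / 2)) (Pi.single f (-1)) := by
    rw [Pi.single_neg]
    rfl
  rw [huv, smul_monoOp, oscG, oscG, diagOp_eq_monoOp, monoOp_mul, smul_monoOp, add_zero,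
    xuvPow_eq_monoOp, diagOp_mul_monoOp]
  congr 1
  funext k
  rw [gFun_minus hη, gFun_minus hη]
  have hs : sVal σ θ (k - Pi.single f (-1)) f = sVal σ θ k f + 1 := by
    simp only [sVal, Pi.sub_apply, Pi.single_eq_same]
    push_cast
    ring
  have hG := mul_localG_mul (Complex.exp ℓ) (Complex.exp_ne_zero η) (norm_exp_lt_one hη) N
    (Complex.exp (-(η * (sVal σ θ k f + 1))))
  have e1 : Complex.exp η * Complex.exp (-(η * (sVal σ θ k f + 1))) =
      Complex.exp (-(η * sVal σ θ k f)) := by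
    rw [← Complex.exp_add]; congr 1; ring
  have e2 : Complex.exp (-(η * ((N + 1 : ℕ) : ℂ))) = (Complex.exp η ^ (N + 1))⁻¹ := by
    rw [Complex.exp_neg, mul_comm η, Complex.exp_nat_mul]
  rw [e1] at hG
  rw [hs, bracket, e2, siteGauge, siteGauge, zpow_neg_one, ← Complex.exp_neg, ← Complex.exp_sub]
  set G0 := localG (Complex.exp η) (Complex.exp ℓ) N (Complex.exp (-(η * sVal σ θ k f)))
  set G1 := localG (Complex.exp η) (Complex.exp ℓ) (N + 1)
    (Complex.exp (-(η * (sVal σ θ k f + 1))))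
  have e4 : -Complex.exp (η / 2) * Complex.exp (-ℓ) * (1 - (Complex.exp η ^ (N + 1))⁻¹) *
      (Complex.exp ℓ * Complex.exp (η * θ / 2) * Complex.exp (η * (σ f + k f) / 2) *
        (Complex.exp (-(ℓ * (sVal σ θ k f + 1))) * G1)) =
      Complex.exp (η / 2) * Complex.exp (-ℓ) * Complex.exp ℓ * Complex.exp (η * θ / 2) *
        Complex.exp (η * (σ f + k f) / 2) * Complex.exp (-(ℓ * (sVal σ θ k f + 1))) *
        (((Complex.exp η ^ (N + 1))⁻¹ - 1) * G1) := by ring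
  rw [e4, ← hG]
  have e5 : Complex.exp (η / 2) * Complex.exp (-ℓ) * Complex.exp ℓ * Complex.exp (η * θ / 2) *
        Complex.exp (η * (σ f + k f) / 2) * Complex.exp (-(ℓ * (sVal σ θ k f + 1))) *
        (Complex.exp ℓ * Complex.exp (-(η * (sVal σ θ k f + 1))) * G0) =
      (Complex.exp (η / 2) * Complex.exp (-ℓ) * Complex.exp ℓ * Complex.exp (η * θ / 2) *
        Complex.exp (η * (σ f + k f) / 2) * Complex.exp (-(ℓ * (sVal σ θ k f + 1))) *
        Complex.exp ℓ * Complex.exp (-(η * (sVal σ θ k f + 1)))) * G0 := by ring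
  have e6 : ∀ A B C : ℂ, A * G0 * (B * C) = (A * B * C) * G0 := by intros; ring
  rw [e5, e6]
  congr 1
  simp only [← Complex.exp_add]
  congr 1
  rw [sVal]
  push_cast
  ring

theorem pow_mul_oscG {η : ℂ} (hη : η.re < 0) (f : Fin F) (N n : ℕ) :
    (∏ i ∈ Finset.range n, bracket η ℓ (N + i + 1)) •
      (((Complex.exp ℓ * Complex.exp (η * θ / 2)) •
      (uOp η σ f * (vOp f)⁻¹ : (Op F)ˣ).val) ^ n * oscG η ℓ σ θ f (N + n)) =
    oscG η ℓ σ θ f N * xuvPow η σ θ f (-n) := by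
  induction n with
  | zero => simp [xuvPow_zero]
  | succ n ih =>
    rw [Finset.prod_range_succ, mul_smul, pow_succ, mul_assoc, ← mul_smul_comm]
    have h := mul_oscG_succ ℓ σ θ hη f (N + n)
    rw [add_assoc] at h
    rw [add_assoc] at *
    rw [h, ← mul_assoc, ← smul_mul_assoc, ih, mul_assoc, xuvPow_add]
    congr 2
    push_cast
    ring

/-- For given N and N' exactly one of the terms of M contributes, and `pow_mul_oscG` brings the
creation terms to the same form as the annihilation terms, with a negative exponent. -/
theorem oscM_eq {η : ℂ} (hη : η.re < 0) (f : Fin F) (N' N : ℕ) :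
    oscM η ℓ σ θ f N' N = oscG η ℓ σ θ f N * xuvPow η σ θ f ((N : ℤ) - N') := by
  rw [oscM]
  rcases lt_trichotomy N' N with h | h | h
  · rw [if_neg h.ne, finsum_eq_single _ (N - N' - 1), finsum_eq_zero_of_forall_eq_zero, zero_add,
      add_zero, oscA_pow_single, show N - N' - 1 + 1 = N - N' by omega, if_pos (Nat.sub_le _ _),
      show N - (N - N') = N' by omega, Finsupp.single_eq_same, one_smul, xuvPow_natCast,
      Nat.cast_sub h.le]
    · intro n
      rw [oscAdag_pow_single, Finsupp.single_eq_of_ne (by omega), zero_smul]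
    · intro n hn
      rw [oscA_pow_single]
      split_ifs
      · rw [Finsupp.single_eq_of_ne (by omega), zero_smul]
      · rw [Finsupp.zero_apply, zero_smul]
  · subst h
    rw [if_pos rfl, finsum_eq_zero_of_forall_eq_zero, finsum_eq_zero_of_forall_eq_zero, add_zero,
      add_zero, sub_self, xuvPow_zero, mul_one]
    · intro n
      rw [oscAdag_pow_single, Finsupp.single_eq_of_ne (by omega), zero_smul]
    · intro n
      rw [oscA_pow_single]
      split_ifs
      · rw [Finsupp.single_eq_of_ne (by omega), zero_smul]
      · rw [Finsupp.zero_apply, zero_smul]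
  · rw [if_neg h.ne', finsum_eq_zero_of_forall_eq_zero, finsum_eq_single _ (N' - N - 1), zero_add,
      zero_add, show N' - N - 1 + 1 = N' - N by omega, oscAdag_pow_single,
      show N + (N' - N) = N' by omega, Finsupp.single_eq_same]
    · have := pow_mul_oscG ℓ σ θ hη f N (N' - N)
      rw [show N + (N' - N) = N' by omega, Nat.cast_sub h.le, neg_sub] at this
      exact this
    · intro n hn
      rw [oscAdag_pow_single, Finsupp.single_eq_of_ne (by omega), zero_smul]
    · intro n
      rw [oscA_pow_single]
      split_ifs
      · rw [Finsupp.single_eq_of_ne (by omega), zero_smul]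
      · rw [Finsupp.zero_apply, zero_smul]

theorem prod_zpow_eq_zpow_sum {ι : Type*} [Fintype ι] {x : ℂ} (hx : x ≠ 0) (m : ι → ℤ) :
    ∏ i, x ^ m i = x ^ ∑ i, m i := by
  classical
  induction (Finset.univ : Finset ι) using Finset.induction_on with
  | empty => simp
  | insert i s hi ih => rw [Finset.prod_insert hi, Finset.sum_insert hi, zpow_add₀ hx, ih]

/-- The exponents n_f − n_{f−1} sum to zero round the cycle, so the powers of x cancel. -/
theorem oscTraceTerm_eq [NeZero F] {η : ℂ} (hη : η.re < 0) (n : Fin F → ℕ) :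
    oscTraceTerm η ℓ σ θ n = localMinus η ℓ σ θ n := by
  have h : ∀ f, oscM η ℓ σ θ f (n (f - 1)) (n f) = monoOp (fun k =>
      (fun (f : Fin F) (κ : ℤ) => gFun η 0 ℓ (n f) (n f - (θ + σ f + κ)) *
        (Complex.exp (η * θ / 2) ^ ((n f : ℤ) - n (f - 1)) *
        (siteGauge η σ f κ / siteGauge η σ f (κ - ((n f : ℤ) - n (f - 1)))))) f (k f))
      (Pi.single f ((fun f => (n f : ℤ) - n (f - 1)) f)) := by
    intro f
    rw [oscM_eq ℓ σ θ hη, oscG, xuvPow_eq_monoOp, diagOp_mul_monoOp]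
    rfl
  rw [oscTraceTerm, funext h, prod_ofFn_monoOp (fun (f : Fin F) (κ : ℤ) =>
    gFun η 0 ℓ (n f) (n f - (θ + σ f + κ)) *
        (Complex.exp (η * θ / 2) ^ ((n f : ℤ) - n (f - 1)) *
        (siteGauge η σ f κ / siteGauge η σ f (κ - ((n f : ℤ) - n (f - 1)))))),
    localMinus, uvMonomial_eq, weylShift_val, diagOp_mul_monoOp]
  congr 1
  funext k
  have h0 : ∑ f, ((n f : ℤ) - n (f - 1)) = 0 := by
    rw [Finset.sum_sub_distrib, sub_eq_zero]
    refine (Equiv.sum_comp (nextPerm F).symm fun f => (n f : ℤ)).symm.trans ?_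
    simp only [nextPerm_symm_apply]
  have h1 : ∏ f, Complex.exp (η * θ / 2) ^ ((n f : ℤ) - n (f - 1)) = 1 := by
    rw [prod_zpow_eq_zpow_sum (Complex.exp_ne_zero _), h0, zpow_zero]
  rw [Finset.prod_mul_distrib, Finset.prod_mul_distrib, h1, one_mul, gauge_div]
  rfl

end Oscillator

end RelToda

namespace RelToda

/-! ### The trace with the permutation extracted -/

section Permutation

variable {F : ℕ}

theorem liftOp_monoOp_single (c : (Fin F → ℤ) → ℂ) (m : Fin F → ℤ) (κ : ℤ) (k : Fin F → ℤ)
    (x : ℂ) : liftOp (monoOp c m) (Finsupp.single (κ, k) x) =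
      Finsupp.single (κ, k + m) (x * c (k + m)) := by
  rw [liftOp, Finsupp.linearCombination_single, monoOp_single, Finsupp.mapDomain_single,
    Finsupp.smul_single, smul_eq_mul, one_mul]

theorem permOp_single (f : Fin F) (κ : ℤ) (k : Fin F → ℤ) (x : ℂ) :
    permOp f (Finsupp.single (κ, k) x) = Finsupp.single (k f, Function.update k f κ) x := by
  rw [permOp, Finsupp.linearCombination_single, Finsupp.smul_single, smul_eq_mul, mul_one]

variable (η ℓ : ℂ) (σ : Fin F → ℂ) (θ : ℂ)

/-- The matrix element of a term of `M_f` between `|κ; k_f⟩` and `|k_f + n; κ - n⟩`. -/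
noncomputable def permWeight (f : Fin F) (n : ℕ) (κ κ' : ℤ) : ℂ :=
  siteGauge η σ f (κ' + n) / siteGauge η σ f κ' *
    (siteGauge η σ f (κ - n) / siteGauge η σ f κ) * gFun η 0 ℓ (n + (θ + σ f + (κ - n : ℤ))) n

theorem permMTerm_single (f : Fin F) (n : ℕ) (κ : ℤ) (k : Fin F → ℤ) (x : ℂ) :
    permMTerm η ℓ σ θ f n (Finsupp.single (κ, k) x) =
      Finsupp.single (k f + n, Function.update k f (κ - n))
        (x * permWeight η ℓ σ θ f n κ (k f)) := by
  have hu : Function.update (k + Pi.single f (n : ℤ)) f κ + Pi.single f (-(n : ℤ)) =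
      Function.update k f (κ - n) := by
    funext g
    rcases eq_or_ne g f with rfl | h
    · simp [sub_eq_add_neg]
    · simp [h]
  rw [permMTerm, uvOp_zpow, uvOp_zpow, weylShift_single, weylShift_single, diagOp_eq_monoOp,
    Module.End.mul_apply, Module.End.mul_apply, Module.End.mul_apply, liftOp_monoOp_single,
    permOp_single, liftOp_monoOp_single, hu, liftOp_monoOp_single, add_zero]
  simp only [Pi.add_apply, Pi.single_eq_same, Function.update_self, sVal, permWeight]
  congr 1
  rw [show κ - (n : ℤ) - -(n : ℤ) = κ by ring, add_sub_cancel_right]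
  ring

/-- The factors act from the last site downwards. At site i the auxiliary label is a_{i+1}; the site
receives a_{i+1} − n_i and the auxiliary space receives a_i = k_i + n_i, starting from a_F = κ. The
induction is on the number j of factors already applied. -/
theorem prod_permMTerm_single (n : Fin F → ℕ) (κ : ℤ) (k : Fin F → ℤ) (a : ℕ → ℤ)
    (ha : ∀ f : Fin F, a f = k f + n f) (haF : a F = κ) (j i : ℕ) (hij : i + j = F) :
    ((List.ofFn fun f => permMTerm η ℓ σ θ f (n f)).drop i).prod (Finsupp.single (κ, k) 1) =
      Finsupp.single (a i, fun f : Fin F => if i ≤ f then a (f + 1) - n f else k f)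
        (∏ f : Fin F, if i ≤ f then permWeight η ℓ σ θ f (n f) (a (f + 1)) (k f) else 1) := by
  induction j generalizing i with
  | zero =>
    rw [add_zero] at hij
    subst hij
    have h : ∀ f : Fin i, ¬ i ≤ (f : ℕ) := fun f => not_le.2 f.2
    rw [List.drop_of_length_le (by simp), List.prod_nil, Module.End.one_apply, haF]
    simp only [h, if_false, Finset.prod_const_one]
  | succ j ih =>
    have hi : i < F := by omega
    have hlen : i < (List.ofFn fun f => permMTerm η ℓ σ θ f (n f)).length := by simpa using hi
    rw [List.drop_eq_getElem_cons hlen, List.prod_cons, Module.End.mul_apply, ih (i + 1) (by omega),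
      List.getElem_ofFn, permMTerm_single]
    have h1 : ¬ i + 1 ≤ ((⟨i, hi⟩ : Fin F) : ℕ) := by simp
    congr 1
    · refine Prod.ext ?_ (funext fun f => ?_)
      · rw [if_neg h1, ← ha]
      · rcases eq_or_ne f ⟨i, hi⟩ with rfl | hf
        · simp
        · have hne : (f : ℕ) ≠ i := fun h => hf (Fin.ext h)
          simp only [Function.update_of_ne hf]
          by_cases h : i ≤ (f : ℕ)
          · rw [if_pos h, if_pos (by omega)]
          · rw [if_neg h, if_neg (by omega)]
    · rw [if_neg h1, ← Finset.prod_erase_mul _ _ (Finset.mem_univ (⟨i, hi⟩ : Fin F)), if_neg h1,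
        ← Finset.prod_erase_mul Finset.univ (fun f : Fin F => if i ≤ f then _ else _)
          (Finset.mem_univ (⟨i, hi⟩ : Fin F)), mul_one, if_pos le_rfl]
      congr 1
      refine Finset.prod_congr rfl fun f hf => ?_
      have hne : (f : ℕ) ≠ i := fun h => (Finset.mem_erase.1 hf).1 (Fin.ext h)
      by_cases h : i ≤ (f : ℕ)
      · rw [if_pos h, if_pos (by omega)]
      · rw [if_neg h, if_neg (by omega)]

variable [NeZero F]

/-- The rotated sequence `f ↦ k_{f+1}`. -/
def rot {M : Type*} (k : Fin F → M) : Fin F → M := fun f => k (f + 1)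

theorem gauge_rot (ς : ℂ) (k : Fin F → ℤ) :
    gauge η (fun _ => ς) (rot k) = gauge η (fun _ => ς) k :=
  Equiv.prod_comp (nextPerm F) fun f => siteGauge η (fun _ : Fin F => ς) f (k f)

/-- Closing the trace forces κ = k_0 + n_0. Then site f ends with k_{f+1} + n_{f+1} − n_f, the
rotated state shifted by `fwd n`. -/
theorem permTraceTerm_eq (ς : ℂ) (n : Fin F → ℕ) (κ : ℤ) (k' k : Fin F → ℤ) :
    permTraceTerm η ℓ (fun _ => ς) θ (n, κ) k' k =
      if κ = k 0 + n 0 then entry (localPlus η ℓ (fun _ => ς) θ n) k' (rot k) else 0 := by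
  set a : ℕ → ℤ := fun i => if h : i < F then k ⟨i, h⟩ + n ⟨i, h⟩ else κ with ha
  have h := prod_permMTerm_single η ℓ (fun _ => ς) θ n κ k a
    (fun f => by simp [ha]) (by simp [ha]) F 0 (zero_add F)
  rw [List.drop_zero] at h
  simp only [Nat.zero_le, if_true] at h
  have ha0 : a 0 = k 0 + n 0 := by
    simp only [ha, dif_pos (Nat.pos_of_ne_zero (NeZero.ne F))]
    rfl
  change (List.ofFn fun f => permMTerm η ℓ (fun _ => ς) θ f (n f)).prod
    (Finsupp.single (κ, k) 1) (κ, k') = _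
  rw [h, ha0, Finsupp.single_apply]
  by_cases h2 : κ = k 0 + n 0
  swap
  · rw [if_neg h2, if_neg fun h3 => h2 (Prod.ext_iff.1 h3).1.symm]
  have hstep : ∀ f : Fin F, a (f + 1) = k (f + 1) + n (f + 1) := by
    intro f
    by_cases hf : (f : ℕ) + 1 < F
    · have : (⟨(f : ℕ) + 1, hf⟩ : Fin F) = f + 1 := by
        refine Fin.ext ?_
        rw [Fin.val_add_one_of_lt']
        exact hf
      simp only [ha, dif_pos hf, this]
    · have : f + 1 = 0 := by
        refine Fin.ext ?_
        rw [Fin.val_add, Fin.val_zero]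
        have h3 : (f : ℕ) + 1 = F := by have := f.2; omega
        rcases Nat.lt_or_ge 1 F with h4 | h4
        · rw [Fin.val_one', Nat.mod_eq_of_lt h4, h3, Nat.mod_self]
        · have : F = 1 := by have := f.2; omega
          subst this
          omega
      simp only [ha, dif_neg hf, this]
      exact h2
  have hsite : (fun f : Fin F => a (f + 1) - n f) = rot k + fwd n := by
    funext f
    rw [hstep, Pi.add_apply, rot, fwd]
    ring
  rw [if_pos h2, hsite, localPlus, entry_diagOp_mul_uvMonomial]
  change _ = if k' = rot k + fwd n then _ else _
  by_cases h3 : k' = rot k + fwd n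
  swap
  · rw [if_neg h3, if_neg fun h4 => h3 (Prod.ext_iff.1 h4).2.symm]
  rw [if_pos h3, if_pos (Prod.ext h2.symm h3.symm), gauge_rot]
  have hk : ∀ f : Fin F, a (f + 1) - n f = k' f := fun f => by
    rw [h3, ← hsite]
  simp only [permWeight, hk]
  have hs : ∀ f g κ, siteGauge η (fun _ : Fin F => ς) f κ = siteGauge η (fun _ : Fin F => ς) g κ :=
    fun _ _ _ => rfl
  -- Since all σ_f are equal, the gauge factors at neighbouring sites are the same function and the
  -- product may be rotated.
  have h5 : ∏ f : Fin F, siteGauge η (fun _ : Fin F => ς) f (a (f + 1)) =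
      ∏ f : Fin F, siteGauge η (fun _ : Fin F => ς) f (k f + n f) := by
    rw [← Equiv.prod_comp (nextPerm F) fun f =>
      siteGauge η (fun _ : Fin F => ς) f (k f + n f)]
    refine Finset.prod_congr rfl fun f _ => ?_
    rw [hstep, hs _ (nextPerm F f)]
    rfl
  have h6 : ∏ f : Fin F, siteGauge η (fun _ : Fin F => ς) f (k f + n f) ≠ 0 :=
    Finset.prod_ne_zero_iff.2 fun f _ => siteGauge_ne_zero _ _ _ _
  rw [Finset.prod_mul_distrib, Finset.prod_mul_distrib, Finset.prod_div_distrib,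
    Finset.prod_div_distrib, h5, gauge, gauge]
  simp only [sVal]
  field_simp

theorem kernel_rot (q lam : ℂ) (ε : ℤ) (W : Fin F → ℂ) (m : Fin F → ℤ) :
    kernel q lam (nextPerm F) ε (rot W) (rot m) = kernel q lam (nextPerm F) ε W m := by
  refine ((Equiv.arrowCongr (nextPerm F).symm (Equiv.refl ℕ)).tsum_eq _).symm.trans
    (tsum_congr fun n => ?_)
  have h : Compat (nextPerm F) ε (rot m)
      (Equiv.arrowCongr (nextPerm F).symm (Equiv.refl ℕ) n) ↔ Compat (nextPerm F) ε m n :=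
    (nextPerm F).forall_congr_right (q := fun f => m f = ε * ((n (nextPerm F f) : ℤ) - n f))
  rw [kernelTerm, kernelTerm]
  simp only [h]
  split_ifs
  · exact Equiv.prod_comp (nextPerm F) fun f => localG q lam (n f) (W f)
  · rfl

theorem plusKernel_rot (ς x : ℂ) (k' k : Fin F → ℤ) :
    plusKernel η ℓ (fun _ => ς) x (rot k') (rot k) = plusKernel η ℓ (fun _ => ς) x k' k := by
  rw [plusKernel, plusKernel, gauge_rot, gauge_rot, ← kernel_rot _ _ _ (fun f => x * uSq η (fun _ => ς) k' f)]
  rfl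

theorem toFormal_cyclicShift (k' k : Fin F → ℤ) :
    toFormal (cyclicShift F) k' k = if k' = rot k then 1 else 0 := by
  change cyclicShift F (Finsupp.single k 1) k' = _
  rw [cyclicShift, Finsupp.linearCombination_single, one_smul, Finsupp.single_apply]
  change (if rot k = k' then _ else _) = _
  simp only [eq_comm]

theorem comp_cyclicShift (A : FormalOp F) (k' k : Fin F → ℤ) :
    A.comp (toFormal (cyclicShift F)) k' k = A k' (rot k) := by
  change ∑' j, A k' j * toFormal (cyclicShift F) j k = _
  rw [tsum_eq_single (rot k)]
  · rw [toFormal_cyclicShift, if_pos rfl, mul_one]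
  · intro j hj
    rw [toFormal_cyclicShift, if_neg hj, mul_zero]

theorem cyclicShift_comp (A : FormalOp F) (k' k : Fin F → ℤ) :
    (toFormal (cyclicShift F)).comp A (rot k') k = A k' k := by
  change ∑' j, toFormal (cyclicShift F) (rot k') j * A j k = _
  rw [tsum_eq_single k']
  · rw [toFormal_cyclicShift, if_pos rfl, one_mul]
  · intro j hj
    rw [toFormal_cyclicShift, if_neg, zero_mul]
    intro h
    refine hj (funext fun f => ?_)
    have := congrFun h (f - 1)
    simp only [rot, sub_add_cancel] at this
    exact this.symm

variable {η}

theorem cyclicShift_comp_qPlus (hη : η.re < 0) (ς : ℂ) :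
    (toFormal (cyclicShift F)).comp (qPlus F η ℓ (fun _ => ς) θ) =
      (qPlus F η ℓ (fun _ => ς) θ).comp (toFormal (cyclicShift F)) := by
  funext k' k
  obtain ⟨j, rfl⟩ : ∃ j, k' = rot j :=
    ⟨fun f => k' (f - 1), funext fun f => by rw [rot, add_sub_cancel_right]⟩
  rw [cyclicShift_comp, comp_cyclicShift, qPlus_apply ℓ _ θ hη, qPlus_apply ℓ _ θ hη,
    plusKernel_rot]

/-- For each n exactly one auxiliary basis vector contributes, so the sum over pairs is the sum over
n in the local form. -/
theorem hasSum_permTraceTerm (hη : η.re < 0) (ς : ℂ) :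
    HasSum (permTraceTerm η ℓ (fun _ => ς) θ)
      ((qPlus F η ℓ (fun _ => ς) θ).comp (toFormal (cyclicShift F))) := by
  refine hasSum_formalOp.2 fun k' k => ?_
  rw [comp_cyclicShift]
  have h := hasSum_formalOp.1 (hasSum_localPlus ℓ (fun _ => ς) θ hη) k' (rot k)
  have hinj : Function.Injective fun n : Fin F → ℕ => (n, k 0 + (n 0 : ℤ)) :=
    fun n n' h => (Prod.ext_iff.1 h).1
  refine (hinj.hasSum_iff ?_).1 (h.congr_fun fun n => ?_)
  · rintro ⟨n, κ⟩ hn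
    rw [permTraceTerm_eq, if_neg]
    rintro rfl
    exact hn ⟨n, rfl⟩
  · simp only [Function.comp]
    rw [permTraceTerm_eq, if_pos rfl]
    rfl

end Permutation

end RelToda

/-! ### The Wronskian: bounds, local identities and regrouping -/

namespace RelToda

/-! ### Products of the two `Q`-operators -/

section Products

variable {q : ℂ} (lam : ℂ)

theorem exists_norm_qPochInf_zpow_le (hq0 : q ≠ 0) (hq1 : ‖q‖ < 1) (a : ℂ) :
    ∃ C D : ℝ, 0 ≤ C ∧ 1 ≤ D ∧ (∀ m : ℕ, ‖qPochInf q (a * q ^ m)‖ ≤ C) ∧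
      ∀ m : ℕ, ‖qPochInf q (a * q ^ (-(m : ℤ)))‖ * ‖q‖ ^ (m * (m + 1) / 2) ≤ C * D ^ m := by
  obtain ⟨C, hC0, hC⟩ := exists_norm_qPochInf_le hq1 ‖a‖
  obtain ⟨C', D, hC0', hD, h⟩ := exists_norm_qPochInf_div_le hq0 hq1 a
  refine ⟨max C C', D, le_max_of_le_left hC0, hD, fun m => ?_, fun m => ?_⟩
  · refine (hC _ ?_).trans (le_max_left _ _)
    rw [norm_mul, norm_pow]
    exact mul_le_of_le_one_right (norm_nonneg _) (pow_le_one₀ (norm_nonneg _) hq1.le)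
  · rw [zpow_neg, zpow_natCast, ← div_eq_mul_inv]
    exact (h m).trans (mul_le_mul_of_nonneg_right (le_max_right _ _) (by positivity))

/-- The Gaussian decay of the exponential prefactor beats the growth of the `q`-Pochhammer symbol
at negative powers of `q`. -/
theorem exists_norm_gauss_le (hq0 : q ≠ 0) (hq1 : ‖q‖ < 1) (a : ℂ) :
    ∃ C R : ℝ, 0 ≤ C ∧ 0 ≤ R ∧ ∀ n p n' : ℕ,
      ‖q‖ ^ (n ^ 2) * ‖q‖ ^ (p ^ 2) * ‖q‖ ^ (((n' : ℤ) - n) * p) *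
        ‖qPochInf q (a * q ^ ((p : ℤ) + n' - n))‖ ≤
      C * (R ^ n * √‖q‖ ^ (n ^ 2)) * √‖q‖ ^ (p ^ 2) := by
  obtain ⟨C, D, hC0, hD, h1, h2⟩ := exists_norm_qPochInf_zpow_le hq0 hq1 a
  set r := √‖q‖ with hr
  have hqpos : 0 < ‖q‖ := norm_pos_iff.2 hq0
  have hr0 : 0 < r := Real.sqrt_pos.2 hqpos
  have hr1 : r ≤ 1 := Real.sqrt_le_one.2 hq1.le
  have hrq : ‖q‖ = r ^ (2 : ℤ) := by
    rw [zpow_ofNat, Real.sq_sqrt hqpos.le]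
  have hpow : ∀ e : ℕ, ‖q‖ ^ e = r ^ (2 * (e : ℤ)) := by
    intro e
    rw [zpow_mul, ← hrq, zpow_natCast]
  have hzpow : ∀ e : ℤ, ‖q‖ ^ e = r ^ (2 * e) := by
    intro e
    rw [zpow_mul, ← hrq]
  -- With r = √|q| the claim compares integer exponents of r, only half of the Gaussian decay being
  -- kept. The factor r⁻¹ in R produces the −n in the exponent n² + p² − n.
  refine ⟨C, D * r⁻¹, hC0, by positivity, fun n p n' => ?_⟩
  have hR : C * ((D * r⁻¹) ^ n * r ^ (n ^ 2)) * r ^ (p ^ 2) =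
      C * D ^ n * r ^ ((n : ℤ) ^ 2 + (p : ℤ) ^ 2 - n) := by
    rw [zpow_sub₀ hr0.ne', zpow_add₀ hr0.ne', mul_pow, inv_pow]
    norm_cast
    ring
  rw [hR, hpow, hpow, hzpow, ← zpow_add₀ hr0.ne', ← zpow_add₀ hr0.ne']
  have hDn : 1 ≤ D ^ n := one_le_pow₀ hD
  rcases le_or_gt (n : ℤ) (p + n') with hm | hm
  · obtain ⟨m, hm'⟩ : ∃ m : ℕ, (p : ℤ) + n' - n = m := Int.eq_ofNat_of_zero_le (by omega)
    have hE := h1 m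
    rw [hm', zpow_natCast]
    -- Here the argument of the infinite product stays bounded, and n² + p² + 2(n' − n)p = (n − p)²
    -- + 2n'p ≥ 0.
    have hexp : (n : ℤ) ^ 2 + (p : ℤ) ^ 2 - n ≤
        2 * ((n ^ 2 : ℕ) : ℤ) + 2 * ((p ^ 2 : ℕ) : ℤ) + 2 * (((n' : ℤ) - n) * p) := by
      push_cast
      rcases le_or_gt n n' with h | h
      · have : (0 : ℤ) ≤ ((n' : ℤ) - n) * p := by
          have : (n : ℤ) ≤ n' := by exact_mod_cast h
          exact mul_nonneg (by linarith) (by positivity)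
        nlinarith [sq_nonneg (n : ℤ), sq_nonneg (p : ℤ)]
      · have h3 : (0 : ℤ) ≤ (n' : ℤ) * p := by positivity
        nlinarith [sq_nonneg ((n : ℤ) - p), sq_nonneg (n : ℤ)]
    calc _ ≤ r ^ ((n : ℤ) ^ 2 + (p : ℤ) ^ 2 - n) * C := by
          refine mul_le_mul ?_ hE (norm_nonneg _) (by positivity)
          exact zpow_le_zpow_right_of_le_one₀ hr0 hr1 hexp
      _ ≤ _ := by
          rw [mul_comm]
          refine mul_le_mul_of_nonneg_right ?_ (by positivity)
          exact le_mul_of_one_le_right hC0 hDn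
  · obtain ⟨m, hm'⟩ : ∃ m : ℕ, (n : ℤ) - p - n' = m := Int.eq_ofNat_of_zero_le (by omega)
    have hE := h2 m
    have hmm : (((m * (m + 1) / 2 : ℕ) : ℤ)) * 2 = m * (m + 1) := by
      exact_mod_cast Nat.div_mul_cancel (Nat.even_mul_succ_self m).two_dvd
    rw [hpow] at hE
    rw [show (p : ℤ) + n' - n = -(m : ℤ) by rw [← hm']; ring]
    have hsplit : 2 * ((n ^ 2 : ℕ) : ℤ) + 2 * ((p ^ 2 : ℕ) : ℤ) + 2 * (((n' : ℤ) - n) * p) =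
        (2 * ((n ^ 2 : ℕ) : ℤ) + 2 * ((p ^ 2 : ℕ) : ℤ) + 2 * (((n' : ℤ) - n) * p) - m * (m + 1)) +
          2 * ((m * (m + 1) / 2 : ℕ) : ℤ) := by linarith
    -- The term m(m+1) pays for the growth at q^{-m}. With n = m + p + n' the right side exceeds the
    -- left by n'² + 2n'(m + p) + p + n'.
    have hexp : (n : ℤ) ^ 2 + (p : ℤ) ^ 2 - n ≤
        2 * ((n ^ 2 : ℕ) : ℤ) + 2 * ((p ^ 2 : ℕ) : ℤ) + 2 * (((n' : ℤ) - n) * p) -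
          m * (m + 1) := by
      push_cast
      have hn : (n : ℤ) = m + p + n' := by rw [← hm']; ring
      rw [hn]
      have h3 : (0 : ℤ) ≤ (n' : ℤ) * p := by positivity
      have h4 : (0 : ℤ) ≤ (n' : ℤ) * m := by positivity
      nlinarith [sq_nonneg (n' : ℤ)]
    have hmn : m ≤ n := by omega
    rw [hsplit, zpow_add₀ hr0.ne']
    calc _ = r ^ (2 * ((n ^ 2 : ℕ) : ℤ) + 2 * ((p ^ 2 : ℕ) : ℤ) + 2 * (((n' : ℤ) - n) * p) -
            m * (m + 1)) * (‖qPochInf q (a * q ^ (-(m : ℤ)))‖ *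
              r ^ (2 * ((m * (m + 1) / 2 : ℕ) : ℤ))) := by ring
      _ ≤ r ^ ((n : ℤ) ^ 2 + (p : ℤ) ^ 2 - n) * (C * D ^ n) := by
          refine mul_le_mul ?_ (hE.trans ?_) (by positivity) (by positivity)
          · exact zpow_le_zpow_right_of_le_one₀ hr0 hr1 hexp
          · exact mul_le_mul_of_nonneg_left (pow_le_pow_right₀ hD hmn) hC0
      _ = _ := by ring

/-- The second factor involves the occupation number n' of the next site, but the bound is uniform
in n'. It therefore decouples the sites, and the multiple sum is dominated by a product of single
sums. -/
theorem exists_bound_localG_mul (hq0 : q ≠ 0) (hq1 : ‖q‖ < 1) (U V : ℂ) :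
    ∃ g h : ℕ → ℝ, (∀ n, 0 ≤ g n) ∧ (∀ n, 0 ≤ h n) ∧ Summable g ∧ Summable h ∧
      ∀ n p n' : ℕ, ‖localG q lam n U * localG q lam p (V * q ^ ((n' : ℤ) - n))‖ ≤ g n * h p := by
  obtain ⟨C, hC0, hC⟩ := exists_norm_qPochInf_le hq1 ‖U‖
  obtain ⟨C', R, hC0', hR0, h⟩ := exists_norm_gauss_le hq0 hq1 (q * V)
  have hq3 : 0 ≤ (1 - ‖q‖)⁻¹ := inv_nonneg.2 (sub_pos.2 hq1).le
  have hr1 : √‖q‖ < 1 := by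
    rw [← Real.sqrt_one]
    exact Real.sqrt_lt_sqrt (norm_nonneg _) hq1
  refine ⟨fun n => C * C' * ((‖lam‖ * ‖U‖ * (1 - ‖q‖)⁻¹ * R) ^ n * √‖q‖ ^ (n ^ 2)),
    fun p => (‖lam‖ * ‖V‖ * (1 - ‖q‖)⁻¹) ^ p * √‖q‖ ^ (p ^ 2), fun n => by positivity,
    fun p => by positivity,
    (summable_pow_mul_pow_sq (Real.sqrt_nonneg _) hr1 (by positivity)).mul_left _,
    summable_pow_mul_pow_sq (Real.sqrt_nonneg _) hr1 (by positivity), fun n p n' => ?_⟩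
  have e1 : q ^ (p + 1) * (V * q ^ ((n' : ℤ) - n)) = q * V * q ^ ((p : ℤ) + n' - n) := by
    rw [add_sub_assoc, zpow_add₀ hq0, zpow_natCast]
    ring
  have hE : ‖qPochInf q (q ^ (n + 1) * U)‖ ≤ C := by
    refine hC _ ?_
    rw [norm_mul, norm_pow]
    exact mul_le_of_le_one_left (norm_nonneg _) (pow_le_one₀ (norm_nonneg _) hq1.le)
  have h2 := h n p n'
  have hn := norm_inv_qPoch_le hq1 n
  have hp := norm_inv_qPoch_le hq1 p
  have h3 := norm_nonneg (qPochInf q (q * V * q ^ ((p : ℤ) + n' - n)))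
  rw [localG, localG, e1, div_eq_mul_inv, div_eq_mul_inv]
  simp only [norm_mul, norm_pow, norm_zpow, mul_pow] at h2 ⊢
  have e2 : (‖q‖ ^ ((n' : ℤ) - n)) ^ p = ‖q‖ ^ (((n' : ℤ) - n) * p) := by
    rw [zpow_mul, zpow_natCast]
  rw [e2]
  calc _ = (‖lam‖ ^ n * ‖U‖ ^ n * ‖lam‖ ^ p * ‖V‖ ^ p) * ‖qPochInf q (q ^ (n + 1) * U)‖ *
        ‖(qPoch q q n)⁻¹‖ * ‖(qPoch q q p)⁻¹‖ * (‖q‖ ^ (n ^ 2) * ‖q‖ ^ (p ^ 2) *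
          ‖q‖ ^ (((n' : ℤ) - n) * p) * ‖qPochInf q (q * V * q ^ ((p : ℤ) + n' - n))‖) := by ring
    _ ≤ (‖lam‖ ^ n * ‖U‖ ^ n * ‖lam‖ ^ p * ‖V‖ ^ p) * C * (1 - ‖q‖)⁻¹ ^ n * (1 - ‖q‖)⁻¹ ^ p *
        (C' * (R ^ n * √‖q‖ ^ (n ^ 2)) * √‖q‖ ^ (p ^ 2)) := by gcongr
    _ = _ := by ring

end Products

end RelToda

namespace RelToda

/-! ### The combinatorial core of the Wronskian -/

section Core

variable {q : ℂ} (lam : ℂ)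

/-- The coefficients of the series `(Y; q)_∞ = ∑ ε(n) Y^n`. -/
noncomputable def eulerCoeff (q : ℂ) (n : ℕ) : ℂ := (-1) ^ n * q ^ n.choose 2 / qPoch q q n

theorem sq_eq_choose (n : ℕ) : n ^ 2 = n.choose 2 + n.choose 2 + n := by
  induction n with
  | zero => rfl
  | succ n ih =>
    rw [Nat.choose_succ_succ', Nat.choose_one_right]
    linarith

theorem qPoch_zero (q x : ℂ) : qPoch q x 0 = 1 := Finset.prod_range_zero _

theorem eulerCoeff_zero : eulerCoeff q 0 = 1 := by simp [eulerCoeff, qPoch_zero]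

theorem eulerCoeff_ne_zero (hq0 : q ≠ 0) (hq1 : ‖q‖ < 1) (n : ℕ) : eulerCoeff q n ≠ 0 := by
  rw [eulerCoeff]
  exact div_ne_zero (mul_ne_zero (pow_ne_zero _ (by norm_num)) (pow_ne_zero _ hq0))
    (qPoch_self_ne_zero hq1 n)

theorem eulerCoeff_succ (hq1 : ‖q‖ < 1) (n : ℕ) :
    eulerCoeff q (n + 1) * (1 - q ^ (n + 1)) = -(q ^ n * eulerCoeff q n) := by
  have h1 := qPoch_self_ne_zero hq1 n
  have h2 := one_sub_pow_ne_zero hq1 n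
  rw [eulerCoeff, eulerCoeff, qPoch_self_succ, Nat.choose_succ_succ', Nat.choose_one_right,
    pow_add]
  field_simp
  ring

theorem inv_qPoch_pred (hq1 : ‖q‖ < 1) (n : ℕ) :
    (qPoch q q n)⁻¹ = (1 - q ^ (n + 1)) * (qPoch q q (n + 1))⁻¹ := by
  have h1 := qPoch_self_ne_zero hq1 n
  have h2 := one_sub_pow_ne_zero hq1 n
  rw [qPoch_self_succ]
  field_simp

/-- The `q`-binomial theorem. -/
theorem sum_eulerCoeff_mul (hq1 : ‖q‖ < 1) (Z : ℂ) (N : ℕ) :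
    ∑ j ∈ Finset.range (N + 1), eulerCoeff q j * (Z ^ (N - j) * (qPoch q q (N - j))⁻¹) =
      (∏ i ∈ Finset.range N, (Z - q ^ i)) * (qPoch q q N)⁻¹ := by
  induction N with
  | zero => simp [eulerCoeff_zero]
  | succ N ih =>
    rw [Finset.prod_range_succ]
    have h2 := one_sub_pow_ne_zero hq1 N
    refine mul_left_cancel₀ h2 ?_
    have hR : (1 - q ^ (N + 1)) * ((∏ i ∈ Finset.range N, (Z - q ^ i)) * (Z - q ^ N) *
        (qPoch q q (N + 1))⁻¹) = Z * ((∏ i ∈ Finset.range N, (Z - q ^ i)) * (qPoch q q N)⁻¹) -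
          q ^ N * ((∏ i ∈ Finset.range N, (Z - q ^ i)) * (qPoch q q N)⁻¹) := by
      rw [inv_qPoch_pred hq1 N]
      ring
    -- The induction uses 1 − q^{N+1} = (1 − q^{N+1−j}) + q^{N+1−j}(1 − q^j): the first part lowers
    -- N + 1 − j, the second lowers j.
    have hA : ∑ j ∈ Finset.range (N + 1 + 1), (1 - q ^ (N + 1 - j)) *
        (eulerCoeff q j * (Z ^ (N + 1 - j) * (qPoch q q (N + 1 - j))⁻¹)) =
        Z * ∑ j ∈ Finset.range (N + 1),
          eulerCoeff q j * (Z ^ (N - j) * (qPoch q q (N - j))⁻¹) := by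
      rw [Finset.sum_range_succ, Nat.sub_self, pow_zero, sub_self, zero_mul, add_zero,
        Finset.mul_sum]
      refine Finset.sum_congr rfl fun j hj => ?_
      have hj' : j ≤ N := Nat.lt_succ_iff.1 (Finset.mem_range.1 hj)
      rw [show N + 1 - j = N - j + 1 by omega, inv_qPoch_pred hq1 (N - j), pow_succ Z]
      ring
    have hB : ∑ j ∈ Finset.range (N + 1 + 1), q ^ (N + 1 - j) * (1 - q ^ j) *
        (eulerCoeff q j * (Z ^ (N + 1 - j) * (qPoch q q (N + 1 - j))⁻¹)) =
        -(q ^ N * ∑ j ∈ Finset.range (N + 1),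
          eulerCoeff q j * (Z ^ (N - j) * (qPoch q q (N - j))⁻¹)) := by
      rw [Finset.sum_range_succ', pow_zero, sub_self, mul_zero, zero_mul, add_zero,
        Finset.mul_sum, ← Finset.sum_neg_distrib]
      refine Finset.sum_congr rfl fun j hj => ?_
      have hj' : j ≤ N := Nat.lt_succ_iff.1 (Finset.mem_range.1 hj)
      have e : q ^ N = q ^ (N - j) * q ^ j := by rw [← pow_add, Nat.sub_add_cancel hj']
      rw [Nat.add_sub_add_right, e]
      linear_combination q ^ (N - j) * (Z ^ (N - j) * (qPoch q q (N - j))⁻¹) *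
        eulerCoeff_succ hq1 j
    rw [hR, ← ih]
    refine Eq.trans ?_ ((congrArg₂ (· + ·) hA hB).trans (sub_eq_add_neg _ _).symm)
    rw [← Finset.sum_add_distrib, Finset.mul_sum]
    refine Finset.sum_congr rfl fun j hj => ?_
    have e : q ^ (N + 1) = q ^ (N + 1 - j) * q ^ j := by
      rw [← pow_add, Nat.sub_add_cancel (Nat.lt_succ_iff.1 (Finset.mem_range.1 hj))]
    rw [e]
    ring

theorem prod_pow_mul_sub (x : ℂ) (N : ℕ) :
    ∏ i ∈ Finset.range N, (q ^ N * x - q ^ i) = (-1) ^ N * q ^ N.choose 2 * qPoch q (q * x) N := by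
  have h1 : ∀ i ∈ Finset.range N, q ^ N * x - q ^ i =
      (-1) * q ^ i * (1 - q ^ (N - 1 - i) * (q * x)) := by
    intro i hi
    have hi' := Finset.mem_range.1 hi
    have e : q ^ N = q ^ i * q ^ (N - 1 - i) * q := by
      rw [← pow_add, ← pow_succ]
      congr 1
      omega
    rw [e]
    ring
  rw [Finset.prod_congr rfl h1, Finset.prod_mul_distrib, Finset.prod_mul_distrib,
    Finset.prod_const, Finset.card_range, Finset.prod_pow_eq_pow_sum,
    Finset.prod_range_reflect (fun k => 1 - q ^ k * (q * x)) N, Finset.sum_range_id, Nat.choose_two_right]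
  rfl

/-- The local weights of the product of the two `Q`-operators, up to a telescoping gauge factor.
Here `N` is the total occupation number of the next site. -/
noncomputable def weightA (q lam U : ℂ) (N ν j : ℕ) : ℂ :=
  lam ^ N * (-1) ^ ν * q ^ ν.choose 2 * U ^ ν * qPochInf q (q ^ ν * U) *
    qPochInf q (q * (q ^ N / (q ^ ν * U))) *
    ((q ^ N / (q ^ ν * U)) ^ (N - j) * eulerCoeff q j * (qPoch q q (N - j))⁻¹)

/-- The counterpart of `weightA` for the second product in the Wronskian. -/
noncomputable def weightB (q lam U : ℂ) (N ν j : ℕ) : ℂ :=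
  if j ≤ N then
    lam ^ N * (-1) ^ ν * q ^ (ν - 1).choose 2 * U ^ (ν - 1) * qPochInf q (q ^ ν * U) *
      qPochInf q (q ^ 2 * (q ^ N / (q ^ ν * U))) *
      ((q * (q ^ N / (q ^ ν * U))) ^ (N - j) * eulerCoeff q j * (1 - q ^ j) *
        (qPoch q q (N - j))⁻¹)
  else 0

/-- This is the hypothesis `hAB` of `cycSum_eq_add`. With Z = q^N/(q^{ν+1}U), the infinite products
reduce to the common factors (q^{ν+1}U;q)_∞ and (q²Z;q)_∞; what remains follows from q^ν U · qZ =
q^N and the recursion of `eulerCoeff`. -/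
theorem weightA_sub (hq0 : q ≠ 0) (hq1 : ‖q‖ < 1) {U : ℂ} (hU : U ≠ 0) (N ν j : ℕ) (hj : j ≤ N) :
    weightA q lam U N (ν + 1) j - weightA q lam U N ν j =
      weightB q lam U N (ν + 1) j - weightB q lam U N (ν + 1) (j + 1) := by
  set Z := q ^ N / (q ^ (ν + 1) * U) with hZ
  have hZ' : q ^ N / (q ^ ν * U) = q * Z := by
    rw [hZ, pow_succ]
    field_simp
  have hUZ : q ^ ν * U * (q * Z) = q ^ N := by
    rw [← hZ']
    field_simp
  have hE1 : qPochInf q (q ^ ν * U) = (1 - q ^ ν * U) * qPochInf q (q ^ (ν + 1) * U) := by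
    rw [qPochInf_eq hq1, pow_succ']
    ring_nf
  have hE2 : qPochInf q (q * Z) = (1 - q * Z) * qPochInf q (q ^ 2 * Z) := by
    rw [qPochInf_eq hq1]
    ring_nf
  rw [weightA, weightA, weightB, weightB, ← hZ, hZ', if_pos hj, Nat.add_sub_cancel,
    Nat.choose_succ_succ', Nat.choose_one_right, hE1, hE2]
  rw [show q * (q * Z) = q ^ 2 * Z by ring]
  rcases hj.lt_or_eq with hj' | rfl
  · obtain ⟨r, rfl⟩ : ∃ r, N = j + (r + 1) := ⟨N - j - 1, by omega⟩
    have hr1 : j + (r + 1) - (j + 1) = r := by omega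
    have e := eulerCoeff_succ hq1 j
    rw [if_pos (by omega), Nat.add_sub_cancel_left, hr1, inv_qPoch_pred hq1 r]
    have hUZ1 : q ^ ν * U * Z = q ^ (j + r) := by
      refine mul_left_cancel₀ hq0 ?_
      rw [← pow_succ', add_assoc j r 1, ← hUZ]
      ring
    generalize qPochInf q (q ^ (ν + 1) * U) = E1
    generalize qPochInf q (q ^ 2 * Z) = E2
    generalize (qPoch q q (r + 1))⁻¹ = P
    linear_combination lam ^ (j + (r + 1)) * (-1) ^ (ν + 1) * q ^ ν.choose 2 * U ^ ν * E1 * E2 * P *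
      ((q * Z) ^ r * (1 - q ^ (r + 1)) * e +
        eulerCoeff q j * Z ^ r * (1 - q * Z - q ^ (r + 1)) * hUZ1)
  -- At j = N the term with j + 1 is removed by the cutoff in `weightB`.
  · rw [if_neg (by omega), Nat.sub_self]
    simp only [pow_zero, one_mul, qPoch_zero, inv_one, mul_one, sub_zero]
    generalize qPochInf q (q ^ (ν + 1) * U) = E1
    generalize qPochInf q (q ^ 2 * Z) = E2
    linear_combination -(lam ^ j * (-1) ^ (ν + 1) * q ^ ν.choose 2 * U ^ ν * E1 * E2 *
      eulerCoeff q j) * hUZ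

/-- The q-binomial theorem at Z = q^N/U yields the finite product that completes (q·q^N/U;q)_∞ to
(q/U;q)_∞. The row sum thus separates into a factor depending on U only and a coefficient of the
series (Y;q)_∞. -/
theorem sum_weightA (hq1 : ‖q‖ < 1) (U : ℂ) (N : ℕ) :
    ∑ j ∈ Finset.range (N + 1), weightA q lam U N 0 j =
      qPochInf q U * qPochInf q (q * U⁻¹) * (lam ^ N * eulerCoeff q N) := by
  have h := sum_eulerCoeff_mul hq1 (q ^ N * U⁻¹) N
  rw [prod_pow_mul_sub] at h
  rw [qPochInf_eq_mul hq1 (q * U⁻¹) N, eulerCoeff]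
  calc _ = lam ^ N * qPochInf q U * qPochInf q (q * (q ^ N * U⁻¹)) *
        ∑ j ∈ Finset.range (N + 1), eulerCoeff q j * ((q ^ N * U⁻¹) ^ (N - j) *
          (qPoch q q (N - j))⁻¹) := by
        rw [Finset.mul_sum]
        refine Finset.sum_congr rfl fun j _ => ?_
        rw [weightA, div_eq_mul_inv]
        simp only [pow_zero, one_mul, mul_one, Nat.choose_zero_succ]
        ring
    _ = _ := by
        rw [h, div_eq_mul_inv, mul_left_comm q]
        ring

/-- The gauge factor relating `weightA` to the product of two local weights. -/
theorem localG_mul_eq_weightA (hq0 : q ≠ 0) (hq1 : ‖q‖ < 1) (hlam : lam ≠ 0) {U : ℂ} (hU : U ≠ 0)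
    (N ν j : ℕ) (hj : j ≤ N) :
    localG q lam ν (U / q) * localG q lam (N - j) (U⁻¹ * q ^ ((j : ℤ) - ν)) =
      weightA q lam U N ν j * ((lam ^ ν * eulerCoeff q ν) / (lam ^ j * eulerCoeff q j)) := by
  obtain ⟨r, rfl⟩ : ∃ r, N = j + r := ⟨N - j, by omega⟩
  have hZ : U⁻¹ * q ^ ((j : ℤ) - ν) * q ^ r = q ^ (j + r) / (q ^ ν * U) := by
    rw [zpow_sub₀ hq0, zpow_natCast, zpow_natCast, pow_add]
    field_simp
  rw [Nat.add_sub_cancel_left, localG, localG, weightA, Nat.add_sub_cancel_left, ← hZ]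
  set V := U⁻¹ * q ^ ((j : ℤ) - ν)
  have e1 : q ^ (ν + 1) * (U / q) = q ^ ν * U := by
    rw [pow_succ]
    field_simp
  have e2 : q ^ (r + 1) * V = q * (V * q ^ r) := by ring
  have e3 : q ^ (ν ^ 2) * (U / q) ^ ν = q ^ ν.choose 2 * q ^ ν.choose 2 * U ^ ν := by
    rw [sq_eq_choose, pow_add, pow_add, div_pow]
    field_simp
  have e4 : lam ^ ν * eulerCoeff q ν / (lam ^ j * eulerCoeff q j) =
      lam ^ ν * ((-1) ^ ν * q ^ ν.choose 2 / qPoch q q ν) * (lam ^ j)⁻¹ * (eulerCoeff q j)⁻¹ := by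
    rw [eulerCoeff, div_eq_mul_inv, mul_inv]
    ring
  have e5 : ((-1 : ℂ)) ^ ν * (-1) ^ ν = 1 := by rw [← mul_pow]; norm_num
  have e6 := mul_inv_cancel₀ (eulerCoeff_ne_zero hq0 hq1 j)
  have e7 := mul_inv_cancel₀ (pow_ne_zero j hlam)
  rw [e1, e2, e4, pow_add lam]
  generalize qPochInf q (q ^ ν * U) = E1
  generalize qPochInf q (q * (V * q ^ r)) = E2
  generalize eulerCoeff q j = x at *
  generalize lam ^ j = y at *
  calc _ = lam ^ ν * (q ^ ν ^ 2 * (U / q) ^ ν) * E1 / qPoch q q ν *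
        (lam ^ r * q ^ r ^ 2 * V ^ r * E2 / qPoch q q r) := by ring
    _ = lam ^ ν * (q ^ ν.choose 2 * q ^ ν.choose 2 * U ^ ν) * E1 / qPoch q q ν *
        (lam ^ r * q ^ r ^ 2 * V ^ r * E2 / qPoch q q r) * ((-1) ^ ν * (-1) ^ ν) *
          (y * y⁻¹) * (x * x⁻¹) := by
      rw [e3, e5, e6, e7, mul_one, mul_one, mul_one]
    _ = _ := by ring

/-- The terms of the second product correspond to `weightB` with N, ν and j all raised by one. The
factor λ per site comes from λ^{-∑ s_f} under θ ↦ θ − 1; the ratio on the right telescopes round the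
cycle. -/
theorem mul_localG_mul_eq_weightB (hq0 : q ≠ 0) (hq1 : ‖q‖ < 1) (hlam : lam ≠ 0) {U : ℂ}
    (hU : U ≠ 0) (N ν j : ℕ) (hj : j ≤ N) :
    lam * (localG q lam ν U * localG q lam (N - j) (q * U⁻¹ * q ^ ((j : ℤ) - ν))) =
      weightB q lam U (N + 1) (ν + 1) (j + 1) *
        ((lam ^ (ν + 1) * eulerCoeff q (ν + 1) * (1 - q ^ (ν + 1))) /
          (lam ^ (j + 1) * eulerCoeff q (j + 1) * (1 - q ^ (j + 1)))) := by
  obtain ⟨r, rfl⟩ : ∃ r, N = j + r := ⟨N - j, by omega⟩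
  have hZ : q * U⁻¹ * q ^ ((j : ℤ) - ν) * q ^ r = q * (q ^ (j + r + 1) / (q ^ (ν + 1) * U)) := by
    rw [zpow_sub₀ hq0, zpow_natCast, zpow_natCast, pow_succ, pow_succ, pow_add]
    field_simp
  have e8 : q ^ 2 * (q ^ (j + r + 1) / (q ^ (ν + 1) * U)) =
      q * (q * (q ^ (j + r + 1) / (q ^ (ν + 1) * U))) := by ring
  rw [Nat.add_sub_cancel_left, localG, localG, weightB, if_pos (by omega),
    show j + r + 1 - (j + 1) = r by omega, Nat.add_sub_cancel, e8, ← hZ,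
    mul_assoc _ (eulerCoeff q (ν + 1)), eulerCoeff_succ hq1 ν]
  set V := q * U⁻¹ * q ^ ((j : ℤ) - ν)
  have e2 : q ^ (r + 1) * V = q * (V * q ^ r) := by ring
  have e3 : q ^ (ν ^ 2) = q ^ ν.choose 2 * q ^ ν.choose 2 * q ^ ν := by
    rw [sq_eq_choose, pow_add, pow_add]
  have e4 : eulerCoeff q ν = (-1) ^ ν * q ^ ν.choose 2 / qPoch q q ν := rfl
  have e5 : ((-1 : ℂ)) ^ ν * (-1) ^ ν = 1 := by rw [← mul_pow]; norm_num
  have e6 := mul_inv_cancel₀ (eulerCoeff_ne_zero hq0 hq1 (j + 1))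
  have e7 := mul_inv_cancel₀ (pow_ne_zero (j + 1) hlam)
  have e9 := mul_inv_cancel₀ (one_sub_pow_ne_zero hq1 j)
  have e10 : lam ^ (j + r + 1) = lam ^ (j + 1) * lam ^ r := by rw [← pow_add]; congr 1; omega
  rw [e2, e3, e4, e10]
  generalize qPochInf q (q ^ (ν + 1) * U) = E1
  generalize qPochInf q (q * (V * q ^ r)) = E2
  generalize eulerCoeff q (j + 1) = x at *
  generalize lam ^ (j + 1) = y at *
  generalize 1 - q ^ (j + 1) = z at *
  calc _ = lam * lam ^ ν * (q ^ ν.choose 2 * q ^ ν.choose 2 * q ^ ν) * U ^ ν * E1 / qPoch q q ν *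
        (lam ^ r * q ^ r ^ 2 * V ^ r * E2 / qPoch q q r) * 1 * 1 * 1 * 1 := by ring
    _ = lam * lam ^ ν * (q ^ ν.choose 2 * q ^ ν.choose 2 * q ^ ν) * U ^ ν * E1 / qPoch q q ν *
        (lam ^ r * q ^ r ^ 2 * V ^ r * E2 / qPoch q q r) * ((-1) ^ ν * (-1) ^ ν) * (y * y⁻¹) *
          (x * x⁻¹) * (z * z⁻¹) := by rw [e5, e6, e7, e9]
    _ = _ := by ring

theorem prod_div_nextPerm {F : ℕ} [NeZero F] (g : Fin F → ℂ) (hg : ∀ f, g f ≠ 0) :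
    ∏ f, g f / g (nextPerm F f) = 1 := by
  rw [Finset.prod_div_distrib, Equiv.prod_comp,
    div_self (Finset.prod_ne_zero_iff.2 fun f _ => hg f)]

/-- The summand of the product of the two `Q`-operators. -/
noncomputable def pairTerm {F : ℕ} [NeZero F] (q lam : ℂ) (U V : Fin F → ℂ)
    (n p : Fin F → ℕ) : ℂ :=
  ∏ f, localG q lam (n f) (U f) *
    localG q lam (p (nextPerm F f)) (V f * q ^ ((n (nextPerm F f) : ℤ) - n f))

theorem sum_pairTerm_eq_cycSum {F : ℕ} [NeZero F] (hq0 : q ≠ 0) (hq1 : ‖q‖ < 1) (hlam : lam ≠ 0)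
    (U : Fin F → ℂ) (hU : ∀ f, U f ≠ 0) (N : Fin F → ℕ) :
    ∑ a ∈ Fintype.piFinset (fun f => Finset.range (N f + 1)),
      pairTerm q lam (fun f => U f / q) (fun f => (U f)⁻¹) a (N - a) =
    cycSum (nextPerm F) (fun f => Finset.range (N f + 1))
      (fun f => weightA q lam (U f) (N (nextPerm F f))) := by
  refine Finset.sum_congr rfl fun a ha => ?_
  have h := prod_div_nextPerm (fun f => lam ^ a f * eulerCoeff q (a f))
    fun f => mul_ne_zero (pow_ne_zero _ hlam) (eulerCoeff_ne_zero hq0 hq1 _)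
  refine Eq.trans ?_ (mul_one _)
  rw [← h, ← Finset.prod_mul_distrib, pairTerm]
  refine Finset.prod_congr rfl fun f _ => ?_
  exact localG_mul_eq_weightA lam hq0 hq1 hlam (hU f) _ _ _
    (Nat.lt_succ_iff.1 (Finset.mem_range.1 (Fintype.mem_piFinset.1 ha _)))

theorem pow_mul_sum_pairTerm {F : ℕ} [NeZero F] (hq0 : q ≠ 0) (hq1 : ‖q‖ < 1) (hlam : lam ≠ 0)
    (U : Fin F → ℂ) (hU : ∀ f, U f ≠ 0) (N : Fin F → ℕ) :
    lam ^ F * ∑ a ∈ Fintype.piFinset (fun f => Finset.range (N f + 1)),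
      pairTerm q lam U (fun f => q * (U f)⁻¹) a (N - a) =
    ∑ a ∈ Fintype.piFinset (fun f => Finset.Icc 1 (N f + 1)),
      ∏ f, weightB q lam (U f) (N (nextPerm F f) + 1) (a f) (a (nextPerm F f)) := by
  rw [Finset.mul_sum]
  refine Finset.sum_nbij' (fun a f => a f + 1) (fun a f => a f - 1) ?_ ?_ ?_ ?_ ?_
  · intro a ha
    rw [Fintype.mem_piFinset] at ha ⊢
    intro f
    have := Finset.mem_range.1 (ha f)
    exact Finset.mem_Icc.2 (by omega)
  · intro a ha
    rw [Fintype.mem_piFinset] at ha ⊢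
    intro f
    have := Finset.mem_Icc.1 (ha f)
    exact Finset.mem_range.2 (by omega)
  · intro a _
    rfl
  · intro a ha
    rw [Fintype.mem_piFinset] at ha
    funext f
    exact Nat.sub_add_cancel (Finset.mem_Icc.1 (ha f)).1
  · intro a ha
    have h := prod_div_nextPerm
      (fun f => lam ^ (a f + 1) * eulerCoeff q (a f + 1) * (1 - q ^ (a f + 1)))
      fun f => mul_ne_zero (mul_ne_zero (pow_ne_zero _ hlam) (eulerCoeff_ne_zero hq0 hq1 _))
        (one_sub_pow_ne_zero hq1 _)
    refine Eq.trans ?_ (mul_one _)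
    rw [← h, ← Finset.prod_mul_distrib, pairTerm,
      show lam ^ F = ∏ _f : Fin F, lam by simp, ← Finset.prod_mul_distrib]
    refine Finset.prod_congr rfl fun f _ => ?_
    exact mul_localG_mul_eq_weightB lam hq0 hq1 hlam (hU f) _ _ _
      (Nat.lt_succ_iff.1 (Finset.mem_range.1 (Fintype.mem_piFinset.1 ha _)))

/-- The remaining sum over positive labels is, by `pow_mul_sum_pairTerm`, the second product with
occupation numbers lowered by one, and it cancels in the Wronskian. -/
theorem cycSum_weightA {F : ℕ} [NeZero F] (hq0 : q ≠ 0) (hq1 : ‖q‖ < 1)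
    (U : Fin F → ℂ) (hU : ∀ f, U f ≠ 0) (N : Fin F → ℕ) :
    cycSum (nextPerm F) (fun f => Finset.range (N f + 1))
      (fun f => weightA q lam (U f) (N (nextPerm F f))) =
    (∏ f, qPochInf q (U f) * qPochInf q (q * (U f)⁻¹)) * ∏ f, lam ^ N f * eulerCoeff q (N f) +
      ∑ a ∈ Fintype.piFinset (fun f => Finset.Icc 1 (N f)),
        ∏ f, weightB q lam (U f) (N (nextPerm F f)) (a f) (a (nextPerm F f)) := by
  have h := cycSum_eq_add (isTransitive_nextPerm F) N
    (fun f => weightA q lam (U f) (N (nextPerm F f)))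
    (fun f => weightB q lam (U f) (N (nextPerm F f))) _
    (fun f => sum_weightA lam hq1 (U f) (N (nextPerm F f)))
    (fun f ν => by simp [weightB]) (fun f ν => by simp [weightB])
    (fun f ν _ j hj => weightA_sub lam hq0 hq1 (hU f) _ _ _ hj)
  rw [h, Finset.prod_mul_distrib,
    Equiv.prod_comp (nextPerm F) fun f => lam ^ N f * eulerCoeff q (N f)]

end Core

end RelToda

namespace RelToda

/-! ### Convergence and regrouping of the products of the two `Q`-operators -/

section Regrouping

variable {F : ℕ} [NeZero F] {q : ℂ} (lam : ℂ)

theorem summable_pairTerm (hq0 : q ≠ 0) (hq1 : ‖q‖ < 1) (U V : Fin F → ℂ) :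
    Summable fun x : (Fin F → ℕ) × (Fin F → ℕ) => pairTerm q lam U V x.1 x.2 := by
  choose g h hg0 hh0 hg hh hgh using fun f => exists_bound_localG_mul lam hq0 hq1 (U f) (V f)
  have hA : Summable fun n : Fin F → ℕ => ∏ f, g f (n f) := summable_pi_prod hg0 hg
  have hB : Summable fun n : Fin F → ℕ => ∏ f, h ((nextPerm F).symm f) (n f) :=
    summable_pi_prod (fun f => hh0 ((nextPerm F).symm f)) fun f => hh ((nextPerm F).symm f)
  have hA0 : 0 ≤ fun n : Fin F → ℕ => ∏ f, g f (n f) :=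
    fun n => Finset.prod_nonneg fun f _ => hg0 f _
  have hB0 : 0 ≤ fun n : Fin F → ℕ => ∏ f, h ((nextPerm F).symm f) (n f) :=
    fun n => Finset.prod_nonneg fun f _ => hh0 _ _
  refine (hA.mul_of_nonneg hB hA0 hB0).of_norm_bounded fun x => ?_
  have e : ∏ f, h ((nextPerm F).symm f) (x.2 f) = ∏ f, h f (x.2 (nextPerm F f)) := by
    refine (Equiv.prod_comp (nextPerm F) _).symm.trans (Finset.prod_congr rfl fun f _ => ?_)
    rw [Equiv.symm_apply_apply]
  rw [e, ← Finset.prod_mul_distrib, pairTerm, norm_prod]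
  exact Finset.prod_le_prod (fun f _ => norm_nonneg _) fun f _ => hgh f _ _ _

theorem compat_nextPerm_one (m : Fin F → ℤ) (n : Fin F → ℕ) :
    Compat (nextPerm F) 1 m n ↔ m = fwd n := by
  have h := compat_nextPerm m 0 n
  rwa [sub_zero, zero_add] at h

/-- Rotating the occupation numbers of Q_- by one site gives its constraint the form of the one for
Q_+, so that the total shift depends only on n + p. -/
theorem compat_nextPerm_symm_comp (m : Fin F → ℤ) (p : Fin F → ℕ) :
    Compat (nextPerm F).symm (-1) m (p ∘ nextPerm F) ↔ m = fwd p := by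
  rw [funext_iff]
  refine forall_congr' fun f => ?_
  rw [Function.comp, Function.comp, Equiv.apply_symm_apply]
  change _ ↔ _ = (p (nextPerm F f) : ℤ) - p f
  constructor <;> intro h <;> linarith

theorem fwd_add (n p : Fin F → ℕ) : fwd (n + p) = fwd n + fwd p := by
  funext f
  simp only [fwd, Pi.add_apply]
  push_cast
  ring

/-- The terms of the product of the two `Q`-operators with total occupation numbers `N`. -/
noncomputable def pairSum (q lam : ℂ) (U V : Fin F → ℂ) (N : Fin F → ℕ) : ℂ :=
  ∑ a ∈ Fintype.piFinset (fun f => Finset.range (N f + 1)), pairTerm q lam U V a (N - a)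

/-- The sum of all the terms contributing to a given matrix element of the product. -/
noncomputable def pairTotal (q lam : ℂ) (U V : Fin F → ℂ) (m : Fin F → ℤ) : ℂ :=
  ∑' x : (Fin F → ℕ) × (Fin F → ℕ), if m = fwd (x.1 + x.2) then pairTerm q lam U V x.1 x.2 else 0

theorem hasSum_pairTotal (hq0 : q ≠ 0) (hq1 : ‖q‖ < 1) (U V : Fin F → ℂ) (m : Fin F → ℤ) :
    HasSum (fun x : (Fin F → ℕ) × (Fin F → ℕ) => if m = fwd (x.1 + x.2) then
      pairTerm q lam U V x.1 x.2 else 0) (pairTotal q lam U V m) := by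
  refine Summable.hasSum ?_
  refine Summable.of_norm_bounded (summable_pairTerm lam hq0 hq1 U V).norm fun x => ?_
  split_ifs
  · rfl
  · rw [norm_zero]
    exact norm_nonneg _

/-- The map (n, p) ↦ (n + p, n) regroups the absolutely convergent sum into finite sums over the
splittings of N. -/
theorem hasSum_pairSum (hq0 : q ≠ 0) (hq1 : ‖q‖ < 1) (U V : Fin F → ℂ) (m : Fin F → ℤ) :
    HasSum (fun N : Fin F → ℕ => if m = fwd N then pairSum q lam U V N else 0)
      (pairTotal q lam U V m) := by
  have hinj : Function.Injective fun x : (Fin F → ℕ) × (Fin F → ℕ) => (x.1 + x.2, x.1) := by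
    rintro ⟨n, p⟩ ⟨n', p'⟩ h
    simp only [Prod.mk.injEq] at h
    obtain ⟨h1, rfl⟩ := h
    rw [add_left_cancel h1]
  have h : HasSum (fun y : (Fin F → ℕ) × (Fin F → ℕ) =>
      if y.2 ∈ Fintype.piFinset (fun f => Finset.range (y.1 f + 1)) then
        (if m = fwd y.1 then pairTerm q lam U V y.2 (y.1 - y.2) else 0) else 0)
      (pairTotal q lam U V m) := by
    refine (hinj.hasSum_iff ?_).1 ((hasSum_pairTotal lam hq0 hq1 U V m).congr_fun fun x => ?_)
    · rintro ⟨N, a⟩ hy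
      rw [if_neg]
      intro ha
      refine hy ⟨(a, N - a), ?_⟩
      have : a ≤ N := fun f =>
        Nat.lt_succ_iff.1 (Finset.mem_range.1 (Fintype.mem_piFinset.1 ha f))
      simp only [Prod.mk.injEq, and_true]
      exact add_tsub_cancel_of_le this
    · have : x.1 ∈ Fintype.piFinset fun f => Finset.range ((x.1 + x.2) f + 1) :=
        Fintype.mem_piFinset.2 fun f => Finset.mem_range.2 (by simp only [Pi.add_apply]; omega)
      simp only [Function.comp, if_pos this, add_tsub_cancel_left]
  refine h.prod_fiberwise fun N => ?_
  have h2 := hasSum_sum_of_ne_finset_zero (L := .unconditional _) (f := fun a : Fin F → ℕ =>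
    if a ∈ Fintype.piFinset (fun f => Finset.range (N f + 1)) then
        (if m = fwd N then pairTerm q lam U V a (N - a) else 0) else 0)
    (s := Fintype.piFinset (fun f => Finset.range (N f + 1))) fun a ha => if_neg ha
  have h3 : (if m = fwd N then pairSum q lam U V N else 0) =
      ∑ a ∈ Fintype.piFinset (fun f => Finset.range (N f + 1)),
        if a ∈ Fintype.piFinset (fun f => Finset.range (N f + 1)) then
          (if m = fwd N then pairTerm q lam U V a (N - a) else 0) else 0 := by
    by_cases hm : m = fwd N
    · simp only [if_pos hm]
      exact Finset.sum_congr rfl fun a ha => (if_pos ha).symm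
    · simp only [if_neg hm, ite_self]
      exact Finset.sum_const_zero.symm
  rw [h3]
  exact h2

/-- Summability of the whole family allows the sum over intermediate states to be taken last, after
each factor has been summed to a kernel. -/
theorem hasSum_fiberwise_mul {ι κ κ' : Type*} {f : ι → κ → ℂ} {g : ι → κ' → ℂ} {a b : ι → ℂ}
    {S : ℂ} (h : HasSum (fun y : ι × κ × κ' => f y.1 y.2.1 * g y.1 y.2.2) S)
    (hf : ∀ i, HasSum (f i) (a i)) (hg : ∀ i, HasSum (g i) (b i)) :
    HasSum (fun i => a i * b i) S := by
  have h1 : ∀ i, Summable fun x : κ × κ' => f i x.1 * g i x.2 := fun i =>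
    summable_mul_of_summable_norm (f := f i) (g := g i) (hf i).summable.norm (hg i).summable.norm
  have h2 : ∀ i, HasSum (fun x : κ × κ' => f i x.1 * g i x.2) (a i * b i) := fun i =>
    HasSum.mul (f := f i) (g := g i) (hf i) (hg i) (h1 i)
  exact HasSum.prod_fiberwise (f := fun y : ι × κ × κ' => f y.1 y.2.1 * g y.1 y.2.2) h h2

theorem hasSum_kernelTerm_comp (hq1 : ‖q‖ < 1) (W : Fin F → ℂ) (m : Fin F → ℤ) :
    HasSum (fun p : Fin F → ℕ => kernelTerm q lam (nextPerm F).symm (-1) W m (p ∘ nextPerm F))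
      (kernel q lam (nextPerm F).symm (-1) W m) := by
  have h := hasSum_kernel lam (nextPerm F).symm (-1) hq1 W m
  rw [← Equiv.hasSum_iff (Equiv.arrowCongr (nextPerm F).symm (Equiv.refl ℕ))] at h
  exact h

/-- The intermediate state is determined by n through `fwd n`, so the sum over it adds nothing to
the sum over (n, p). -/
theorem hasSum_kernelTerm_mul (hq0 : q ≠ 0) (hq1 : ‖q‖ < 1) (U V : Fin F → ℂ) (m : Fin F → ℤ) :
    HasSum (fun y : (Fin F → ℤ) × ((Fin F → ℕ) × (Fin F → ℕ)) =>
      kernelTerm q lam (nextPerm F) 1 U y.1 y.2.1 *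
        kernelTerm q lam (nextPerm F).symm (-1) (fun f => V f * q ^ y.1 f) (m - y.1)
          (y.2.2 ∘ nextPerm F)) (pairTotal q lam U V m) := by
  have hinj : Function.Injective fun x : (Fin F → ℕ) × (Fin F → ℕ) => (fwd x.1, x) := by
    intro x y h
    exact (Prod.mk.inj h).2
  refine (hinj.hasSum_iff ?_).1 ((hasSum_pairTotal lam hq0 hq1 U V m).congr_fun fun x => ?_)
  · rintro ⟨j, x⟩ hy
    have : ¬ Compat (nextPerm F) 1 j x.1 := by
      rw [compat_nextPerm_one]
      rintro rfl
      exact hy ⟨x, rfl⟩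
    rw [kernelTerm, if_neg this, zero_mul]
  · simp only [Function.comp_def]
    rw [kernelTerm, if_pos ((compat_nextPerm_one _ _).2 rfl), kernelTerm]
    have : Compat (nextPerm F).symm (-1) (m - fwd x.1) (x.2 ∘ nextPerm F) ↔
        m = fwd (x.1 + x.2) := by
      rw [compat_nextPerm_symm_comp, fwd_add, sub_eq_iff_eq_add, add_comm]
    simp only [Function.comp_def] at this
    simp only [this]
    split_ifs
    · rw [← Finset.prod_mul_distrib]
      rfl
    · rw [mul_zero]

theorem hasSum_kernel_mul (hq0 : q ≠ 0) (hq1 : ‖q‖ < 1) (U V : Fin F → ℂ) (m : Fin F → ℤ) :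
    HasSum (fun j => kernel q lam (nextPerm F) 1 U j *
      kernel q lam (nextPerm F).symm (-1) (fun f => V f * q ^ j f) (m - j))
      (pairTotal q lam U V m) :=
  hasSum_fiberwise_mul (f := fun j n => kernelTerm q lam (nextPerm F) 1 U j n)
    (g := fun j p => kernelTerm q lam (nextPerm F).symm (-1) (fun f => V f * q ^ j f) (m - j)
      (p ∘ nextPerm F)) (hasSum_kernelTerm_mul lam hq0 hq1 U V m)
    (fun j => hasSum_kernel lam (nextPerm F) 1 hq1 U j)
    fun j => hasSum_kernelTerm_comp lam hq1 (fun f => V f * q ^ j f) (m - j)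

/-- The difference of the two products, expanded in the total occupation numbers. -/
theorem hasSum_pairTotal_sub (hq0 : q ≠ 0) (hq1 : ‖q‖ < 1) (hlam : lam ≠ 0) (U : Fin F → ℂ)
    (hU : ∀ f, U f ≠ 0) (m : Fin F → ℤ) :
    HasSum (fun N : Fin F → ℕ => if m = fwd N then
        (∏ f, qPochInf q (U f) * qPochInf q (q * (U f)⁻¹)) * ∏ f, lam ^ N f * eulerCoeff q (N f)
        else 0)
      (pairTotal q lam (fun f => U f / q) (fun f => (U f)⁻¹) m -
        lam ^ F * pairTotal q lam U (fun f => q * (U f)⁻¹) m) := by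
  have h1 := hasSum_pairSum lam hq0 hq1 (fun f => U f / q) (fun f => (U f)⁻¹) m
  have h2 := (hasSum_pairSum lam hq0 hq1 U (fun f => q * (U f)⁻¹) m).mul_left (lam ^ F)
  have hinj : Function.Injective fun (N : Fin F → ℕ) f => N f + 1 := by
    intro n n' h
    funext f
    exact Nat.add_right_cancel (congrFun h f)
  -- Raising every N_f by one leaves `fwd N` unchanged, and the extra terms with some N_f = 0 are
  -- empty sums. The second product now has the index set of the first and cancels its `weightB`
  -- part.
  have h3 : HasSum (fun N : Fin F → ℕ => if m = fwd N then
      ∑ a ∈ Fintype.piFinset (fun f => Finset.Icc 1 (N f)),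
        ∏ f, weightB q lam (U f) (N (nextPerm F f)) (a f) (a (nextPerm F f)) else 0)
      (lam ^ F * pairTotal q lam U (fun f => q * (U f)⁻¹) m) := by
    refine (hinj.hasSum_iff ?_).1 (h2.congr_fun fun N => ?_)
    · intro N hN
      have : ∃ f, N f = 0 := by
        by_contra hcon
        push Not at hcon
        exact hN ⟨fun f => N f - 1, funext fun f =>
          Nat.sub_add_cancel (Nat.one_le_iff_ne_zero.2 (hcon f))⟩
      obtain ⟨f, hf⟩ := this
      rw [Finset.sum_eq_zero, ite_self]
      intro a ha
      have := Finset.mem_Icc.1 (Fintype.mem_piFinset.1 ha f)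
      omega
    · have hf : fwd (fun f => N f + 1) = fwd N := by
        funext f
        simp only [fwd]
        push_cast
        ring
      simp only [Function.comp, hf, mul_ite, mul_zero, pairSum]
      rw [pow_mul_sum_pairTerm lam hq0 hq1 hlam U hU N]
  refine (h1.sub h3).congr_fun fun N => ?_
  rw [pairSum, sum_pairTerm_eq_cycSum lam hq0 hq1 hlam U hU, cycSum_weightA lam hq0 hq1 U hU]
  split_ifs
  · ring
  · ring

end Regrouping

end RelToda

namespace RelToda

/-! ### The Wronskian -/

section Wronskian

theorem prod_ofFn_smul {A : Type*} [Ring A] [Algebra ℂ A] {n : ℕ} (c : Fin n → ℂ)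
    (a : Fin n → A) :
    (List.ofFn fun f => c f • a f).prod = (∏ f, c f) • (List.ofFn a).prod := by
  induction n with
  | zero => simp
  | succ n ih =>
    rw [List.ofFn_succ, List.prod_cons, ih, List.ofFn_succ, List.prod_cons, Fin.prod_univ_succ,
      smul_mul_smul_comm]

variable {F : ℕ} [NeZero F] {η : ℂ} (ℓ : ℂ) (σ : Fin F → ℂ)

theorem summable_eulerCoeff {q : ℂ} (lam : ℂ) (hq0 : q ≠ 0) (hq1 : ‖q‖ < 1) :
    Summable fun n : ℕ => ‖lam ^ n * eulerCoeff q n‖ := by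
  set r := √‖q‖ with hr
  have hqpos : 0 < ‖q‖ := norm_pos_iff.2 hq0
  have hr0 : 0 < r := Real.sqrt_pos.2 hqpos
  have hr1 : r < 1 := by
    rw [hr, ← Real.sqrt_one]
    exact Real.sqrt_lt_sqrt (norm_nonneg _) hq1
  have hq3 : 0 ≤ (1 - ‖q‖)⁻¹ := inv_nonneg.2 (sub_pos.2 hq1).le
  refine Summable.of_nonneg_of_le (fun n => norm_nonneg _) (fun n => ?_)
    (summable_pow_mul_pow_sq hr0.le hr1 (D := ‖lam‖ * (1 - ‖q‖)⁻¹ * r⁻¹) (by positivity))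
  have h1 : ‖q‖ ^ n.choose 2 = r ^ (n ^ 2) * (r⁻¹) ^ n := by
    have : ‖q‖ = r ^ 2 := (Real.sq_sqrt hqpos.le).symm
    rw [this, ← pow_mul, sq_eq_choose, pow_add _ _ n, mul_assoc, ← mul_pow,
      mul_inv_cancel₀ hr0.ne', one_pow, mul_one, two_mul]
  rw [eulerCoeff, div_eq_mul_inv]
  simp only [norm_mul, norm_pow, norm_neg, norm_one, one_pow, one_mul]
  rw [h1]
  calc _ ≤ ‖lam‖ ^ n * (r ^ (n ^ 2) * r⁻¹ ^ n * (1 - ‖q‖)⁻¹ ^ n) := by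
        gcongr
        exact norm_inv_qPoch_le hq1 n
    _ = _ := by
      rw [mul_pow, mul_pow]
      ring

theorem wronskianArg_eq (f : Fin F) : wronskianArg η ℓ σ f = Complex.exp ℓ •
    (weylShift η σ (Multiplicative.ofAdd (Pi.single f 1 - Pi.single (f + 1) 1))).val := by
  rw [wronskianArg, uvOp_eq, uvOp_eq, ofAdd_sub, map_div, div_eq_mul_inv]

/-- Summation by parts on the cycle. It explains why the index of the series at site f is N_{f+1}.
-/
theorem sum_smul_single_sub (N : Fin F → ℕ) :
    ∑ f, N (nextPerm F f) • (Pi.single f 1 - Pi.single (f + 1) 1 : Fin F → ℤ) = fwd N := by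
  have h1 : ∑ f, N (nextPerm F f) • (Pi.single (f + 1) 1 : Fin F → ℤ) =
      ∑ f, N f • (Pi.single f 1 : Fin F → ℤ) :=
    Equiv.sum_comp (nextPerm F) fun f => N f • (Pi.single f 1 : Fin F → ℤ)
  have h2 : ∀ M : Fin F → ℕ, ∑ f, M f • (Pi.single f 1 : Fin F → ℤ) = fun f => (M f : ℤ) := by
    intro M
    rw [← Finset.univ_sum_single fun f => (M f : ℤ)]
    refine Finset.sum_congr rfl fun f _ => ?_
    rw [← Pi.single_smul, nsmul_eq_mul, mul_one]
  simp only [smul_sub, Finset.sum_sub_distrib]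
  rw [h1, h2, h2 N]
  rfl

theorem entry_qPochSeriesTerm (q : ℂ) (N : Fin F → ℕ) (k' k : Fin F → ℤ) :
    entry (qPochSeriesTerm q (wronskianArg η ℓ σ) (N ∘ nextPerm F)) k' k =
      gauge η σ k' / gauge η σ k *
        if k' - k = fwd N then ∏ f, Complex.exp ℓ ^ N f * eulerCoeff q (N f) else 0 := by
  have h : ∀ f, (q ^ ((N ∘ nextPerm F) f * ((N ∘ nextPerm F) f - 1) / 2) /
      qPoch q q ((N ∘ nextPerm F) f)) • (-wronskianArg η ℓ σ f) ^ (N ∘ nextPerm F) f =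
      (Complex.exp ℓ ^ N (nextPerm F f) * eulerCoeff q (N (nextPerm F f))) •
        (weylShift η σ (Multiplicative.ofAdd
          (N (nextPerm F f) • (Pi.single f 1 - Pi.single (f + 1) 1)))).val := by
    intro f
    have hn : ∀ (c : ℂ) (a : Op F), -(c • a) = (-c) • a := fun c a => (neg_smul c a).symm
    rw [wronskianArg_eq, hn, smul_pow, smul_smul, ofAdd_nsmul, map_pow,
      Units.val_pow_eq_pow_val, Function.comp, ← Nat.choose_two_right, eulerCoeff, neg_pow]
    congr 1
    ring
  have hp : (List.ofFn fun f => (weylShift η σ (Multiplicative.ofAdd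
      (N (nextPerm F f) • (Pi.single f 1 - Pi.single (f + 1) 1)))).val).prod =
      (weylShift η σ (Multiplicative.ofAdd (fwd N))).val := by
    rw [← sum_smul_single_sub, ofAdd_sum, ← List.prod_ofFn, map_list_prod, List.map_ofFn,
      ← Units.coeHom_apply, map_list_prod, List.map_ofFn]
    rfl
  have hs := prod_ofFn_smul (fun f => Complex.exp ℓ ^ N (nextPerm F f) *
    eulerCoeff q (N (nextPerm F f))) fun f => (weylShift η σ (Multiplicative.ofAdd
      (N (nextPerm F f) • (Pi.single f 1 - Pi.single (f + 1) 1)))).val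
  rw [hp] at hs
  rw [qPochSeriesTerm, funext h, hs,
    Equiv.prod_comp (nextPerm F) fun f => Complex.exp ℓ ^ N f * eulerCoeff q (N f),
    weylShift_val, smul_monoOp, entry_monoOp]
  by_cases hk : k' = k + fwd N
  · rw [if_pos hk, if_pos (by rw [hk, add_sub_cancel_left]), hk, add_sub_cancel_right, mul_comm]
  · rw [if_neg hk, if_neg (fun hc => hk (by rw [← hc, add_sub_cancel])), mul_zero]

theorem summable_thetaSeries {q : ℂ} (hq0 : q ≠ 0) (hq1 : ‖q‖ < 1) (m : Fin F → ℤ) :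
    Summable fun N : Fin F → ℕ =>
      if m = fwd N then ∏ f, Complex.exp ℓ ^ N f * eulerCoeff q (N f) else 0 := by
  refine (summable_pi_prod (F := F) (fun _ n => norm_nonneg _)
    fun _ => summable_eulerCoeff (Complex.exp ℓ) hq0 hq1).of_norm_bounded fun N => ?_
  rw [← norm_prod]
  split_ifs
  · rfl
  · rw [norm_zero]
    exact norm_nonneg _

theorem hasSum_qPochSeriesTerm (hη : η.re < 0) : HasSum (fun n : Fin F → ℕ =>
    toFormal (qPochSeriesTerm (Complex.exp η) (wronskianArg η ℓ σ) n))
    (fun k' k => gauge η σ k' / gauge η σ k * ∑' N : Fin F → ℕ,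
      if k' - k = fwd N then ∏ f, Complex.exp ℓ ^ N f * eulerCoeff (Complex.exp η) (N f) else 0) := by
  refine hasSum_formalOp.2 fun k' k => ?_
  refine (Equiv.hasSum_iff (Equiv.arrowCongr (nextPerm F).symm (Equiv.refl ℕ))).1 ?_
  exact ((summable_thetaSeries ℓ (Complex.exp_ne_zero η) (norm_exp_lt_one hη)
    (k' - k)).hasSum.mul_left (gauge η σ k' / gauge η σ k)).congr_fun fun N =>
      entry_qPochSeriesTerm ℓ σ (Complex.exp η) N k' k

theorem sum_fwd (n : Fin F → ℕ) : ∑ f, fwd n f = 0 := by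
  simp only [fwd]
  rw [Finset.sum_sub_distrib, sub_eq_zero]
  exact Equiv.sum_comp (nextPerm F) fun f => (n f : ℤ)

/-- The differences n_{f+1} − n_f sum to zero, so all contributing intermediate states have the same
∑ s_f, and the factor λ^{-∑ s_f} of Q_- may be evaluated at k'. -/
theorem kernel_eq_zero_of_sum_ne_zero (q lam : ℂ) (U : Fin F → ℂ) (m : Fin F → ℤ)
    (hm : ∑ f, m f ≠ 0) : kernel q lam (nextPerm F) 1 U m = 0 := by
  rw [kernel, ← tsum_zero (β := Fin F → ℕ)]
  refine tsum_congr fun n => ?_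
  rw [kernelTerm, if_neg]
  rw [compat_nextPerm_one]
  rintro rfl
  exact hm (sum_fwd n)

theorem sum_sVal_sub {F : ℕ} (σ : Fin F → ℂ) (θ : ℂ) (k m : Fin F → ℤ) (hm : ∑ f, m f = 0) :
    ∑ f, sVal σ θ (k - m) f = ∑ f, sVal σ θ k f := by
  have h : ∀ f, sVal σ θ (k - m) f = sVal σ θ k f - (m f : ℂ) := by
    intro f
    rw [sVal, sVal, Pi.sub_apply]
    push_cast
    ring
  rw [Finset.sum_congr rfl fun f _ => h f, Finset.sum_sub_distrib, ← Int.cast_sum, hm,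
    Int.cast_zero, sub_zero]

theorem hasSum_qPlus_mul_qMinus (hη : η.re < 0) (θ θ' : ℂ) (k' k : Fin F → ℤ) :
    HasSum (fun j => qPlus F η ℓ σ θ k' j * qMinus F η ℓ σ θ' j k)
      (Complex.exp (-(ℓ * ∑ f, sVal σ θ' k' f)) * (gauge η σ k' / gauge η σ k) *
        pairTotal (Complex.exp η) (Complex.exp ℓ)
          (fun f => Complex.exp (η * θ) * uSq η σ k' f)
          (fun f => Complex.exp (-(η * θ')) * (uSq η σ k' f)⁻¹) (k' - k)) := by
  refine (Equiv.hasSum_iff (Equiv.subLeft k')).1 ?_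
  refine ((hasSum_kernel_mul (Complex.exp ℓ) (Complex.exp_ne_zero η) (norm_exp_lt_one hη)
    (fun f => Complex.exp (η * θ) * uSq η σ k' f)
    (fun f => Complex.exp (-(η * θ')) * (uSq η σ k' f)⁻¹) (k' - k)).mul_left
      (Complex.exp (-(ℓ * ∑ f, sVal σ θ' k' f)) * (gauge η σ k' / gauge η σ k))).congr_fun
        fun i => ?_
  rw [Function.comp, Equiv.subLeft_apply, qPlus_apply ℓ σ θ hη, qMinus_apply ℓ σ θ' hη, plusKernel,
    minusKernel, sub_sub_cancel]
  by_cases hi : ∑ f, i f = 0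
  · have hV : (fun f => Complex.exp (-(η * θ')) * (uSq η σ (k' - i) f)⁻¹) =
        fun f => Complex.exp (-(η * θ')) * (uSq η σ k' f)⁻¹ * Complex.exp η ^ i f := by
      funext f
      rw [uSq_sub, mul_inv, zpow_neg, inv_inv, mul_assoc]
    have hg := gauge_ne_zero η σ (k' - i)
    have hg' := gauge_ne_zero η σ k
    rw [sum_sVal_sub σ θ' k' i hi, hV, sub_right_comm]
    field_simp
  · rw [kernel_eq_zero_of_sum_ne_zero _ _ _ _ hi]
    ring

theorem composable_qPlus_qMinus (hη : η.re < 0) (θ θ' : ℂ) :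
    (qPlus F η ℓ σ θ).Composable (qMinus F η ℓ σ θ') := fun k' k =>
  (hasSum_qPlus_mul_qMinus ℓ σ hη θ θ' k' k).summable

theorem diagOp_comp {F : ℕ} (d : (Fin F → ℤ) → ℂ) (B : FormalOp F) (k' k : Fin F → ℤ) :
    (toFormal (diagOp d)).comp B k' k = d k' * B k' k := by
  have h : ∀ j, toFormal (diagOp d) k' j = if k' = j then d k' else 0 := by
    intro j
    change entry (diagOp d) k' j = _
    rw [diagOp_eq_monoOp, entry_monoOp, add_zero]
  rw [FormalOp.comp, tsum_eq_single k']
  · rw [h, if_pos rfl]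
  · intro j hj
    rw [h, if_neg hj.symm, zero_mul]

/-- Put U_f = q^{s_f} at the row k'. Under θ ↦ θ − 1 the argument of Q_+ becomes U/q, that of Q_-
becomes qU⁻¹, and λ^{-∑ s_f} acquires λ^F: this is the combination in `hasSum_pairTotal_sub`. -/
theorem wronskian_eq (hη : η.re < 0) (θ : ℂ) : wronskian F η ℓ σ θ =
    (toFormal (thetaFactor η ℓ σ θ)).comp (∑' n : Fin F → ℕ,
      toFormal (qPochSeriesTerm (Complex.exp η) (wronskianArg η ℓ σ) n)) := by
  funext k' k
  set q := Complex.exp η with hq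
  set U : Fin F → ℂ := fun f => Complex.exp (η * θ) * uSq η σ k' f with hUdef
  have hU : ∀ f, U f ≠ 0 := fun f => mul_ne_zero (Complex.exp_ne_zero _) (uSq_ne_zero η σ k' f)
  have e1 : (fun f => Complex.exp (η * (θ - 1)) * uSq η σ k' f) = fun f => U f / q := by
    funext f
    rw [mul_sub, mul_one, Complex.exp_sub, hUdef]
    ring
  have e2 : (fun f => Complex.exp (-(η * θ)) * (uSq η σ k' f)⁻¹) = fun f => (U f)⁻¹ := by
    funext f
    rw [Complex.exp_neg, hUdef, mul_inv]
  have e3 : (fun f => Complex.exp (-(η * (θ - 1))) * (uSq η σ k' f)⁻¹) = fun f => q * (U f)⁻¹ := by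
    funext f
    rw [mul_sub, mul_one, neg_sub, Complex.exp_sub, hUdef, mul_inv]
    ring
  have e4 : Complex.exp (-(ℓ * ∑ f, sVal σ (θ - 1) k' f)) =
      Complex.exp (-(ℓ * ∑ f, sVal σ θ k' f)) * Complex.exp ℓ ^ F := by
    have : ∑ f, sVal σ (θ - 1) k' f = ∑ f, sVal σ θ k' f - F := by
      have h : ∀ f, sVal σ (θ - 1) k' f = sVal σ θ k' f - 1 := fun f => by
        rw [sVal, sVal]
        ring
      rw [Finset.sum_congr rfl fun f _ => h f, Finset.sum_sub_distrib]
      simp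
    rw [this, ← Complex.exp_nat_mul, ← Complex.exp_add]
    congr 1
    ring
  have h1 := (hasSum_qPlus_mul_qMinus ℓ σ hη (θ - 1) θ k' k).tsum_eq
  have h2 := (hasSum_qPlus_mul_qMinus ℓ σ hη θ (θ - 1) k' k).tsum_eq
  rw [e1, e2] at h1
  rw [e3, e4] at h2
  have h3 := (hasSum_pairTotal_sub (Complex.exp ℓ) (Complex.exp_ne_zero η) (norm_exp_lt_one hη)
    (Complex.exp_ne_zero ℓ) U hU (k' - k)).tsum_eq
  have h4 : ∀ N : Fin F → ℕ, (if k' - k = fwd N then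
      (∏ f, qPochInf q (U f) * qPochInf q (q * (U f)⁻¹)) *
        ∏ f, Complex.exp ℓ ^ N f * eulerCoeff q (N f) else 0) =
      (∏ f, qPochInf q (U f) * qPochInf q (q * (U f)⁻¹)) * (if k' - k = fwd N then
        ∏ f, Complex.exp ℓ ^ N f * eulerCoeff q (N f) else 0) := by
    intro N
    rw [mul_ite, mul_zero]
  rw [tsum_congr h4, tsum_mul_left] at h3
  have h5 : ∏ f, (qPochInf q (Complex.exp (η * sVal σ θ k' f)) *
      qPochInf q (Complex.exp (η * (1 - sVal σ θ k' f))) * Complex.exp (-(ℓ * sVal σ θ k' f))) =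
      (∏ f, qPochInf q (U f) * qPochInf q (q * (U f)⁻¹)) *
        Complex.exp (-(ℓ * ∑ f, sVal σ θ k' f)) := by
    rw [Finset.prod_mul_distrib, ← Complex.exp_sum, Finset.sum_neg_distrib, ← Finset.mul_sum]
    congr 1
    refine Finset.prod_congr rfl fun f _ => ?_
    have : Complex.exp (η * (1 - sVal σ θ k' f)) = q * (U f)⁻¹ := by
      rw [mul_sub, mul_one, sub_eq_add_neg, Complex.exp_add, exp_neg_sVal, hUdef, mul_inv,
        Complex.exp_neg]
    rw [this, exp_sVal]
  have h6 : wronskian F η ℓ σ θ k' k =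
      (∑' j, qPlus F η ℓ σ (θ - 1) k' j * qMinus F η ℓ σ θ j k) -
        ∑' j, qPlus F η ℓ σ θ k' j * qMinus F η ℓ σ (θ - 1) j k := rfl
  rw [h6, h1, h2, thetaFactor, diagOp_comp, (hasSum_qPochSeriesTerm ℓ σ hη).tsum_eq, h5]
  linear_combination Complex.exp (-(ℓ * ∑ f, sVal σ θ k' f)) * (gauge η σ k' / gauge η σ k) * -h3

end Wronskian

end RelToda

/-! ### Assembly of the proposition -/

open RelToda in
theorem proposition2 (F : ℕ) [NeZero F] (η ℓ : ℂ) (hη : η.re < 0) (σ : Fin F → ℂ) :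
    -- the coefficients of the transfer matrix
    (transferMatrix (Complex.exp (η / 2)) (Complex.exp ℓ) (uOp η σ) vOp =
        transferLaurent F (tCoeff F η ℓ σ) ∧
      tCoeff F η ℓ σ F = 1 ∧
      tCoeff F η ℓ σ 0 = ((List.ofFn fun f => uOp η σ f ^ 2).prod).val ∧
      ∀ i j, Commute (tCoeff F η ℓ σ i) (tCoeff F η ℓ σ j)) ∧
    -- the series `J` is the normalized formal solution of the Baxter equation, for `t` and `t̄`
    (∀ t ∈ ({tCoeff F η ℓ σ, tBar F η ℓ σ} : Set (ℕ → Op F)), ∀ Q : PowerSeries (Op F),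
      IsBaxterSolution F (Complex.exp η) (Complex.exp ℓ) t Q ∧ PowerSeries.constantCoeff Q = 1 ↔
        Q = baxterJ F (Complex.exp η) (Complex.exp ℓ) t) ∧
    (∀ θ : ℂ,
      -- local form of `Q_+`
      (Summable (qPlusTerm F η ℓ σ θ) ∧
        HasSum (fun n : Fin F → ℕ => toFormal (localPlus η ℓ σ θ n)) (qPlus F η ℓ σ θ)) ∧
      -- local form of `Q_-`
      (Summable (qMinusTerm F η ℓ σ θ) ∧
        HasSum (fun n : Fin F → ℕ => toFormal (localMinus η ℓ σ θ n)) (qMinus F η ℓ σ θ)) ∧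
      -- the Wronskian
      ((qPlus F η ℓ σ (θ - 1)).Composable (qMinus F η ℓ σ θ) ∧
        (qPlus F η ℓ σ θ).Composable (qMinus F η ℓ σ (θ - 1)) ∧
        Summable (fun n : Fin F → ℕ =>
          toFormal (qPochSeriesTerm (Complex.exp η) (wronskianArg η ℓ σ) n)) ∧
        wronskian F η ℓ σ θ =
          (toFormal (thetaFactor η ℓ σ θ)).comp (∑' n : Fin F → ℕ,
            toFormal (qPochSeriesTerm (Complex.exp η) (wronskianArg η ℓ σ) n))) ∧
      -- `Q_-` is the trace of the monodromy over the `q`-oscillator space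
      HasSum (fun n : Fin F → ℕ => toFormal (oscTraceTerm η ℓ σ θ n)) (qMinus F η ℓ σ θ) ∧
      -- up to the cyclic shift, `Q_+` is the trace of the monodromy with the permutation extracted
      (∀ ς : ℂ, σ = (fun _ => ς) →
        HasSum (permTraceTerm η ℓ σ θ)
            ((qPlus F η ℓ σ θ).comp (toFormal (cyclicShift F))) ∧
          (toFormal (cyclicShift F)).comp (qPlus F η ℓ σ θ) =
            (qPlus F η ℓ σ θ).comp (toFormal (cyclicShift F)))) := by
  have hq0 := Complex.exp_ne_zero η
  have hq1 := norm_exp_lt_one hη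
  refine ⟨⟨transferMatrix_eq_tCoeff η ℓ σ, tCoeff_top η ℓ σ, tCoeff_zero η ℓ σ,
    commute_tCoeff η ℓ σ⟩, ?_, fun θ => ⟨⟨(hasSum_qPlusTerm ℓ σ θ hη).summable,
    hasSum_localPlus ℓ σ θ hη⟩, ⟨(hasSum_qMinusTerm ℓ σ θ hη).summable,
    hasSum_localMinus ℓ σ θ hη⟩, ⟨composable_qPlus_qMinus ℓ σ hη _ _,
    composable_qPlus_qMinus ℓ σ hη _ _, (hasSum_qPochSeriesTerm ℓ σ hη).summable,
    wronskian_eq ℓ σ hη θ⟩, ?_, ?_⟩⟩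
  · rintro t (rfl | rfl) Q
    · exact isBaxterSolution_iff_eq_baxterJ (NeZero.ne F) hq0 hq1 _ _ (tCoeff_top η ℓ σ)
        (commute_tCoeff η ℓ σ) Q
    · exact isBaxterSolution_iff_eq_baxterJ (NeZero.ne F) hq0 hq1 _ _ (tBar_top η ℓ σ)
        (commute_tBar η ℓ σ) Q
  · simp only [oscTraceTerm_eq ℓ σ θ hη]
    exact hasSum_localMinus ℓ σ θ hη
  · rintro ς rfl
    exact ⟨hasSum_permTraceTerm ℓ θ hη ς, cyclicShift_comp_qPlus ℓ θ hη ς⟩
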